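/- **Setting.** A monoidal $W^*$-category is a category $\mathcal C$ whose morphism spaces are complex Banach spaces with bilinear submultiplicative composition, isometric antilinear involutions $f\mapsto f^*$ satisfying $(fg)^*=g^*f^*$ and $\|f^*f\|=\|f\|^2$, and chosen Banach preduals (defining the ultraweak topologies), together with a monoidal structure $(\otimes,\mathbb 1)$ given by a bilinear $*$-preserving bifunctor, separately ultraweakly continuous on morphisms, and unitary associativity and unit isomorphisms. It is *concrete* if it is equipped with a strong monoidal, linear, $*$-preserving, ultraweakly continuous functor $\mathrm{For}$ to Hilbert spaces with the completed tensor product, with unitary monoidal structure maps. The Hilbert space underlying an object $H,K,L$ is denoted by $\mathcal H,\mathcal K,\mathcal L$; morphisms are identified with the operators underlying them and coherence isomorphisms are suppressed. $B(\cdot,\cdot)_*$ denotes the normal functionals, $K(\cdot,\cdot)$ the compact operators and $[\,\cdot\,]$ the norm-closed linear span. Let $\mathcal C$ be a concrete monoidal $W^*$-category with a unitary braiding $c_{H,K}\colon H\otimes K\to K\otimes H$ that is *bi-regular*: for all objects $H,K$, $$[(\mathrm{id}\otimes\omega)(c_{H,K})\mid\omega\in B(\mathcal K,\mathcal H)_*]=K(\mathcal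 H,\mathcal K),\qquad [(\omega\otimes\mathrm{id})(c_{H,K})\mid\omega\in B(\mathcal H,\mathcal K)_*]=K(\mathcal K,\mathcal H).$$ Let $F\in\mathrm{End}_{\mathcal C}(L\otimes L)$ be a *multiplicative unitary*, that is, a unitary with $$F_{23}F_{12}=F_{12}\,(c_{L,L}^{-1})_{12}\,F_{23}\,(c_{L,L})_{12}\,F_{23},$$ that is *bi-regular*: $$[(\mathrm{id}\otimes\omega)(c_{L,L}^{-1}F)\mid\omega\in B(\mathcal L)_*]=K(\mathcal L)=[(\omega\otimes\mathrm{id})(c_{L,L}F^*)\mid\omega\in B(\mathcal L)_*].$$ **The category $A(\mathcal C)$.** Objects are pairs $(H,A)$, where $H\in\mathcal C$ and $A\subseteq B(\mathcal H)$ is a non-degenerate $C^*$-subalgebra of the form $A=A(X):=[(\omega\otimes\mathrm{id})(X)\mid\omega\in B(\mathcal K)_*]$ for some $K\in\mathcal C$ and $X\in\mathrm{End}_{\mathcal C}(K\otimes H)$. Morphisms $(H_1,A_1)\to(H_2,A_2)$ are the non-degenerate $*$-homomorphisms $f\colon A_1\to M(A_2)$ of the form $f(a)=V(a\otimes\mathrm{id}_K)V^*$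 for some $K\in\mathcal C$ and some $V\in\mathrm{Hom}_{\mathcal C}(H_1\otimes K,H_2)$ that is a partial isometry; they are composed through their extensions to multiplier algebras. Put $(H_1,A_1)\boxtimes(H_2,A_2):=(H_1\otimes H_2,A_1\boxtimes A_2)$ with $$A_1\boxtimes A_2:=\bigl[(A_1\otimes\mathrm{id}_{H_2})\cdot c_{H_2,H_1}(A_2\otimes\mathrm{id}_{H_1})c_{H_2,H_1}^{-1}\bigr]\subseteq B(\mathcal H_1\otimes\mathcal H_2),$$ and write $a\boxtimes1:=a\otimes\mathrm{id}_{H_2}$ and $1\boxtimes b:=c_{H_2,H_1}(b\otimes\mathrm{id}_{H_1})c_{H_2,H_1}^{-1}$. **Monoidal categories of $C^*$-algebras.** Let $C^*\text{-Alg}$ be the category of $C^*$-algebras with the non-degenerate $*$-homomorphisms $A\to M(B)$ as morphisms $A\to B$. A monoidal category of $C^*$-algebras is a monoidal category $(\mathcal D,\boxtimes,\mathbb 1)$ with a faithful functor $\mathfrak A\colon\mathcal D\to C^*\text{-Alg}$ and natural transformations $\iota_{1;X,Y}\colon X\to X\boxtimes Y$ and $\iota_{2;X,Y}\colon Y\to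 X\boxtimes Y$ such that (suppressing $\mathfrak A$) $X\boxtimes Y=[\iota_1(X)\cdot\iota_2(Y)]$ and, up to associators, $$\iota_{1;X\boxtimes Y,Z}\,\iota_{1;X,Y}=\iota_{1;X,Y\boxtimes Z},\qquad \iota_{1;X\boxtimes Y,Z}\,\iota_{2;X,Y}=\iota_{2;X,Y\boxtimes Z}\,\iota_{1;Y,Z},\qquad \iota_{2;X\boxtimes Y,Z}=\iota_{2;X,Y\boxtimes Z}\,\iota_{2;Y,Z}.$$ A *bi-simplifiable $C^*$-bialgebra* in it is an object $A$ with a morphism $\Delta\colon A\to A\boxtimes A$ such that $(\Delta\boxtimes\mathrm{id})\Delta=(\mathrm{id}\boxtimes\Delta)\Delta$ (up to the associator) and $$A\boxtimes A=[\Delta(A)\cdot(A\boxtimes1)]=[\Delta(A)\cdot(1\boxtimes A)].$$ **Proposition.** The pair $(H_1\otimes H_2,A_1\boxtimes A_2)$ is an object of $A(\mathcal C)$ for all objects $(H_1,A_1),(H_2,A_2)$ of $A(\mathcal C)$, and $A(\mathcal C)$ is a monoidal category of $C^*$-algebras with this tensor product of objects, a unit object over $\mathbb 1$, the functor $(H,A)\mapsto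 A$, and the inclusions $\iota_1(a)=a\boxtimes1$ and $\iota_2(b)=1\boxtimes b$. Let $A(F):=[(\omega\otimes\mathrm{id})(F)\mid\omega\in B(\mathcal L)_*]$. Then $(L,A(F))$ is an object of $A(\mathcal C)$, the formula $\Delta(a):=F(a\otimes\mathrm{id}_L)F^*$ defines a morphism $\Delta\colon A(F)\to A(F)\boxtimes A(F)$ of $A(\mathcal C)$, and $(A(F),\Delta)$ is a bi-simplifiable $C^*$-bialgebra in $(A(\mathcal C),\boxtimes)$. -/

import Mathlib

open CategoryTheory MonoidalCategory
open scoped Topology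

universe u v w

noncomputable section

namespace BraidedMU

/-! ### Operators on Hilbert spaces -/

section Operators

/-- `[S]`: the closed linear span of a set. -/
def closedSpan {E : Type*} [NormedAddCommGroup E] [NormedSpace ℂ E] (S : Set E) :
    Submodule ℂ E :=
  (Submodule.span ℂ S).topologicalClosure

/-- The Hilbert space tensor product (completion of the algebraic tensor product). -/
abbrev HilbTensor (H K : Type*) [NormedAddCommGroup H] [InnerProductSpace ℂ H]
    [NormedAddCommGroup K] [InnerProductSpace ℂ K] :=
  UniformSpace.Completion (TensorProduct ℂ H K)

variable (H K : Type*) [NormedAddCommGroup H] [InnerProductSpace ℂ H]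
  [NormedAddCommGroup K] [InnerProductSpace ℂ K]

/-- The predual `B(H, K)_*`: the norm-closed linear span of the vector functionals
`T ↦ ⟨η, T ξ⟩`. -/
def normalFunctionals : Submodule ℂ (StrongDual ℂ (H →L[ℂ] K)) :=
  closedSpan {ω : StrongDual ℂ (H →L[ℂ] K) | ∃ (ξ : H) (η : K), ∀ T : H →L[ℂ] K, ω T = inner ℂ η (T ξ)}

/-- The ultraweak topology on `B(H, K)`. -/
@[reducible] def operatorUltraweak : TopologicalSpace (H →L[ℂ] K) :=
  TopologicalSpace.induced (fun T (ω : normalFunctionals H K) => ω.1 T) Pi.topologicalSpace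

/-- The compact operators `K(H, K)`. -/
abbrev compacts : Submodule ℂ (H →L[ℂ] K) := compactOperator (RingHom.id ℂ) H K

end Operators

/-! ### Monoidal `W^*`-categories -/

/-- A `W^*`-category: the morphism spaces are complex Banach spaces with bilinear submultiplicative
composition, an isometric antilinear contravariant involution `adj` (the `*` of a morphism) with
the `C^*`-identity, and each morphism space is the dual of a Banach space. -/
class WStarCategory (C : Type u) [Category.{v} C] where
  [normed : ∀ X Y : C, NormedAddCommGroup (X ⟶ Y)]
  [space : ∀ X Y : C, NormedSpace ℂ (X ⟶ Y)]
  complete : ∀ X Y : C, CompleteSpace (X ⟶ Y)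
  add_comp : ∀ {X Y Z : C} (f f' : X ⟶ Y) (g : Y ⟶ Z), (f + f') ≫ g = f ≫ g + f' ≫ g
  comp_add : ∀ {X Y Z : C} (f : X ⟶ Y) (g g' : Y ⟶ Z), f ≫ (g + g') = f ≫ g + f ≫ g'
  smul_comp : ∀ {X Y Z : C} (z : ℂ) (f : X ⟶ Y) (g : Y ⟶ Z), (z • f) ≫ g = z • (f ≫ g)
  comp_smul : ∀ {X Y Z : C} (z : ℂ) (f : X ⟶ Y) (g : Y ⟶ Z), f ≫ (z • g) = z • (f ≫ g)
  norm_comp_le : ∀ {X Y Z : C} (f : X ⟶ Y) (g : Y ⟶ Z), ‖f ≫ g‖ ≤ ‖f‖ * ‖g‖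
  adj : ∀ {X Y : C}, (X ⟶ Y) → (Y ⟶ X)
  adj_adj : ∀ {X Y : C} (f : X ⟶ Y), adj (adj f) = f
  adj_add : ∀ {X Y : C} (f g : X ⟶ Y), adj (f + g) = adj f + adj g
  adj_smul : ∀ {X Y : C} (z : ℂ) (f : X ⟶ Y), adj (z • f) = (starRingEnd ℂ) z • adj f
  adj_comp : ∀ {X Y Z : C} (f : X ⟶ Y) (g : Y ⟶ Z), adj (f ≫ g) = adj g ≫ adj f
  norm_adj : ∀ {X Y : C} (f : X ⟶ Y), ‖adj f‖ = ‖f‖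
  norm_comp_adj : ∀ {X Y : C} (f : X ⟶ Y), ‖f ≫ adj f‖ = ‖f‖ ^ 2
  /-- the preduals -/
  Predual : C → C → Type v
  [predualNormed : ∀ X Y : C, NormedAddCommGroup (Predual X Y)]
  [predualSpace : ∀ X Y : C, NormedSpace ℂ (Predual X Y)]
  predualComplete : ∀ X Y : C, CompleteSpace (Predual X Y)
  dualIso : ∀ X Y : C, (X ⟶ Y) ≃ₗᵢ[ℂ] StrongDual ℂ (Predual X Y)

attribute [reducible, instance] WStarCategory.normed WStarCategory.space WStarCategory.predualNormed
  WStarCategory.predualSpace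

open WStarCategory (adj)

section Categories

variable {C : Type u} [Category.{v} C] [WStarCategory C]

/-- The ultraweak topology on a morphism space: the weak-`*` topology from its predual. -/
@[reducible] def ultraweak (X Y : C) : TopologicalSpace (X ⟶ Y) :=
  TopologicalSpace.induced
    (fun f (p : WStarCategory.Predual X Y) => WStarCategory.dualIso X Y f p) Pi.topologicalSpace

/-- `f` is unitary: `f^* f = id` and `f f^* = id`. -/
def IsUnitaryMor {X Y : C} (f : X ⟶ Y) : Prop :=
  f ≫ adj f = 𝟙 X ∧ adj f ≫ f = 𝟙 Y

end Categories

/-- A monoidal `W^*`-category: `⊗` is a normal bilinear `*`-bifunctor and the coherence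
isomorphisms are unitary. -/
class MonoidalWStarCategory (C : Type u) [Category.{v} C] [WStarCategory C]
    [MonoidalCategory C] : Prop where
  add_tensor : ∀ {X Y X' Y' : C} (f f' : X ⟶ Y) (g : X' ⟶ Y'),
    (f + f') ⊗ₘ g = (f ⊗ₘ g) + (f' ⊗ₘ g)
  tensor_add : ∀ {X Y X' Y' : C} (f : X ⟶ Y) (g g' : X' ⟶ Y'),
    f ⊗ₘ (g + g') = (f ⊗ₘ g) + (f ⊗ₘ g')
  smul_tensor : ∀ {X Y X' Y' : C} (z : ℂ) (f : X ⟶ Y) (g : X' ⟶ Y'),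
    (z • f) ⊗ₘ g = z • (f ⊗ₘ g)
  tensor_smul : ∀ {X Y X' Y' : C} (z : ℂ) (f : X ⟶ Y) (g : X' ⟶ Y'),
    f ⊗ₘ (z • g) = z • (f ⊗ₘ g)
  adj_tensor : ∀ {X Y X' Y' : C} (f : X ⟶ Y) (g : X' ⟶ Y'), adj (f ⊗ₘ g) = adj f ⊗ₘ adj g
  normal_left : ∀ {X Y X' Y' : C} (g : X' ⟶ Y'),
    Continuous[ultraweak X Y, ultraweak (X ⊗ X') (Y ⊗ Y')] (fun f : X ⟶ Y => f ⊗ₘ g)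
  normal_right : ∀ {X Y X' Y' : C} (f : X ⟶ Y),
    Continuous[ultraweak X' Y', ultraweak (X ⊗ X') (Y ⊗ Y')] (fun g : X' ⟶ Y' => f ⊗ₘ g)
  associator_unitary : ∀ X Y Z : C, IsUnitaryMor (α_ X Y Z).hom
  leftUnitor_unitary : ∀ X : C, IsUnitaryMor (λ_ X).hom
  rightUnitor_unitary : ∀ X : C, IsUnitaryMor (ρ_ X).hom

/-- A normal strong monoidal `*`-functor to the category of Hilbert spaces with the completed tensor
product. The unitaries `μ` and `ε` are its monoidal structure; by density, naturality and coherence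
are expressed on elementary tensors. A monoidal `W^*`-category with such a functor is a concrete
monoidal `W^*`-category. -/
structure FibreFunctor (C : Type u) [Category.{v} C] [WStarCategory C] [MonoidalCategory C] where
  obj : C → Type w
  [normed : ∀ X, NormedAddCommGroup (obj X)]
  [innerSpace : ∀ X, InnerProductSpace ℂ (obj X)]
  [complete : ∀ X, CompleteSpace (obj X)]
  map : ∀ {X Y : C}, (X ⟶ Y) → (obj X →L[ℂ] obj Y)
  map_id : ∀ X : C, map (𝟙 X) = ContinuousLinearMap.id ℂ (obj X)
  map_comp : ∀ {X Y Z : C} (f : X ⟶ Y) (g : Y ⟶ Z), map (f ≫ g) = map g ∘L map f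
  map_add : ∀ {X Y : C} (f g : X ⟶ Y), map (f + g) = map f + map g
  map_smul : ∀ {X Y : C} (z : ℂ) (f : X ⟶ Y), map (z • f) = z • map f
  map_adj : ∀ {X Y : C} (f : X ⟶ Y), map (adj f) = ContinuousLinearMap.adjoint (map f)
  normal : ∀ X Y : C,
    Continuous[ultraweak X Y, operatorUltraweak (obj X) (obj Y)] (map : (X ⟶ Y) → _)
  μ : ∀ X Y : C, HilbTensor (obj X) (obj Y) ≃ₗᵢ[ℂ] obj (X ⊗ Y)
  ε : ℂ ≃ₗᵢ[ℂ] obj (𝟙_ C)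
  μ_natural : ∀ {X Y X' Y' : C} (f : X ⟶ Y) (g : X' ⟶ Y') (x : obj X) (x' : obj X'),
    map (f ⊗ₘ g) (μ X X' (TensorProduct.tmul ℂ x x' : TensorProduct ℂ (obj X) (obj X'))) =
      μ Y Y' (TensorProduct.tmul ℂ (map f x) (map g x') : TensorProduct ℂ (obj Y) (obj Y'))
  μ_assoc : ∀ (X Y Z : C) (x : obj X) (y : obj Y) (z : obj Z),
    map (α_ X Y Z).hom
        (μ (X ⊗ Y) Z (TensorProduct.tmul ℂ
          (μ X Y (TensorProduct.tmul ℂ x y : TensorProduct ℂ (obj X) (obj Y))) z :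
            TensorProduct ℂ (obj (X ⊗ Y)) (obj Z))) =
      μ X (Y ⊗ Z) (TensorProduct.tmul ℂ x
        (μ Y Z (TensorProduct.tmul ℂ y z : TensorProduct ℂ (obj Y) (obj Z))) :
          TensorProduct ℂ (obj X) (obj (Y ⊗ Z)))
  μ_leftUnit : ∀ (X : C) (x : obj X),
    map (λ_ X).hom
      (μ (𝟙_ C) X (TensorProduct.tmul ℂ (ε 1) x : TensorProduct ℂ (obj (𝟙_ C)) (obj X))) = x
  μ_rightUnit : ∀ (X : C) (x : obj X),
    map (ρ_ X).hom
      (μ X (𝟙_ C) (TensorProduct.tmul ℂ x (ε 1) : TensorProduct ℂ (obj X) (obj (𝟙_ C)))) = x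

attribute [instance] FibreFunctor.normed FibreFunctor.innerSpace FibreFunctor.complete

namespace FibreFunctor

variable {C : Type u} [Category.{v} C] [WStarCategory C] [MonoidalCategory C]
  (𝓕 : FibreFunctor.{u, v, w} C)

/-- The operator `|ξ⟩ ⊗ id : y ↦ ξ ⊗ y`. -/
def ketLeft {H : C} (ξ : 𝓕.obj H) (K : C) : 𝓕.obj K →L[ℂ] 𝓕.obj (H ⊗ K) :=
  (𝓕.μ H K).toContinuousLinearEquiv.toContinuousLinearMap ∘L
    UniformSpace.Completion.toComplL ∘L TensorProduct.mkL ℂ (𝓕.obj H) (𝓕.obj K) ξ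

/-- The operator `id ⊗ |ξ⟩ : x ↦ x ⊗ ξ`. -/
def ketRight (H : C) {K : C} (ξ : 𝓕.obj K) : 𝓕.obj H →L[ℂ] 𝓕.obj (H ⊗ K) :=
  (𝓕.μ H K).toContinuousLinearEquiv.toContinuousLinearMap ∘L
    UniformSpace.Completion.toComplL ∘L (TensorProduct.mkL ℂ (𝓕.obj H) (𝓕.obj K)).flip ξ

/-- The operator `a ⊗ id_Z`. -/
def amp {X Y : C} (a : 𝓕.obj X →L[ℂ] 𝓕.obj Y) (Z : C) :
    𝓕.obj (X ⊗ Z) →L[ℂ] 𝓕.obj (Y ⊗ Z) :=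
  (𝓕.μ Y Z).toContinuousLinearEquiv.toContinuousLinearMap ∘L
    (a.rTensor (𝓕.obj Z)).completion ∘L
      (𝓕.μ X Z).symm.toContinuousLinearEquiv.toContinuousLinearMap

/-- The slices `(id ⊗ ω)(T)`, where `ω` is a normal functional. The slice is the operator `S` whose
matrix coefficients are `⟨η, S ξ⟩ = ω((⟨η| ⊗ id) T (|ξ⟩ ⊗ id))`. -/
def rightSlices {H K H' K' : C} (T : 𝓕.obj (H ⊗ K) →L[ℂ] 𝓕.obj (H' ⊗ K')) :
    Set (𝓕.obj H →L[ℂ] 𝓕.obj H') :=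
  {S | ∃ ω ∈ normalFunctionals (𝓕.obj K) (𝓕.obj K'), ∀ (ξ : 𝓕.obj H) (η : 𝓕.obj H'),
    inner ℂ η (S ξ) =
      ω (ContinuousLinearMap.adjoint (𝓕.ketLeft η K') ∘L T ∘L 𝓕.ketLeft ξ K)}

/-- The slices `(ω ⊗ id)(T)`, where `ω` is a normal functional. -/
def leftSlices {H K H' K' : C} (T : 𝓕.obj (H ⊗ K) →L[ℂ] 𝓕.obj (H' ⊗ K')) :
    Set (𝓕.obj K →L[ℂ] 𝓕.obj K') :=
  {S | ∃ ω ∈ normalFunctionals (𝓕.obj H) (𝓕.obj H'), ∀ (ξ : 𝓕.obj K) (η : 𝓕.obj K'),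
    inner ℂ η (S ξ) =
      ω (ContinuousLinearMap.adjoint (𝓕.ketRight H' η) ∘L T ∘L 𝓕.ketRight H ξ)}

/-! Elementary facts about `a ⊗ id`, needed for the composition of morphisms below. -/

/-- The elementary tensor `x ⊗ y`. -/
def tmul {X Y : C} (x : 𝓕.obj X) (y : 𝓕.obj Y) : 𝓕.obj (X ⊗ Y) :=
  𝓕.μ X Y (TensorProduct.tmul ℂ x y : TensorProduct ℂ (𝓕.obj X) (𝓕.obj Y))

lemma ketLeft_apply {X Y : C} (x : 𝓕.obj X) (y : 𝓕.obj Y) :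
    𝓕.ketLeft x Y y = 𝓕.tmul x y := rfl

lemma ketRight_apply {X Y : C} (x : 𝓕.obj X) (y : 𝓕.obj Y) :
    𝓕.ketRight X y x = 𝓕.tmul x y := rfl

lemma amp_tmul {X Y : C} (a : 𝓕.obj X →L[ℂ] 𝓕.obj Y) (Z : C) (x : 𝓕.obj X) (z : 𝓕.obj Z) :
    𝓕.amp a Z (𝓕.tmul x z) = 𝓕.tmul (a x) z := by
  simp [amp, tmul]

lemma inner_tmul {X Y : C} (x x' : 𝓕.obj X) (y y' : 𝓕.obj Y) :
    inner ℂ (𝓕.tmul x y) (𝓕.tmul x' y') = inner ℂ x x' * inner ℂ y y' := by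
  simp [tmul]

lemma ext_tmul {X Y : C} {E : Type*} [NormedAddCommGroup E] [NormedSpace ℂ E]
    {S T : 𝓕.obj (X ⊗ Y) →L[ℂ] E}
    (h : ∀ x y, S (𝓕.tmul x y) = T (𝓕.tmul x y)) : S = T := by
  ext z
  obtain ⟨z, rfl⟩ := (𝓕.μ X Y).surjective z
  induction z using UniformSpace.Completion.induction_on with
  | hp => exact isClosed_eq (by fun_prop) (by fun_prop)
  | ih z =>
    induction z using TensorProduct.induction_on with
    | zero => simp only [UniformSpace.Completion.coe_zero, _root_.map_zero]
    | tmul x y => exact h x y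
    | add a b ha hb => simp only [UniformSpace.Completion.coe_add, _root_.map_add, ha, hb]

lemma amp_comp {X Y W : C} (a : 𝓕.obj X →L[ℂ] 𝓕.obj Y) (b : 𝓕.obj Y →L[ℂ] 𝓕.obj W) (Z : C) :
    𝓕.amp (b ∘L a) Z = 𝓕.amp b Z ∘L 𝓕.amp a Z := by
  apply 𝓕.ext_tmul
  intro x y
  simp [amp_tmul]

lemma amp_id (X Z : C) :
    𝓕.amp (ContinuousLinearMap.id ℂ (𝓕.obj X)) Z = ContinuousLinearMap.id ℂ _ := by
  apply 𝓕.ext_tmul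
  intro x y
  simp [amp_tmul]

lemma amp_adjoint {X Y : C} (a : 𝓕.obj X →L[ℂ] 𝓕.obj Y) (Z : C) :
    𝓕.amp (ContinuousLinearMap.adjoint a) Z = ContinuousLinearMap.adjoint (𝓕.amp a Z) := by
  apply 𝓕.ext_tmul
  intro y z
  refine ext_inner_right ℂ fun t => ?_
  have : (innerSL ℂ (𝓕.amp (ContinuousLinearMap.adjoint a) Z (𝓕.tmul y z))) =
      innerSL ℂ (ContinuousLinearMap.adjoint (𝓕.amp a Z) (𝓕.tmul y z)) := by
    apply 𝓕.ext_tmul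
    intro x z'
    simp [amp_tmul, inner_tmul, ContinuousLinearMap.adjoint_inner_left]
  exact congrArg (fun f => f t) this

lemma map_whiskerRight {X Y : C} (f : X ⟶ Y) (Z : C) : 𝓕.map (f ▷ Z) = 𝓕.amp (𝓕.map f) Z := by
  apply 𝓕.ext_tmul
  intro x z
  rw [amp_tmul, ← tensorHom_id]
  unfold tmul
  rw [μ_natural, map_id]
  rfl

lemma ext_tmul₃ {X Y Z : C} {E : Type*} [NormedAddCommGroup E] [NormedSpace ℂ E]
    {S T : 𝓕.obj ((X ⊗ Y) ⊗ Z) →L[ℂ] E}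
    (h : ∀ x y z, S (𝓕.tmul (𝓕.tmul x y) z) = T (𝓕.tmul (𝓕.tmul x y) z)) : S = T := by
  apply 𝓕.ext_tmul
  intro t z
  have : S ∘L 𝓕.ketRight (X ⊗ Y) z = T ∘L 𝓕.ketRight (X ⊗ Y) z := by
    apply 𝓕.ext_tmul
    intro x y
    simpa [ketRight_apply] using h x y z
  exact congrArg (fun f => f t) this

lemma map_associator_amp {X Y : C} (a : 𝓕.obj X →L[ℂ] 𝓕.obj Y) (K L : C) :
    𝓕.map (α_ Y K L).hom ∘L 𝓕.amp (𝓕.amp a K) L =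
      𝓕.amp a (K ⊗ L) ∘L 𝓕.map (α_ X K L).hom := by
  apply 𝓕.ext_tmul₃
  intro x y z
  simp only [ContinuousLinearMap.comp_apply, amp_tmul]
  have h := 𝓕.μ_assoc X K L x y z
  have h' := 𝓕.μ_assoc Y K L (a x) y z
  change 𝓕.map _ (𝓕.tmul (𝓕.tmul x y) z) = 𝓕.tmul x (𝓕.tmul y z) at h
  change 𝓕.map _ (𝓕.tmul (𝓕.tmul (a x) y) z) = 𝓕.tmul (a x) (𝓕.tmul y z) at h'
  rw [h, h', amp_tmul]

lemma map_rightUnitor_amp {X Y : C} (a : 𝓕.obj X →L[ℂ] 𝓕.obj Y) :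
    𝓕.map (ρ_ Y).hom ∘L 𝓕.amp a (𝟙_ C) = a ∘L 𝓕.map (ρ_ X).hom := by
  apply 𝓕.ext_tmul
  intro x t
  obtain ⟨s, rfl⟩ := 𝓕.ε.surjective t
  have key : ∀ (Z : C) (z : 𝓕.obj Z), 𝓕.map (ρ_ Z).hom (𝓕.tmul z (𝓕.ε s)) = s • z := by
    intro Z z
    have h : 𝓕.tmul z (𝓕.ε s) = s • 𝓕.tmul z (𝓕.ε 1) := by
      rw [← ketLeft_apply, ← ketLeft_apply, ← _root_.map_smul, ← _root_.map_smul]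
      simp
    rw [h, _root_.map_smul]
    exact congrArg (s • ·) (𝓕.μ_rightUnit Z z)
  simp [amp_tmul, key]

end FibreFunctor

/-! ### Braidings and multiplicative unitaries -/

section Braiding

variable {C : Type u} [Category.{v} C] [WStarCategory C] [MonoidalCategory C]
  [BraidedCategory C]

/-- The braiding is unitary, regular for `⊗`, and regular for the opposite tensor product:
`[(id ⊗ ω)(c_{H,K})] = K(H, K)` and `[(ω ⊗ id)(c_{H,K})] = K(K, H)`. -/
structure IsBiRegularBraiding (𝓕 : FibreFunctor.{u, v, w} C) : Prop where
  unitary : ∀ H K : C, IsUnitaryMor (β_ H K).hom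
  regular : ∀ H K : C,
    closedSpan (𝓕.rightSlices (𝓕.map (β_ H K).hom)) = compacts (𝓕.obj H) (𝓕.obj K)
  regular_op : ∀ H K : C,
    closedSpan (𝓕.leftSlices (𝓕.map (β_ H K).hom)) = compacts (𝓕.obj K) (𝓕.obj H)

/-- A unitary `F` on `L ⊗ L` with `F₂₃ F₁₂ = F₁₂ (c⁻¹)₁₂ F₂₃ c₁₂ F₂₃`, as endomorphisms
of `(L ⊗ L) ⊗ L`. -/
structure IsMultiplicativeUnitary {L : C} (F : L ⊗ L ⟶ L ⊗ L) : Prop where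
  unitary : IsUnitaryMor F
  pentagon :
    let F₁₂ : (L ⊗ L) ⊗ L ⟶ (L ⊗ L) ⊗ L := F ▷ L
    let F₂₃ : (L ⊗ L) ⊗ L ⟶ (L ⊗ L) ⊗ L := (α_ L L L).hom ≫ L ◁ F ≫ (α_ L L L).inv
    F₁₂ ≫ F₂₃ = F₂₃ ≫ (β_ L L).hom ▷ L ≫ F₂₃ ≫ (β_ L L).inv ▷ L ≫ F₁₂

/-- `F` is regular for `(⊗, c)`: `[(id ⊗ ω)(c⁻¹ F)] = K(L)`; and `F^*` is regular for the opposite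
tensor product with the braiding `c⁻¹`: `[(ω ⊗ id)(c F^*)] = K(L)`. -/
structure IsBiRegular (𝓕 : FibreFunctor.{u, v, w} C) {L : C} (F : L ⊗ L ⟶ L ⊗ L) : Prop where
  regular : closedSpan (𝓕.rightSlices (𝓕.map (F ≫ (β_ L L).inv))) =
    compacts (𝓕.obj L) (𝓕.obj L)
  regular_op : closedSpan (𝓕.leftSlices (𝓕.map (adj F ≫ (β_ L L).hom))) =
    compacts (𝓕.obj L) (𝓕.obj L)

end Braiding

/-! ### The category of `C^*`-algebras -/

/-- A norm-closed `*`-subalgebra of `B(H)` acting non-degenerately on `H`. -/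
structure IsNondegCStarSubalgebra {H : Type*} [NormedAddCommGroup H] [InnerProductSpace ℂ H]
    [CompleteSpace H] (A : Submodule ℂ (H →L[ℂ] H)) : Prop where
  isClosed : IsClosed (A : Set (H →L[ℂ] H))
  mul_mem : ∀ {a b}, a ∈ A → b ∈ A → a * b ∈ A
  star_mem : ∀ {a}, a ∈ A → star a ∈ A
  nondegenerate : closedSpan {y : H | ∃ a ∈ A, ∃ x : H, y = a x} = ⊤

/-- A `C^*`-algebra, given through a faithful non-degenerate representation on a Hilbert space. -/
structure CStarAlg where
  H : Type w
  [normed : NormedAddCommGroup H]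
  [innerSpace : InnerProductSpace ℂ H]
  [complete : CompleteSpace H]
  alg : Submodule ℂ (H →L[ℂ] H)
  isCStar : IsNondegCStarSubalgebra alg

attribute [instance] CStarAlg.normed CStarAlg.innerSpace CStarAlg.complete

namespace CStarAlg

/-- The multiplier algebra `M(A)`, realized as the idealizer of `A` in `B(H)`. -/
def mult (A : CStarAlg.{w}) : StarSubalgebra ℂ (A.H →L[ℂ] A.H) where
  carrier := {T | ∀ a ∈ A.alg, T * a ∈ A.alg ∧ a * T ∈ A.alg}
  mul_mem' {S T} hS hT a ha := by
    refine ⟨?_, ?_⟩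
    · rw [mul_assoc]; exact (hS _ (hT a ha).1).1
    · rw [← mul_assoc]; exact (hT _ (hS a ha).2).2
  add_mem' {S T} hS hT a ha := by
    rw [add_mul, mul_add]
    exact ⟨A.alg.add_mem (hS a ha).1 (hT a ha).1, A.alg.add_mem (hS a ha).2 (hT a ha).2⟩
  algebraMap_mem' z a ha := by
    rw [Algebra.algebraMap_eq_smul_one, smul_mul_assoc, mul_smul_comm, one_mul, mul_one]
    exact ⟨A.alg.smul_mem z ha, A.alg.smul_mem z ha⟩
  star_mem' {T} hT a ha := by
    have h := hT _ (A.isCStar.star_mem ha)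
    have h1 := A.isCStar.star_mem h.2
    have h2 := A.isCStar.star_mem h.1
    simp only [star_mul, star_star] at h1 h2
    exact ⟨h1, h2⟩

lemma isClosed_mult (A : CStarAlg.{w}) : IsClosed (A.mult : Set (A.H →L[ℂ] A.H)) := by
  have h : (A.mult : Set (A.H →L[ℂ] A.H)) =
      ⋂ a ∈ A.alg, {T | T * a ∈ A.alg} ∩ {T | a * T ∈ A.alg} := by
    ext T
    simp only [Set.mem_iInter, Set.mem_inter_iff, Set.mem_ofPred_eq]
    rfl
  rw [h]
  refine isClosed_biInter fun a _ => IsClosed.inter ?_ ?_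
  · exact A.isCStar.isClosed.preimage (f := fun T => T * a) (by fun_prop)
  · exact A.isCStar.isClosed.preimage (f := fun T => a * T) (by fun_prop)

instance (A : CStarAlg.{w}) : IsClosed (A.mult : Set (A.H →L[ℂ] A.H)) := A.isClosed_mult

/-- A morphism from `A` to `B` is a non-degenerate `*`-homomorphism `A → M(B)`. It is stored as its
unique extension to a unital `*`-homomorphism `M(A) → M(B)`. -/
structure Hom (A B : CStarAlg.{w}) where
  toHom : A.mult →⋆ₐ[ℂ] B.mult
  nondegenerate : closedSpan {T : B.H →L[ℂ] B.H |
    ∃ a : A.mult, a.1 ∈ A.alg ∧ ∃ b ∈ B.alg, T = (toHom a).1 * b} = B.alg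

lemma Hom.ext' {A B : CStarAlg.{w}} {f g : Hom A B} (h : f.toHom = g.toHom) : f = g := by
  cases f; cases g; cases h; rfl

lemma alg_le_mult (A : CStarAlg.{w}) {a : A.H →L[ℂ] A.H} (ha : a ∈ A.alg) : a ∈ A.mult :=
  fun _ hb => ⟨A.isCStar.mul_mem ha hb, A.isCStar.mul_mem hb ha⟩

lemma closedSpan_le {E : Type*} [NormedAddCommGroup E] [NormedSpace ℂ E] {S : Set E}
    {V : Submodule ℂ E} (hV : IsClosed (V : Set E)) (h : S ⊆ V) : closedSpan S ≤ V :=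
  Submodule.topologicalClosure_minimal _ (Submodule.span_le.2 h) hV

lemma subset_closedSpan {E : Type*} [NormedAddCommGroup E] [NormedSpace ℂ E] (S : Set E) :
    S ⊆ closedSpan S :=
  Submodule.subset_span.trans (Submodule.le_topologicalClosure _)

lemma isClosed_closedSpan {E : Type*} [NormedAddCommGroup E] [NormedSpace ℂ E] (S : Set E) :
    IsClosed (closedSpan S : Set E) :=
  Submodule.isClosed_topologicalClosure _

lemma mem_closure_mul {B : Type*} [NonUnitalCStarAlgebra B] (a : B) :
    a ∈ closure (Set.range fun b : B => a * b) := by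
  let _ := CStarAlgebra.spectralOrder B
  have := CStarAlgebra.spectralOrderedRing B
  have h := (CStarAlgebra.increasingApproximateUnit B).tendsto_mul_left a
  exact mem_closure_of_tendsto h (Filter.Eventually.of_forall fun b => ⟨b, rfl⟩)

/-- A `C^*`-algebra has dense products. -/
lemma closedSpan_mul (A : CStarAlg.{w}) :
    closedSpan {T : A.H →L[ℂ] A.H |
      ∃ a : A.mult, a.1 ∈ A.alg ∧ ∃ b ∈ A.alg, T = a.1 * b} = A.alg := by
  apply le_antisymm
  · refine closedSpan_le A.isCStar.isClosed ?_
    rintro _ ⟨a, ha, b, hb, rfl⟩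
    exact A.isCStar.mul_mem ha hb
  · intro a ha
    let B : NonUnitalStarSubalgebra ℂ (A.H →L[ℂ] A.H) :=
      { A.alg with
        mul_mem' := fun h h' => A.isCStar.mul_mem h h'
        star_mem' := fun h => A.isCStar.star_mem h }
    have : IsClosed (B : Set (A.H →L[ℂ] A.H)) := A.isCStar.isClosed
    have h := mem_closure_mul (B := B) ⟨a, ha⟩
    have h' := map_mem_closure (f := fun b : B => (b : A.H →L[ℂ] A.H)) continuous_subtype_val h
      (t := closedSpan {T : A.H →L[ℂ] A.H |
        ∃ a : A.mult, a.1 ∈ A.alg ∧ ∃ b ∈ A.alg, T = a.1 * b}) (by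
        rintro _ ⟨b, rfl⟩
        exact subset_closedSpan _ ⟨⟨a, A.alg_le_mult ha⟩, ha, b.1, b.2, rfl⟩)
    exact (isClosed_closedSpan _).closure_subset h'

lemma Hom.mul_mem {A B : CStarAlg.{w}} (f : Hom A B) (a : A.mult) {b : B.H →L[ℂ] B.H}
    (hb : b ∈ B.alg) : (f.toHom a).1 * b ∈ B.alg :=
  ((f.toHom a).2 b hb).1

lemma Hom.continuous {A B : CStarAlg.{w}} (f : Hom A B) : Continuous f.toHom :=
  AddMonoidHomClass.continuous_of_bound f.toHom 1
    (fun a => by simpa using NonUnitalStarAlgHom.norm_apply_le f.toHom a)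

/-- The identity morphism. -/
def Hom.id (A : CStarAlg.{w}) : Hom A A where
  toHom := StarAlgHom.id ℂ A.mult
  nondegenerate := A.closedSpan_mul

/-- Composition of morphisms, through the extensions to the multiplier algebras. -/
def Hom.comp {A B D : CStarAlg.{w}} (f : Hom A B) (g : Hom B D) : Hom A D where
  toHom := g.toHom.comp f.toHom
  nondegenerate := by
    apply le_antisymm
    · refine closedSpan_le D.isCStar.isClosed ?_
      rintro _ ⟨a, _, d, hd, rfl⟩
      exact g.mul_mem _ hd
    · set S := closedSpan {T : D.H →L[ℂ] D.H | ∃ a : A.mult, a.1 ∈ A.alg ∧ ∃ d ∈ D.alg,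
        T = ((g.toHom.comp f.toHom) a).1 * d} with hS
      have hScl : IsClosed (S : Set (D.H →L[ℂ] D.H)) := isClosed_closedSpan _
      rw [← g.nondegenerate]
      refine closedSpan_le hScl ?_
      rintro _ ⟨b, hb, d, hd, rfl⟩
      let V : Submodule ℂ B.mult :=
        S.comap ((LinearMap.mulRight ℂ d).comp
          ((D.mult.subtype.toAlgHom.toLinearMap).comp g.toHom.toAlgHom.toLinearMap))
      have hV : IsClosed (V : Set B.mult) := by
        have hc : Continuous fun x : B.mult => (g.toHom x).1 * d :=
          (continuous_subtype_val.comp g.continuous).mul continuous_const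
        exact hScl.preimage hc
      suffices hbV : b ∈ V from hbV
      have hle : closedSpan {T : B.H →L[ℂ] B.H | ∃ a : A.mult, a.1 ∈ A.alg ∧ ∃ b ∈ B.alg,
          T = (f.toHom a).1 * b} ≤ V.map B.mult.subtype.toAlgHom.toLinearMap := by
        refine closedSpan_le ?_ ?_
        · have := B.isClosed_mult.isClosedEmbedding_subtypeVal.isClosedMap _ hV
          exact this
        · rintro _ ⟨a, ha, b', hb', rfl⟩
          refine ⟨f.toHom a * ⟨b', B.alg_le_mult hb'⟩, ?_, rfl⟩
          change (g.toHom (f.toHom a * ⟨b', _⟩)).1 * d ∈ S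
          rw [map_mul]
          refine subset_closedSpan _ ⟨a, ha, (g.toHom ⟨b', B.alg_le_mult hb'⟩).1 * d,
            g.mul_mem _ hd, ?_⟩
          simp [mul_assoc]
      rw [f.nondegenerate] at hle
      obtain ⟨b', hb', hbb⟩ := hle hb
      have : b' = b := Subtype.ext hbb
      rwa [this] at hb'

/-- The category of `C^*`-algebras with non-degenerate `*`-homomorphisms into multiplier algebras as
morphisms. -/
instance : Category CStarAlg.{w} where
  Hom := Hom
  id := Hom.id
  comp := Hom.comp

/-- `[f(A) · g(B)]`, for morphisms `f : A ⟶ D` and `g : B ⟶ D`. -/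
def prodSpan {A B D : CStarAlg.{w}} (f : A ⟶ D) (g : B ⟶ D) : Submodule ℂ (D.H →L[ℂ] D.H) :=
  closedSpan {T | ∃ a : A.mult, a.1 ∈ A.alg ∧ ∃ b : B.mult, b.1 ∈ B.alg ∧
    T = (f.toHom a).1 * (g.toHom b).1}

/-- `D` is a crossed product of `A` and `B` with inclusions `f` and `g`. -/
def IsCrossedProduct {A B D : CStarAlg.{w}} (f : A ⟶ D) (g : B ⟶ D) : Prop :=
  D.alg = prodSpan f g

end CStarAlg

/-! ### Monoidal categories of `C^*`-algebras and bialgebras -/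

/-- A monoidal category of `C^*`-algebras. -/
structure MonoidalCategoryOfCStarAlgebras (D : Type u) [Category.{v} D] [MonoidalCategory D] where
  𝔄 : D ⥤ CStarAlg.{w}
  faithful : 𝔄.Faithful
  ι₁ : ∀ X Y : D, X ⟶ X ⊗ Y
  ι₂ : ∀ X Y : D, Y ⟶ X ⊗ Y
  ι₁_natural : ∀ {X Y X' Y' : D} (f : X ⟶ X') (g : Y ⟶ Y'),
    ι₁ X Y ≫ (f ⊗ₘ g) = f ≫ ι₁ X' Y'
  ι₂_natural : ∀ {X Y X' Y' : D} (f : X ⟶ X') (g : Y ⟶ Y'),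
    ι₂ X Y ≫ (f ⊗ₘ g) = g ≫ ι₂ X' Y'
  crossed : ∀ X Y : D, CStarAlg.IsCrossedProduct (𝔄.map (ι₁ X Y)) (𝔄.map (ι₂ X Y))
  ι₁_ι₁ : ∀ X Y Z : D,
    ι₁ X Y ≫ ι₁ (X ⊗ Y) Z ≫ (α_ X Y Z).hom = ι₁ X (Y ⊗ Z)
  ι₂_ι₁ : ∀ X Y Z : D,
    ι₂ X Y ≫ ι₁ (X ⊗ Y) Z ≫ (α_ X Y Z).hom = ι₁ Y Z ≫ ι₂ X (Y ⊗ Z)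
  ι₂_ι₂ : ∀ X Y Z : D,
    ι₂ (X ⊗ Y) Z ≫ (α_ X Y Z).hom = ι₂ Y Z ≫ ι₂ X (Y ⊗ Z)

namespace MonoidalCategoryOfCStarAlgebras

variable {D : Type u} [Category.{v} D] [MonoidalCategory D]
  (𝓜 : MonoidalCategoryOfCStarAlgebras.{u, v, w} D)

/-- `(A, Δ)` is a bi-simplifiable `C^*`-bialgebra: `Δ` is coassociative and the Podleś conditions
`A ⊠ A = [Δ(A) · (A ⊠ 1)] = [Δ(A) · (1 ⊠ A)]` hold. -/
structure IsBiSimplifiableBialgebra {A : D} (Δ : A ⟶ A ⊗ A) : Prop where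
  coassoc : Δ ≫ (Δ ⊗ₘ 𝟙 A) ≫ (α_ A A A).hom = Δ ≫ (𝟙 A ⊗ₘ Δ)
  podles₁ : (𝓜.𝔄.obj (A ⊗ A)).alg = CStarAlg.prodSpan (𝓜.𝔄.map Δ) (𝓜.𝔄.map (𝓜.ι₁ A A))
  podles₂ : (𝓜.𝔄.obj (A ⊗ A)).alg = CStarAlg.prodSpan (𝓜.𝔄.map Δ) (𝓜.𝔄.map (𝓜.ι₂ A A))

end MonoidalCategoryOfCStarAlgebras

/-! ### The category `A(C)` -/

section CategoryA

variable {C : Type u} [Category.{v} C] [WStarCategory C] [MonoidalCategory C]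

/-- `A(X)`, the closed linear span of the slices `(ω ⊗ id)(X)`. -/
def legAlgebra (𝓕 : FibreFunctor.{u, v, w} C) {K H : C} (X : K ⊗ H ⟶ K ⊗ H) :
    Submodule ℂ (𝓕.obj H →L[ℂ] 𝓕.obj H) :=
  closedSpan (𝓕.leftSlices (𝓕.map X))

/-- `(H, A)` is an object of `A(C)`: `A` is a non-degenerate `C^*`-subalgebra of `B(H)` of the form
`A(X)`. -/
structure IsObj (𝓕 : FibreFunctor.{u, v, w} C) (H : C)
    (A : Submodule ℂ (𝓕.obj H →L[ℂ] 𝓕.obj H)) : Prop where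
  isCStar : IsNondegCStarSubalgebra A
  exists_leg : ∃ (K : C) (X : K ⊗ H ⟶ K ⊗ H), A = legAlgebra 𝓕 X

/-- The objects of `A(C)`. -/
structure AObj (𝓕 : FibreFunctor.{u, v, w} C) where
  H : C
  alg : Submodule ℂ (𝓕.obj H →L[ℂ] 𝓕.obj H)
  isObj : IsObj 𝓕 H alg

namespace AObj

variable {𝓕 : FibreFunctor.{u, v, w} C}

/-- The underlying `C^*`-algebra. -/
abbrev toCStarAlg (P : AObj 𝓕) : CStarAlg.{w} where
  H := 𝓕.obj P.H
  alg := P.alg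
  isCStar := P.isObj.isCStar

/-- A morphism of `A(C)`: a morphism of `C^*`-algebras of the form `a ↦ V (a ⊗ id_K) V^*`, with a
morphism `V : H₁ ⊗ K ⟶ H₂` of the category that is a partial isometry. The extension of
`a ↦ V (a ⊗ id_K) V^*` to multipliers is given by the same formula. -/
structure Hom (P Q : AObj 𝓕) where
  toHom : P.toCStarAlg ⟶ Q.toCStarAlg
  exists_form : ∃ (K : C) (V : P.H ⊗ K ⟶ Q.H),
    𝓕.map V ∘L ContinuousLinearMap.adjoint (𝓕.map V) ∘L 𝓕.map V = 𝓕.map V ∧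
    ∀ m : P.toCStarAlg.mult, (toHom.toHom m).1 =
      𝓕.map V ∘L 𝓕.amp (X := P.H) (Y := P.H) m.1 K ∘L ContinuousLinearMap.adjoint (𝓕.map V)

lemma Hom.ext' {P Q : AObj 𝓕} {f g : Hom P Q} (h : f.toHom = g.toHom) : f = g := by
  cases f; cases g; cases h; rfl

variable [MonoidalWStarCategory C]

/-- The identity morphism, of the form `V (a ⊗ id) V^*` with `V : H ⊗ 𝟙 ⟶ H` the unit isomorphism. -/
def Hom.id (P : AObj 𝓕) : Hom P P where
  toHom := 𝟙 P.toCStarAlg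
  exists_form := by
    obtain ⟨h1, h2⟩ := MonoidalWStarCategory.rightUnitor_unitary P.H
    have h2' := congrArg 𝓕.map h2
    rw [𝓕.map_comp, 𝓕.map_id, 𝓕.map_adj] at h2'
    refine ⟨𝟙_ C, (ρ_ P.H).hom, ?_, fun m => ?_⟩
    · rw [← ContinuousLinearMap.comp_assoc, h2', ContinuousLinearMap.id_comp]
    · rw [← ContinuousLinearMap.comp_assoc, 𝓕.map_rightUnitor_amp (X := P.H) (Y := P.H) m.1,
        ContinuousLinearMap.comp_assoc, h2', ContinuousLinearMap.comp_id]
      rfl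

/-- Composition of morphisms. -/
def Hom.comp {P Q R : AObj 𝓕} (f : Hom P Q) (g : Hom Q R) : Hom P R where
  toHom := f.toHom ≫ g.toHom
  exists_form := by
    obtain ⟨K, V, _, hV⟩ := f.exists_form
    obtain ⟨K', V', _, hV'⟩ := g.exists_form
    obtain ⟨hα1, hα2⟩ := MonoidalWStarCategory.associator_unitary P.H K K'
    have hα : 𝓕.map (adj (α_ P.H K K').inv) = 𝓕.map (α_ P.H K K').hom := by
      congr 1
      have h := congrArg adj hα1
      have e : adj (α_ P.H K K').hom = (α_ P.H K K').inv := by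
        rw [← cancel_epi (α_ P.H K K').hom, hα1, Iso.hom_inv_id]
      rw [← e, WStarCategory.adj_adj]
    have key : ∀ m : P.toCStarAlg.mult, ((f.toHom ≫ g.toHom).toHom m).1 =
        𝓕.map ((α_ P.H K K').inv ≫ V ▷ K' ≫ V') ∘L
          𝓕.amp (X := P.H) (Y := P.H) m.1 (K ⊗ K') ∘L
          ContinuousLinearMap.adjoint (𝓕.map ((α_ P.H K K').inv ≫ V ▷ K' ≫ V')) := by
      intro m
      have h1 : ((f.toHom ≫ g.toHom).toHom m).1 = (g.toHom.toHom (f.toHom.toHom m)).1 := rfl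
      have h2 : 𝓕.map (α_ P.H K K').inv ∘L 𝓕.amp (X := P.H) (Y := P.H) m.1 (K ⊗ K') ∘L
          𝓕.map (α_ P.H K K').hom = 𝓕.amp (𝓕.amp (X := P.H) (Y := P.H) m.1 K) K' := by
        rw [← 𝓕.map_associator_amp, ← ContinuousLinearMap.comp_assoc, ← 𝓕.map_comp,
          Iso.hom_inv_id, 𝓕.map_id, ContinuousLinearMap.id_comp]
      rw [h1, hV', hV, 𝓕.amp_comp, 𝓕.amp_comp, ← h2, 𝓕.amp_adjoint, 𝓕.map_comp, 𝓕.map_comp,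
        𝓕.map_whiskerRight, ContinuousLinearMap.adjoint_comp, ContinuousLinearMap.adjoint_comp,
        ← 𝓕.map_adj (α_ P.H K K').inv, hα]
      simp only [ContinuousLinearMap.comp_assoc]
    refine ⟨K ⊗ K', (α_ P.H K K').inv ≫ V ▷ K' ≫ V', ?_, key⟩
    have h1 := key 1
    rw [map_one] at h1
    have h2 : 𝓕.amp (X := P.H) (Y := P.H) (1 : P.toCStarAlg.mult).1 (K ⊗ K') =
        ContinuousLinearMap.id ℂ _ := 𝓕.amp_id P.H (K ⊗ K')
    rw [h2, ContinuousLinearMap.id_comp] at h1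
    rw [← ContinuousLinearMap.comp_assoc, ← h1]
    rfl

/-- The category `A(C)`. -/
instance : Category (AObj 𝓕) where
  Hom := Hom
  id := Hom.id
  comp := Hom.comp

/-- The functor from `A(C)` to `C^*`-algebras. -/
def forget (𝓕 : FibreFunctor.{u, v, w} C) : AObj 𝓕 ⥤ CStarAlg.{w} where
  obj P := P.toCStarAlg
  map f := f.toHom

/-- The value `f(m)` of a morphism `f` at a multiplier `m`. -/
def Hom.val {P Q : AObj 𝓕} (f : P ⟶ Q) (m : P.toCStarAlg.mult) :
    𝓕.obj Q.H →L[ℂ] 𝓕.obj Q.H :=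
  (f.toHom.toHom m).1

variable [BraidedCategory C]

/-- `a ⊠ 1 = a ⊗ id`. -/
def inc₁ (P Q : AObj 𝓕) (a : 𝓕.obj P.H →L[ℂ] 𝓕.obj P.H) :
    𝓕.obj (P.H ⊗ Q.H) →L[ℂ] 𝓕.obj (P.H ⊗ Q.H) :=
  𝓕.amp a Q.H

/-- `1 ⊠ b = c (b ⊗ id) c⁻¹`, where `c` is the braiding `H₂ ⊗ H₁ ⟶ H₁ ⊗ H₂`. -/
def inc₂ (P Q : AObj 𝓕) (b : 𝓕.obj Q.H →L[ℂ] 𝓕.obj Q.H) :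
    𝓕.obj (P.H ⊗ Q.H) →L[ℂ] 𝓕.obj (P.H ⊗ Q.H) :=
  𝓕.map (β_ Q.H P.H).hom ∘L 𝓕.amp b P.H ∘L 𝓕.map (β_ Q.H P.H).inv

/-- `A₁ ⊠ A₂ = [(A₁ ⊠ 1) (1 ⊠ A₂)]`. -/
def boxAlg (P Q : AObj 𝓕) : Submodule ℂ (𝓕.obj (P.H ⊗ Q.H) →L[ℂ] 𝓕.obj (P.H ⊗ Q.H)) :=
  closedSpan {T | ∃ a ∈ P.alg, ∃ b ∈ Q.alg, T = inc₁ P Q a * inc₂ P Q b}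

end AObj

/-- The structure of a monoidal category of `C^*`-algebras on `A(C)`: the tensor product of objects
is `(H₁, A₁) ⊠ (H₂, A₂) = (H₁ ⊗ H₂, A₁ ⊠ A₂)`, the functor to `C^*`-algebras is the obvious one, and
the inclusions are `a ↦ a ⊠ 1` and `b ↦ 1 ⊠ b`. -/
structure BoxMonoidalCategory [MonoidalWStarCategory C] [BraidedCategory C]
    (𝓕 : FibreFunctor.{u, v, w} C) where
  isObj_box : ∀ P Q : AObj 𝓕, IsObj 𝓕 (P.H ⊗ Q.H) (AObj.boxAlg P Q)
  [monoidal : MonoidalCategory (AObj 𝓕)]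
  unit_eq : (𝟙_ (AObj 𝓕)).H = 𝟙_ C
  tensorObj_eq : ∀ P Q : AObj 𝓕, P ⊗ Q = ⟨P.H ⊗ Q.H, AObj.boxAlg P Q, isObj_box P Q⟩
  cstar : MonoidalCategoryOfCStarAlgebras.{_, _, w} (AObj 𝓕)
  functor_eq : cstar.𝔄 = AObj.forget 𝓕
  ι₁_eq : ∀ (P Q : AObj 𝓕) (m : P.toCStarAlg.mult), m.1 ∈ P.alg →
    AObj.Hom.val (cstar.ι₁ P Q ≫ eqToHom (tensorObj_eq P Q)) m = AObj.inc₁ P Q m.1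
  ι₂_eq : ∀ (P Q : AObj 𝓕) (m : Q.toCStarAlg.mult), m.1 ∈ Q.alg →
    AObj.Hom.val (cstar.ι₂ P Q ≫ eqToHom (tensorObj_eq P Q)) m = AObj.inc₂ P Q m.1

end CategoryA
end BraidedMU
end

/-!
All spaces of operators in the statement are norm-closed spans of products, and the proof turns the
manipulation of such spans into a diagram calculus. Norm-closed spaces of operators between the
Hilbert spaces underlying two objects compose by taking closed spans of products, and tensoring with
identities makes them the morphisms of a monoidal category with a dagger, into which `C` maps by
sending a morphism to its line (`OpCat`). The identity space is the line through the identity, and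
in each object there are, in addition, the spaces of all kets and all bras, that is, of the
operators `η ↦ ξ ⊗ η` and their adjoints (`KetBra`). A slice `[(ω ⊗ id)(X)]` becomes the composite
of a ket, the line of `X` and a bra. Since the compact operators are the closed span of the rank one
operators, regularity of the braiding or of `F` becomes an equation between a slice and the
composite of a bra and a ket, and the assertions about closed spans follow from it by sliding kets
and bras along naturality squares.

In this calculus, regularity of the braiding shows that `A₁ ⊠ 1` and `1 ⊠ A₂` commute as spaces
(`slice_comp_incR`, `incR_comp_slice`) and that `A₁ ⊠ A₂` is again a slice (`boxLeg`), so that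
`A₁ ⊠ A₂` is an object. The pentagon equation and regularity of `F` show that `A(F)` is closed under
products and adjoints (`slice_comp_slice`, `dag_slice`), and the pentagon equation also gives the
two density conditions for the comultiplication (`incR_comp_comul`, `slice_comp_comul`).

A morphism `a ↦ V (a ⊗ id) V^*` maps `1` to `1`, so that `V` is a coisometry (`Hom.exists_conj`),
and its multiplicativity makes `V` intertwine `a ⊗ id` with the image of `a`
(`intertwines_of_conj_mul_star`). Two morphisms out of `A₁` and `A₂` that are compressions of
`a ⊠ 1` and `1 ⊠ b` by the same coisometry are therefore the restrictions of a single morphism out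
of `A₁ ⊠ A₂` (`exists_boxDesc`); in particular `f ⊠ g` and the associators exist. A morphism out of
`A₁ ⊠ A₂` is determined by its restrictions to the two legs (`box_hom_ext`), which reduces functoriality,
naturality and the coherence conditions to equations between inclusions (`InclusionTensor`).

Both iterates of `Δ(a) = F (a ⊗ 1) F^*` are compressions of `a ⊗ 1 ⊗ 1` by products of copies of `F`
and the braiding. By the pentagon equation these products differ only by a unitary acting on the
second and third tensor factors, which commutes with `a ⊗ 1 ⊗ 1`; this is coassociativity
(`comul_coassoc`).
-/

noncomputable section

namespace BraidedMU

/-! ### Diagrams of operator spaces -/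

section Diagrams

/-- The formal properties of the category whose morphisms are norm-closed spaces of operators, with
closed linear spans of products as composition. There `ket V Z` is the space of all operators
`|v⟩ ⊗ id_Z` with `v ∈ V`, `bra V Z` is its adjoint, and `dag` takes the adjoints of all elements.
The unitary `U` corresponds to the line spanned by it, so that an equation between unitaries becomes
an equation of the same form here. -/
class KetBra (D : Type u) [Category.{v} D] [MonoidalCategory D] where
  ket : ∀ V Z : D, Z ⟶ V ⊗ Z
  bra : ∀ V Z : D, V ⊗ Z ⟶ Z
  dag : ∀ {X Y : D}, (X ⟶ Y) → (Y ⟶ X)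
  dag_dag : ∀ {X Y : D} (f : X ⟶ Y), dag (dag f) = f
  dag_comp : ∀ {X Y Z : D} (f : X ⟶ Y) (g : Y ⟶ Z), dag (f ≫ g) = dag g ≫ dag f
  dag_whiskerRight : ∀ {X Y : D} (f : X ⟶ Y) (Z : D), dag (f ▷ Z) = dag f ▷ Z
  dag_whiskerLeft : ∀ {X Y : D} (Z : D) (f : X ⟶ Y), dag (Z ◁ f) = Z ◁ dag f
  dag_associator : ∀ X Y Z : D, dag (α_ X Y Z).hom = (α_ X Y Z).inv
  dag_ket : ∀ V Z : D, dag (ket V Z) = bra V Z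
  ket_naturality : ∀ (V : D) {Z Z' : D} (f : Z ⟶ Z'), f ≫ ket V Z' = ket V Z ≫ V ◁ f
  ket_whiskerRight : ∀ V Z W : D, ket V Z ▷ W = ket V (Z ⊗ W) ≫ (α_ V Z W).inv
  ket_tensor : ∀ V W Z : D, ket (V ⊗ W) Z = ket W Z ≫ ket V (W ⊗ Z) ≫ (α_ V W Z).inv
  ket_bra_ket : ∀ V Z : D, ket V Z ≫ bra V Z ≫ ket V Z = ket V Z

namespace KetBra

variable {D : Type u} [Category.{v} D] [MonoidalCategory D]

/-- `f` slides through the crossings of `c`. In a category of operator spaces this fails for general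
spaces; it holds for those that come from morphisms of the underlying braided category. -/
structure Transparent (c : ∀ X Y : D, X ⊗ Y ≅ Y ⊗ X) {X : D} (f : X ⟶ X) : Prop where
  slide_left : ∀ Z, f ▷ Z ≫ (c X Z).hom = (c X Z).hom ≫ Z ◁ f
  slide_right : ∀ Z, Z ◁ f ≫ (c Z X).hom = (c Z X).hom ≫ f ▷ Z

/-- The inverse crossings. -/
abbrev reverse (c : ∀ X Y : D, X ⊗ Y ≅ Y ⊗ X) : ∀ X Y : D, X ⊗ Y ≅ Y ⊗ X :=
  fun X Y => (c Y X).symm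

variable {c : ∀ X Y : D, X ⊗ Y ≅ Y ⊗ X}

lemma Transparent.reverse {X : D} {f : X ⟶ X} (h : Transparent c f) :
    Transparent (reverse c) f where
  slide_left Z := by
    simp only [KetBra.reverse, Iso.symm_hom]
    rw [← cancel_epi (c Z X).hom, ← reassoc_of% (h.slide_right Z)]
    simp
  slide_right Z := by
    simp only [KetBra.reverse, Iso.symm_hom]
    rw [← cancel_epi (c X Z).hom, ← reassoc_of% (h.slide_left Z)]
    simp

variable [KetBra D]

lemma dag_associator_inv (X Y Z : D) : dag (α_ X Y Z).inv = (α_ X Y Z).hom := by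
  rw [← dag_associator, dag_dag]

lemma dag_bra (V Z : D) : dag (bra V Z) = ket V Z := by
  rw [← dag_ket, dag_dag]

lemma dag_injective {X Y : D} {f g : X ⟶ Y} (h : dag f = dag g) : f = g := by
  rw [← dag_dag f, h, dag_dag]

lemma bra_naturality (V : D) {Z Z' : D} (f : Z ⟶ Z') : bra V Z ≫ f = V ◁ f ≫ bra V Z' := by
  apply dag_injective
  simp only [dag_comp, dag_bra, dag_whiskerLeft, ket_naturality]

lemma bra_whiskerRight (V Z W : D) : bra V Z ▷ W = (α_ V Z W).hom ≫ bra V (Z ⊗ W) := by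
  apply dag_injective
  simp only [dag_comp, dag_bra, dag_whiskerRight, dag_associator, ket_whiskerRight]

lemma bra_tensor (V W Z : D) :
    bra (V ⊗ W) Z = (α_ V W Z).hom ≫ bra V (W ⊗ Z) ≫ bra W Z := by
  apply dag_injective
  simp only [dag_comp, dag_bra, dag_associator, ket_tensor, Category.assoc]

/-- The closed span of the slices `(ω ⊗ id)(X)`, with `ω` a normal functional on `B(K)`. -/
def slice {K H : D} (X : K ⊗ H ⟶ K ⊗ H) : H ⟶ H := ket K H ≫ X ≫ bra K H

lemma dag_slice {K H : D} (X : K ⊗ H ⟶ K ⊗ H) : dag (slice X) = slice (dag X) := by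
  simp only [slice, dag_comp, dag_bra, dag_ket, Category.assoc]

lemma slice_whiskerRight {K H : D} (X : K ⊗ H ⟶ K ⊗ H) (Z : D) :
    slice X ▷ Z = ket K (H ⊗ Z) ≫ (α_ K H Z).inv ≫ X ▷ Z ≫ (α_ K H Z).hom ≫ bra K (H ⊗ Z) := by
  simp only [slice, comp_whiskerRight, ket_whiskerRight, bra_whiskerRight, Category.assoc]

/-- `u` is unitary, and it permutes the vectors of the spaces it relates: the operators
`(u ⊗ id)(|v⟩ ⊗ id)` span the space of all `|w⟩ ⊗ id`. -/
def Absorbs {V W : D} (u : V ≅ W) : Prop :=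
  dag u.hom = u.inv ∧ ∀ Z, ket V Z ≫ u.hom ▷ Z = ket W Z

section

variable {V W : D} {u : V ≅ W}

lemma Absorbs.dag_inv (hu : Absorbs u) : dag u.inv = u.hom := by rw [← hu.1, dag_dag]

lemma Absorbs.symm (hu : Absorbs u) : Absorbs u.symm := by
  refine ⟨hu.dag_inv, fun Z => ?_⟩
  rw [← hu.2 Z, Category.assoc, ← comp_whiskerRight]
  simp

lemma Absorbs.bra (hu : Absorbs u) (Z : D) : u.hom ▷ Z ≫ bra W Z = bra V Z := by
  apply dag_injective
  simp only [dag_comp, dag_bra, dag_whiskerRight, hu.1]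
  exact hu.symm.2 Z

lemma Absorbs.ket_hom (hu : Absorbs u) (Z : D) : ket V Z ≫ u.hom ▷ Z = ket W Z := hu.2 Z

lemma Absorbs.ket_inv (hu : Absorbs u) (Z : D) : ket W Z ≫ u.inv ▷ Z = ket V Z := hu.symm.2 Z

lemma Absorbs.bra_inv (hu : Absorbs u) (Z : D) : u.inv ▷ Z ≫ KetBra.bra V Z = KetBra.bra W Z :=
  hu.symm.bra Z

end

/-- A braiding by unitaries with `[(ω ⊗ id)(c)] = K(K, H)`. Compact operators appear as the products
of kets and bras; `regular` is this equation tensored with `id_Z`. Naturality is not part of the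
structure, see `Transparent`. -/
structure RegularBraiding (c : ∀ X Y : D, X ⊗ Y ≅ Y ⊗ X) : Prop where
  hexagon_forward : ∀ X Y Z : D, (α_ X Y Z).hom ≫ (c X (Y ⊗ Z)).hom ≫ (α_ Y Z X).hom =
    (c X Y).hom ▷ Z ≫ (α_ Y X Z).hom ≫ Y ◁ (c X Z).hom
  hexagon_reverse : ∀ X Y Z : D, (α_ X Y Z).inv ≫ (c (X ⊗ Y) Z).hom ≫ (α_ Z X Y).inv =
    X ◁ (c Y Z).hom ≫ (α_ X Z Y).inv ≫ (c X Z).hom ▷ Y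
  absorbs : ∀ X Y : D, Absorbs (c X Y)
  regular : ∀ H K Z : D, (ket H K ≫ (c H K).hom ≫ bra K H) ▷ Z = bra K Z ≫ ket H Z

lemma RegularBraiding.reverse (hc : RegularBraiding c) : RegularBraiding (reverse c) where
  hexagon_forward X Y Z := by
    have h := hc.hexagon_reverse Y Z X
    rw [← cancel_mono ((α_ Y Z X).inv ≫ (c (Y ⊗ Z) X).hom ≫ (α_ X Y Z).inv)]
    nth_rw 2 [h]
    simp
  hexagon_reverse X Y Z := by
    have h := hc.hexagon_forward Z X Y
    rw [← cancel_mono ((α_ Z X Y).hom ≫ (c Z (X ⊗ Y)).hom ≫ (α_ X Y Z).hom)]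
    nth_rw 2 [h]
    simp
  absorbs X Y := (hc.absorbs Y X).symm
  regular H K Z := by
    apply dag_injective
    have := hc.regular K H Z
    simp only [dag_comp, dag_bra, dag_ket, dag_whiskerRight, Iso.symm_hom, (hc.absorbs K H).dag_inv]
    simpa using this

lemma Transparent.dag (hc : RegularBraiding c) {X : D} {f : X ⟶ X} (h : Transparent c f) :
    Transparent c (dag f) where
  slide_left Z := by
    apply dag_injective
    simp only [dag_comp, dag_whiskerLeft, dag_whiskerRight, dag_dag, (hc.absorbs _ _).1]
    exact (h.reverse.slide_right Z).symm
  slide_right Z := by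
    apply dag_injective
    simp only [dag_comp, dag_whiskerLeft, dag_whiskerRight, dag_dag, (hc.absorbs _ _).1]
    exact (h.reverse.slide_left Z).symm

lemma RegularBraiding.tensor_left (hc : RegularBraiding c) (X Y Z : D) :
    (c (X ⊗ Y) Z).hom = (α_ X Y Z).hom ≫ X ◁ (c Y Z).hom ≫ (α_ X Z Y).inv ≫ (c X Z).hom ▷ Y ≫
      (α_ Z X Y).hom := by
  have h := hc.hexagon_reverse X Y Z
  rw [← cancel_epi (α_ X Y Z).inv, ← cancel_mono (α_ Z X Y).inv]
  simpa using h

lemma RegularBraiding.tensor_right (hc : RegularBraiding c) (X Y Z : D) :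
    (c X (Y ⊗ Z)).hom = (α_ X Y Z).inv ≫ (c X Y).hom ▷ Z ≫ (α_ Y X Z).hom ≫ Y ◁ (c X Z).hom ≫
      (α_ Y Z X).inv := by
  have h := hc.hexagon_forward X Y Z
  rw [← cancel_epi (α_ X Y Z).hom, ← cancel_mono (α_ Y Z X).hom]
  simpa using h

/-- The slices of a transparent `Y` commute, as a space, past a crossing whose first output is
contracted. By regularity of `c`, a product of a bra and a ket is a slice of a crossing; `Y` then
slides through this crossing. -/
lemma bra_exchange (hc : RegularBraiding c) {K H : D} {Y : K ⊗ H ⟶ K ⊗ H}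
    (hY : Transparent c Y) (V : D) :
    (c H V).hom ≫ bra V H ≫ slice Y = slice Y ▷ V ≫ (c H V).hom ≫ bra V H := by
  have h1 := hc.hexagon_reverse K H V
  have h2 := hY.slide_left V
  calc (c H V).hom ≫ bra V H ≫ slice Y
      = (c H V).hom ≫ (bra V H ≫ ket K H) ≫ Y ≫ bra K H := by simp only [slice, Category.assoc]
    _ = ((c H V).hom ≫ ket K (V ⊗ H)) ≫ (α_ K V H).inv ≫ (c K V).hom ▷ H ≫ (α_ V K H).hom ≫
          (bra V (K ⊗ H) ≫ Y) ≫ bra K H := by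
        rw [← hc.regular]
        simp only [comp_whiskerRight, ket_whiskerRight, bra_whiskerRight, Category.assoc]
    _ = ket K (H ⊗ V) ≫ (K ◁ (c H V).hom ≫ (α_ K V H).inv ≫ (c K V).hom ▷ H) ≫ (α_ V K H).hom ≫
          V ◁ Y ≫ bra V (K ⊗ H) ≫ bra K H := by
        rw [ket_naturality, bra_naturality]
        simp only [Category.assoc]
    _ = ket K (H ⊗ V) ≫ (α_ K H V).inv ≫ Y ▷ V ≫ (c (K ⊗ H) V).hom ≫
          bra V (K ⊗ H) ≫ bra K H := by
        rw [← h1, reassoc_of% h2]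
        simp only [Category.assoc, Iso.inv_hom_id_assoc]
    _ = ket K (H ⊗ V) ≫ (α_ K H V).inv ≫ Y ▷ V ≫ (α_ K H V).hom ≫ K ◁ (c H V).hom ≫
          (α_ K V H).inv ≫ (c K V).hom ▷ H ≫ bra (V ⊗ K) H := by
        rw [hc.tensor_left, bra_tensor]
        simp only [Category.assoc]
    _ = ket K (H ⊗ V) ≫ (α_ K H V).inv ≫ Y ▷ V ≫ (α_ K H V).hom ≫ bra K (H ⊗ V) ≫ (c H V).hom ≫
          bra V H := by
        rw [(hc.absorbs K V).bra, bra_tensor, Iso.inv_hom_id_assoc, reassoc_of% bra_naturality]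
    _ = slice Y ▷ V ≫ (c H V).hom ≫ bra V H := by
        rw [slice_whiskerRight]
        simp only [Category.assoc]

/-- The adjoint of `bra_exchange`. -/
lemma ket_exchange (hc : RegularBraiding c) {K H : D} {Y : K ⊗ H ⟶ K ⊗ H}
    (hY : Transparent c Y) (hs : dag (slice Y) = slice Y) (V : D) :
    slice Y ≫ ket V H ≫ (c H V).inv = ket V H ≫ (c H V).inv ≫ slice Y ▷ V := by
  have h := congrArg dag (bra_exchange hc hY V)
  simpa only [dag_comp, dag_bra, dag_whiskerRight, (hc.absorbs H V).1, hs, Category.assoc] using h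

end KetBra
end Diagrams

/-! ### Multiplicative unitaries in diagrams -/

section Diagrams
namespace KetBra

variable {D : Type u} [Category.{v} D] [MonoidalCategory D]

/-- `f` acting on the second and third tensor factors. -/
def at₂₃ {L : D} (f : L ⊗ L ⟶ L ⊗ L) : (L ⊗ L) ⊗ L ⟶ (L ⊗ L) ⊗ L :=
  (α_ L L L).hom ≫ L ◁ f ≫ (α_ L L L).inv

section

variable {L : D} (f g : L ⊗ L ⟶ L ⊗ L)

lemma at₂₃_comp : at₂₃ (f ≫ g) = at₂₃ f ≫ at₂₃ g := by
  simp [at₂₃]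

lemma at₂₃_id : at₂₃ (𝟙 (L ⊗ L)) = 𝟙 _ := by
  simp [at₂₃]

instance [IsIso f] : IsIso (at₂₃ f) := by
  unfold at₂₃
  infer_instance

lemma at₂₃_exchange (A : L ⟶ L) : at₂₃ f ≫ A ▷ L ▷ L = A ▷ L ▷ L ≫ at₂₃ f := by
  have h := whisker_exchange A f
  simp only [whiskerRight_tensor, Category.assoc] at h
  simp only [at₂₃, Category.assoc]
  rw [← cancel_epi (α_ L L L).inv, ← cancel_mono (α_ L L L).hom]
  simpa using h

end

variable [KetBra D]
variable {c : ∀ X Y : D, X ⊗ Y ≅ Y ⊗ X}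

/-- The space of all `1 ⊠ b = c (b ⊗ id) c⁻¹` with `b ∈ B`. -/
def incR (c : ∀ X Y : D, X ⊗ Y ≅ Y ⊗ X) (H₁ : D) {H₂ : D} (B : H₂ ⟶ H₂) : H₁ ⊗ H₂ ⟶ H₁ ⊗ H₂ :=
  (c H₂ H₁).inv ≫ B ▷ H₁ ≫ (c H₂ H₁).hom

/-- A form of the product `A(X) ⊠ A(Y)` in which only the vectors of `K₁` are contracted. It shows
both that the product is a space of slices (`slice_boxLeg`) and, since `X` and `slice Y` act on
different tensor factors in the middle, that it equals its adjoint. -/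
lemma slice_comp_incR (hc : RegularBraiding c) {K₁ H₁ K₂ H₂ : D} {X : K₁ ⊗ H₁ ⟶ K₁ ⊗ H₁}
    {Y : K₂ ⊗ H₂ ⟶ K₂ ⊗ H₂} (hX : Transparent c X) (hY : Transparent c Y) :
    slice X ▷ H₂ ≫ incR c H₁ (slice Y) =
      ket K₁ (H₁ ⊗ H₂) ≫ (α_ K₁ H₁ H₂).inv ≫ (c H₂ (K₁ ⊗ H₁)).inv ≫ slice Y ▷ (K₁ ⊗ H₁) ≫
        H₂ ◁ X ≫ (c H₂ (K₁ ⊗ H₁)).hom ≫ (α_ K₁ H₁ H₂).hom ≫ bra K₁ (H₁ ⊗ H₂) := by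
  have hX' : X ▷ H₂ = (c H₂ (K₁ ⊗ H₁)).inv ≫ H₂ ◁ X ≫ (c H₂ (K₁ ⊗ H₁)).hom := by
    rw [hX.slide_right, Iso.inv_hom_id_assoc]
  have h1 : (c H₂ (K₁ ⊗ H₁)).hom ≫ (α_ K₁ H₁ H₂).hom ≫ K₁ ◁ (c H₂ H₁).inv =
      (α_ H₂ K₁ H₁).inv ≫ (c H₂ K₁).hom ▷ H₁ ≫ (α_ K₁ H₂ H₁).hom := by
    rw [hc.tensor_right]
    simp only [Category.assoc, Iso.inv_hom_id_assoc, ← whiskerLeft_comp, Iso.hom_inv_id,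
      whiskerLeft_id, Category.comp_id]
  have h2 := congrArg (· ▷ H₁) (bra_exchange hc hY K₁)
  simp only [comp_whiskerRight] at h2
  calc slice X ▷ H₂ ≫ incR c H₁ (slice Y)
      = ket K₁ (H₁ ⊗ H₂) ≫ (α_ K₁ H₁ H₂).inv ≫ X ▷ H₂ ≫ (α_ K₁ H₁ H₂).hom ≫
          (bra K₁ (H₁ ⊗ H₂) ≫ (c H₂ H₁).inv) ≫ slice Y ▷ H₁ ≫ (c H₂ H₁).hom := by
        simp only [slice_whiskerRight X, incR, Category.assoc]
    _ = ket K₁ (H₁ ⊗ H₂) ≫ (α_ K₁ H₁ H₂).inv ≫ (c H₂ (K₁ ⊗ H₁)).inv ≫ H₂ ◁ X ≫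
          ((c H₂ (K₁ ⊗ H₁)).hom ≫ (α_ K₁ H₁ H₂).hom ≫ K₁ ◁ (c H₂ H₁).inv) ≫
          bra K₁ (H₂ ⊗ H₁) ≫ slice Y ▷ H₁ ≫ (c H₂ H₁).hom := by
        rw [bra_naturality, hX']
        simp only [Category.assoc]
    _ = ket K₁ (H₁ ⊗ H₂) ≫ (α_ K₁ H₁ H₂).inv ≫ (c H₂ (K₁ ⊗ H₁)).inv ≫ H₂ ◁ X ≫
          (α_ H₂ K₁ H₁).inv ≫ ((c H₂ K₁).hom ▷ H₁ ≫ bra K₁ H₂ ▷ H₁ ≫ slice Y ▷ H₁) ≫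
          (c H₂ H₁).hom := by
        rw [h1, bra_whiskerRight]
        simp only [Category.assoc]
    _ = ket K₁ (H₁ ⊗ H₂) ≫ (α_ K₁ H₁ H₂).inv ≫ (c H₂ (K₁ ⊗ H₁)).inv ≫
          slice Y ▷ (K₁ ⊗ H₁) ≫ H₂ ◁ X ≫ (α_ H₂ K₁ H₁).inv ≫ (c H₂ K₁).hom ▷ H₁ ≫
          (α_ K₁ H₂ H₁).hom ≫ K₁ ◁ (c H₂ H₁).hom ≫ bra K₁ (H₁ ⊗ H₂) := by
        rw [h2, bra_whiskerRight, ← bra_naturality, ← whisker_exchange_assoc]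
        simp only [Category.assoc, whiskerRight_tensor, Iso.hom_inv_id_assoc]
    _ = _ := by
        rw [hc.tensor_right]
        simp only [Category.assoc, Iso.inv_hom_id_assoc]

/-- `(1 ⊠ A(Y)) (A(X) ⊠ 1) = (A(X) ⊠ 1) (1 ⊠ A(Y))`: the left side is the adjoint of the right
side. -/
lemma incR_comp_slice (hc : RegularBraiding c) {K₁ H₁ K₂ H₂ : D} {X : K₁ ⊗ H₁ ⟶ K₁ ⊗ H₁}
    {Y : K₂ ⊗ H₂ ⟶ K₂ ⊗ H₂} (hX : Transparent c X) (hY : Transparent c Y)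
    (hXs : dag (slice X) = slice X) (hYs : dag (slice Y) = slice Y) :
    incR c H₁ (slice Y) ≫ slice X ▷ H₂ = slice X ▷ H₂ ≫ incR c H₁ (slice Y) := by
  have h := congrArg dag (slice_comp_incR hc (hX.dag hc) hY)
  rw [← dag_slice, hXs] at h
  have e : dag (slice X ▷ H₂ ≫ incR c H₁ (slice Y)) = incR c H₁ (slice Y) ≫ slice X ▷ H₂ := by
    simp only [incR, dag_comp, dag_whiskerRight, hXs, hYs, (hc.absorbs _ _).1,
      (hc.absorbs _ _).dag_inv, Category.assoc]
  rw [← e, h, slice_comp_incR hc hX hY]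
  simp only [dag_comp, dag_whiskerRight, dag_whiskerLeft, dag_dag, hYs, (hc.absorbs _ _).1,
      (hc.absorbs _ _).dag_inv, Category.assoc, dag_ket, dag_bra, dag_associator,
      dag_associator_inv, whisker_exchange_assoc]

/-- A morphism whose slices span `A(X) ⊠ A(Y)`. -/
def boxLeg (c : ∀ X Y : D, X ⊗ Y ≅ Y ⊗ X) {K₁ H₁ K₂ H₂ : D} (X : K₁ ⊗ H₁ ⟶ K₁ ⊗ H₁)
    (Y : K₂ ⊗ H₂ ⟶ K₂ ⊗ H₂) : (K₂ ⊗ K₁) ⊗ (H₁ ⊗ H₂) ⟶ (K₂ ⊗ K₁) ⊗ (H₁ ⊗ H₂) :=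
  (α_ K₂ K₁ (H₁ ⊗ H₂)).hom ≫ K₂ ◁ ((α_ K₁ H₁ H₂).inv ≫ (c H₂ (K₁ ⊗ H₁)).inv) ≫
    (α_ K₂ H₂ (K₁ ⊗ H₁)).inv ≫ Y ▷ (K₁ ⊗ H₁) ≫ (α_ K₂ H₂ (K₁ ⊗ H₁)).hom ≫
      K₂ ◁ (H₂ ◁ X ≫ (c H₂ (K₁ ⊗ H₁)).hom ≫ (α_ K₁ H₁ H₂).hom) ≫ (α_ K₂ K₁ (H₁ ⊗ H₂)).inv

lemma slice_boxLeg (hc : RegularBraiding c) {K₁ H₁ K₂ H₂ : D} {X : K₁ ⊗ H₁ ⟶ K₁ ⊗ H₁}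
    {Y : K₂ ⊗ H₂ ⟶ K₂ ⊗ H₂} (hX : Transparent c X) (hY : Transparent c Y) :
    slice (boxLeg c X Y) = slice X ▷ H₂ ≫ incR c H₁ (slice Y) := by
  rw [slice_comp_incR hc hX hY, slice_whiskerRight Y, slice, boxLeg, ket_tensor, bra_tensor]
  simp only [Category.assoc, Iso.inv_hom_id_assoc]
  rw [← reassoc_of% bra_naturality, ← reassoc_of% ket_naturality]
  simp only [Category.assoc]

section

variable {L : D} (f : L ⊗ L ⟶ L ⊗ L)

lemma ket_at₂₃ : ket L L ▷ L ≫ at₂₃ f = f ≫ ket L L ▷ L := by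
  simp only [at₂₃, ket_whiskerRight, Category.assoc, Iso.inv_hom_id_assoc]
  rw [reassoc_of% ket_naturality]

lemma at₂₃_bra : at₂₃ f ≫ bra L L ▷ L = bra L L ▷ L ≫ f := by
  simp only [at₂₃, bra_whiskerRight, Category.assoc, Iso.inv_hom_id_assoc]
  rw [bra_naturality]

lemma ket_pair : ket (L ⊗ L) L = ket L L ≫ ket L L ▷ L := by
  rw [ket_tensor, ket_whiskerRight]

lemma bra_pair : bra (L ⊗ L) L = bra L L ▷ L ≫ bra L L := by
  rw [bra_tensor, bra_whiskerRight, Category.assoc]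

lemma slice_at₂₃ : slice (at₂₃ f) = slice f := by
  have h : ket L L ▷ L ≫ bra L L ▷ L ≫ bra L L = bra L L := by
    have h0 : bra L L ≫ ket L L ≫ bra L L = bra L L := by
      apply dag_injective
      simp only [dag_comp, dag_bra, dag_ket, Category.assoc, ket_bra_ket]
    rw [← bra_pair, bra_tensor, ket_whiskerRight]
    simp only [Category.assoc, Iso.inv_hom_id_assoc]
    rw [bra_naturality, ← reassoc_of% ket_naturality, h0]
  rw [slice, ket_pair, bra_pair]
  simp only [Category.assoc]
  rw [reassoc_of% ket_at₂₃, h]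
  simp only [slice]

lemma slice_whisker : ket L L ▷ L ≫ f ▷ L ≫ bra L L ▷ L = slice f ▷ L := by
  simp only [slice, comp_whiskerRight]

lemma slice_at₂₃_comp (g h : L ⊗ L ⟶ L ⊗ L) :
    slice (at₂₃ f ≫ g ▷ L ≫ at₂₃ h) = ket L L ≫ f ≫ slice g ▷ L ≫ h ≫ bra L L := by
  rw [slice, ket_pair, bra_pair, ← slice_whisker]
  simp only [Category.assoc]
  rw [reassoc_of% ket_at₂₃, reassoc_of% at₂₃_bra]

end

/-- A multiplicative unitary `F` with `[(ω ⊗ id)(c F^*)] = K(L)`; the compact operators are given by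
the products of kets and bras. -/
structure RegularMultiplicativeUnitary (c : ∀ X Y : D, X ⊗ Y ≅ Y ⊗ X) {L : D}
    (F : L ⊗ L ≅ L ⊗ L) : Prop where
  absorbs : Absorbs F
  transparent : Transparent c F.hom
  pentagon : F.hom ▷ L ≫ at₂₃ F.hom =
    at₂₃ F.hom ≫ (c L L).hom ▷ L ≫ at₂₃ F.hom ≫ (c L L).inv ▷ L ≫ F.hom ▷ L
  regular : ∀ Z, slice (F.inv ≫ (c L L).hom) ▷ Z = bra L Z ≫ ket L Z

namespace RegularMultiplicativeUnitary

variable {L : D} {F : L ⊗ L ≅ L ⊗ L}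

lemma pentagon' (hF : RegularMultiplicativeUnitary c F) :
    at₂₃ F.hom ≫ (c L L).hom ▷ L ≫ at₂₃ F.hom =
      F.hom ▷ L ≫ at₂₃ F.hom ≫ (F.inv ≫ (c L L).hom) ▷ L := by
  rw [reassoc_of% hF.pentagon]
  simp only [← comp_whiskerRight, Iso.hom_inv_id_assoc, Iso.inv_hom_id, id_whiskerRight,
    Category.comp_id]

/-- `A(F)` is closed under multiplication, and its products span it. Slicing both sides of the
pentagon equation gives `slice F` and, by regularity of the braiding, `slice F ≫ slice F`. -/
lemma slice_comp_slice (hc : RegularBraiding c) (hF : RegularMultiplicativeUnitary c F) :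
    slice F.hom ≫ slice F.hom = slice F.hom := by
  have h := congrArg slice hF.pentagon'
  have h2 : slice (F.hom ▷ L ≫ at₂₃ F.hom ≫ (F.inv ≫ (c L L).hom) ▷ L) = slice F.hom := by
    rw [← slice_at₂₃ F.hom]
    simp only [slice, Category.assoc, comp_whiskerRight]
    rw [reassoc_of% hF.absorbs.ket_hom, (hc.absorbs L L).bra, hF.absorbs.bra_inv]
  have h3 : slice (c L L).hom ▷ L = bra L L ≫ ket L L := hc.regular L L L
  rw [h2, slice_at₂₃_comp, h3] at h
  simpa only [slice, Category.assoc] using h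

/-- `[A(F)^* A(F)] = A(F)`, by slicing the pentagon equation in a form where regularity of `F`
applies. Hence `A(F)` is closed under adjoints. -/
lemma slice_comp_dag_slice (hc : RegularBraiding c) (hF : RegularMultiplicativeUnitary c F) :
    slice F.hom ≫ slice F.inv = slice F.hom := by
  have h : at₂₃ F.hom ≫ (F.inv ≫ (c L L).hom) ▷ L ≫ at₂₃ F.inv =
      F.inv ▷ L ≫ at₂₃ F.hom ≫ (c L L).hom ▷ L := by
    rw [← cancel_mono (at₂₃ F.hom), ← cancel_epi (F.hom ▷ L)]
    simp only [Category.assoc, ← at₂₃_comp, Iso.inv_hom_id, at₂₃_id, Category.comp_id]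
    rw [← hF.pentagon', hom_inv_whiskerRight_assoc]
  have h2 : slice (F.inv ▷ L ≫ at₂₃ F.hom ≫ (c L L).hom ▷ L) = slice F.hom := by
    rw [← slice_at₂₃ F.hom]
    simp only [slice, Category.assoc]
    rw [reassoc_of% hF.absorbs.ket_inv, (hc.absorbs L L).bra]
  rw [← h, slice_at₂₃_comp, hF.regular] at h2
  simpa only [slice, Category.assoc] using h2

lemma dag_slice (hc : RegularBraiding c) (hF : RegularMultiplicativeUnitary c F) :
    dag (slice F.hom) = slice F.hom := by
  have e : slice F.inv = dag (slice F.hom) := by rw [KetBra.dag_slice, hF.absorbs.1]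
  have h := hF.slice_comp_dag_slice hc
  rw [e] at h
  nth_rw 1 [← h]
  rw [dag_comp, dag_dag, h]

/-- `F` is a multiplier of `K(L) ⊗ A(F)`; this is the multiplier property contracted with vectors
of the first tensor factor. -/
lemma slice_ket (hc : RegularBraiding c) (hF : RegularMultiplicativeUnitary c F) :
    slice F.hom ≫ ket L L ≫ F.hom = slice F.hom ≫ ket L L := by
  have h := congrArg (fun f => ket (L ⊗ L) L ≫ f ≫ bra L L ▷ L) hF.pentagon'
  simp only [Category.assoc] at h
  rw [reassoc_of% hF.absorbs.ket_hom, ket_pair, Category.assoc, Category.assoc,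
    reassoc_of% ket_at₂₃, reassoc_of% ket_at₂₃, slice_whisker, at₂₃_bra, hF.regular] at h
  have h3 : slice (c L L).hom ▷ L = bra L L ≫ ket L L := hc.regular L L L
  rw [← slice_whisker] at h3
  rw [reassoc_of% h3] at h
  simpa only [slice, Category.assoc] using h

/-- `F₁₂` slides through the inverse crossing of the third factor with the first two. -/
lemma naturality (hc : RegularBraiding c) (hF : RegularMultiplicativeUnitary c F) :
    F.hom ▷ L ≫ at₂₃ (c L L).inv ≫ (c L L).inv ▷ L =
      at₂₃ (c L L).inv ≫ (c L L).inv ▷ L ≫ at₂₃ F.hom := by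
  have h := hF.transparent.reverse.slide_left L
  have e : (reverse c (L ⊗ L) L).hom = at₂₃ (c L L).inv ≫ (c L L).inv ▷ L ≫ (α_ L L L).hom := by
    rw [hc.reverse.tensor_left]
    simp [at₂₃, reverse]
  rw [e] at h
  rw [← cancel_mono (α_ L L L).hom]
  simp only [Category.assoc, h]
  simp [at₂₃]

/-- `F₂₃` conjugated by the braiding of the first two factors is `F₁₂` conjugated by the inverse
braiding of the last two factors: both let `F` act on the outer factors. -/
lemma conj_eq (hc : RegularBraiding c) (hF : RegularMultiplicativeUnitary c F) :
    (c L L).hom ▷ L ≫ at₂₃ F.hom ≫ (c L L).inv ▷ L =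
      at₂₃ (c L L).inv ≫ F.hom ▷ L ≫ at₂₃ (c L L).hom := by
  have h := hF.transparent.slide_left L
  have e : (c (L ⊗ L) L).hom = at₂₃ (c L L).hom ≫ (c L L).hom ▷ L ≫ (α_ L L L).hom := by
    rw [hc.tensor_left]
    simp [at₂₃]
  have h2 : F.hom ▷ L ≫ at₂₃ (c L L).hom ≫ (c L L).hom ▷ L =
      at₂₃ (c L L).hom ≫ (c L L).hom ▷ L ≫ at₂₃ F.hom := by
    rw [e] at h
    rw [← cancel_mono (α_ L L L).hom]
    simp only [Category.assoc, h]
    simp [at₂₃]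
  rw [← cancel_mono ((c L L).hom ▷ L), ← cancel_epi (at₂₃ (c L L).hom)]
  simp only [Category.assoc, inv_hom_whiskerRight, Category.comp_id, ← h2]
  rw [← Category.assoc (at₂₃ _) (at₂₃ _), ← at₂₃_comp, Iso.hom_inv_id, at₂₃_id, Category.id_comp]

/-- `[⟨v| F c⁻¹ (A(F) ⊗ id)] = [⟨v| c⁻¹ (A(F) ⊗ id)]`, by the pentagon equation and regularity
of `F` and of the braiding. -/
lemma slice_inv_bra (hc : RegularBraiding c) (hF : RegularMultiplicativeUnitary c F) :
    slice F.hom ▷ L ≫ (c L L).inv ≫ F.hom ≫ bra L L =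
      slice F.hom ▷ L ≫ (c L L).inv ≫ bra L L := by
  have hreg : slice ((c L L).inv ≫ F.hom) ▷ L = bra L L ≫ ket L L := by
    apply dag_injective
    have := hF.regular L
    rw [dag_whiskerRight, KetBra.dag_slice]
    simpa only [dag_comp, (hc.absorbs L L).dag_inv, hF.absorbs.1, dag_bra, dag_ket] using this
  have hnat : F.hom ▷ L ≫ at₂₃ (c L L).inv =
      at₂₃ (c L L).inv ≫ (c L L).inv ▷ L ≫ at₂₃ F.hom ≫ (c L L).hom ▷ L := by
    rw [← cancel_mono ((c L L).inv ▷ L)]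
    simpa using hF.naturality hc
  calc slice F.hom ▷ L ≫ (c L L).inv ≫ F.hom ≫ bra L L
      = ket L L ▷ L ≫ (F.hom ▷ L ≫ at₂₃ (c L L).inv) ≫ at₂₃ F.hom ≫ bra (L ⊗ L) L := by
        rw [bra_pair, reassoc_of% at₂₃_bra, Category.assoc, reassoc_of% at₂₃_bra, ← slice_whisker]
        simp only [Category.assoc]
    _ = ket L L ▷ L ≫ at₂₃ (c L L).inv ≫ (c L L).inv ▷ L ≫
          (at₂₃ F.hom ≫ (c L L).hom ▷ L ≫ at₂₃ F.hom) ≫ bra (L ⊗ L) L := by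
        rw [hnat]
        simp only [Category.assoc]
    _ = (c L L).inv ≫ ket L L ▷ L ≫ ((c L L).inv ≫ F.hom) ▷ L ≫ at₂₃ F.hom ≫
          bra (L ⊗ L) L := by
        rw [hF.pentagon', reassoc_of% ket_at₂₃]
        simp only [Category.assoc, comp_whiskerRight]
        rw [(hc.absorbs L L).bra, hF.absorbs.bra_inv]
    _ = (c L L).inv ≫ bra L L ≫ slice F.hom := by
        rw [bra_pair, reassoc_of% at₂₃_bra, reassoc_of% (slice_whisker ((c L L).inv ≫ F.hom)), hreg]
        simp only [slice, Category.assoc]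
    _ = _ := bra_exchange hc.reverse hF.transparent.reverse L

/-- The pentagon equation expresses the space of all `F (a ⊗ id) F^*`, `a ∈ A(F)`, by slices. -/
lemma comul_eq (hF : RegularMultiplicativeUnitary c F) :
    F.inv ≫ slice F.hom ▷ L ≫ F.hom =
      ket L L ▷ L ≫ ((c L L).hom ▷ L ≫ at₂₃ F.hom ≫ (c L L).inv ▷ L) ≫ F.hom ▷ L ≫
        bra L L ▷ L := by
  have h : at₂₃ F.inv ≫ F.hom ▷ L ≫ at₂₃ F.hom =
      ((c L L).hom ▷ L ≫ at₂₃ F.hom ≫ (c L L).inv ▷ L) ≫ F.hom ▷ L := by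
    rw [hF.pentagon, ← Category.assoc (at₂₃ _) (at₂₃ _), ← at₂₃_comp, Iso.inv_hom_id, at₂₃_id]
    simp only [Category.id_comp, Category.assoc]
  have h' := congrArg (fun f => ket L L ▷ L ≫ f ≫ bra L L ▷ L) h
  simp only [Category.assoc] at h' ⊢
  rw [← h', at₂₃_bra, reassoc_of% ket_at₂₃, reassoc_of% (slice_whisker F.hom)]

/-- `[Δ(A(F)) (1 ⊠ A(F))] = A(F) ⊠ A(F)`. -/
lemma incR_comp_comul (hc : RegularBraiding c) (hF : RegularMultiplicativeUnitary c F) :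
    incR c L (slice F.hom) ≫ F.inv ≫ slice F.hom ▷ L ≫ F.hom =
      incR c L (slice F.hom) ≫ slice F.hom ▷ L := by
  have h := congrArg (· ▷ L) (hF.slice_ket hc)
  simp only [comp_whiskerRight] at h
  rw [hF.comul_eq, hF.conj_eq hc, incR]
  simp only [Category.assoc]
  rw [reassoc_of% ket_at₂₃, Iso.hom_inv_id_assoc, reassoc_of% h, reassoc_of% ket_at₂₃,
    slice_whisker]

/-- `[Δ(A(F)) (A(F) ⊠ 1)] = A(F) ⊠ A(F)`. -/
lemma slice_comp_comul (hc : RegularBraiding c) (hF : RegularMultiplicativeUnitary c F) :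
    slice F.hom ▷ L ≫ F.inv ≫ slice F.hom ▷ L ≫ F.hom =
      slice F.hom ▷ L ≫ incR c L (slice F.hom) := by
  have h1 := congrArg (· ▷ L) (ket_exchange hc.reverse hF.transparent.reverse (hF.dag_slice hc) L)
  have h2 := congrArg (· ▷ L) (hF.slice_inv_bra hc)
  simp only [comp_whiskerRight, reverse, Iso.symm_inv] at h1 h2
  calc slice F.hom ▷ L ≫ F.inv ≫ slice F.hom ▷ L ≫ F.hom
      = (slice F.hom ▷ L ≫ ket L L ▷ L ≫ (c L L).hom ▷ L) ≫ at₂₃ F.hom ≫ (c L L).inv ▷ L ≫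
          F.hom ▷ L ≫ bra L L ▷ L := by
        rw [hF.comul_eq]
        simp only [Category.assoc]
    _ = ket L L ▷ L ≫ (c L L).hom ▷ L ≫ at₂₃ F.hom ≫ slice F.hom ▷ L ▷ L ≫ (c L L).inv ▷ L ≫
          F.hom ▷ L ≫ bra L L ▷ L := by
        rw [h1, reassoc_of% at₂₃_exchange]
        simp only [Category.assoc]
    _ = (slice F.hom ▷ L ≫ ket L L ▷ L ≫ (c L L).hom ▷ L) ≫ at₂₃ F.hom ≫ (c L L).inv ▷ L ≫
          bra L L ▷ L := by
        rw [h2, h1, reassoc_of% at₂₃_exchange]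
        simp only [Category.assoc]
    _ = slice F.hom ▷ L ≫ ket L L ▷ L ≫ ((c L L).hom ▷ L ≫ at₂₃ F.hom ≫ (c L L).inv ▷ L) ≫
          bra L L ▷ L := by
        simp only [Category.assoc]
    _ = _ := by
        rw [hF.conj_eq hc, incR]
        simp only [Category.assoc]
        rw [at₂₃_bra, reassoc_of% ket_at₂₃, reassoc_of% (slice_whisker F.hom)]

end RegularMultiplicativeUnitary
end KetBra
end Diagrams

/-! ### Unitary morphisms -/

section Unitary

variable {C : Type u} [Category.{v} C] [WStarCategory C]

lemma adj_id (X : C) : WStarCategory.adj (𝟙 X) = 𝟙 X := by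
  have h := WStarCategory.adj_comp (WStarCategory.adj (𝟙 X)) (𝟙 X)
  rw [Category.comp_id, WStarCategory.adj_adj, Category.comp_id] at h
  exact h.symm

lemma isUnitaryMor_id (X : C) : IsUnitaryMor (𝟙 X) :=
  ⟨by rw [adj_id, Category.comp_id], by rw [adj_id, Category.comp_id]⟩

lemma adj_hom_eq_inv {X Y : C} (f : X ≅ Y) (h : IsUnitaryMor f.hom) :
    WStarCategory.adj f.hom = f.inv := by
  rw [← cancel_epi f.hom, h.1, Iso.hom_inv_id]

lemma IsUnitaryMor.comp {X Y Z : C} {f : X ⟶ Y} {g : Y ⟶ Z} (hf : IsUnitaryMor f)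
    (hg : IsUnitaryMor g) : IsUnitaryMor (f ≫ g) := by
  refine ⟨?_, ?_⟩
  · rw [WStarCategory.adj_comp, Category.assoc, ← Category.assoc g, hg.1, Category.id_comp, hf.1]
  · rw [WStarCategory.adj_comp, Category.assoc, ← Category.assoc _ f, hf.2, Category.id_comp, hg.2]

lemma IsUnitaryMor.inv {X Y : C} {f : X ≅ Y} (hf : IsUnitaryMor f.hom) : IsUnitaryMor f.inv := by
  rw [← adj_hom_eq_inv f hf]
  refine ⟨?_, ?_⟩
  · rw [WStarCategory.adj_adj, hf.2]
  · rw [WStarCategory.adj_adj, hf.1]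

end Unitary

/-! ### Closed linear spans -/

section Spans

variable {E F G : Type*} [NormedAddCommGroup E] [NormedSpace ℂ E] [NormedAddCommGroup F]
  [NormedSpace ℂ F] [NormedAddCommGroup G] [NormedSpace ℂ G]

open CStarAlg (closedSpan_le subset_closedSpan isClosed_closedSpan)

lemma closedSpan_mono {S T : Set E} (h : S ⊆ T) : closedSpan S ≤ closedSpan T :=
  closedSpan_le (isClosed_closedSpan T) (h.trans (subset_closedSpan T))

lemma closedSpan_eq_of_isClosed {V : Submodule ℂ E} (hV : IsClosed (V : Set E)) :
    closedSpan (V : Set E) = V :=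
  le_antisymm (closedSpan_le hV subset_rfl) (subset_closedSpan _)

lemma closedSpan_eq_of_subset {S T : Set E} (h : S ⊆ closedSpan T) (h' : T ⊆ closedSpan S) :
    closedSpan S = closedSpan T :=
  le_antisymm (closedSpan_le (isClosed_closedSpan T) h)
    (closedSpan_le (isClosed_closedSpan S) h')

lemma map_mem_closedSpan {σ : ℂ →+* ℂ} (f : E →SL[σ] F) {S : Set E} {T : Set F}
    (h : ∀ x ∈ S, f x ∈ closedSpan T) {x : E} (hx : x ∈ closedSpan S) : f x ∈ closedSpan T := by
  have : closedSpan S ≤ (closedSpan T).comap (f : E →ₛₗ[σ] F) :=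
    closedSpan_le ((isClosed_closedSpan T).preimage f.continuous) h
  exact this hx

lemma closedSpan_image_closedSpan {σ : ℂ →+* ℂ} (f : E →SL[σ] F) (S : Set E) :
    closedSpan (f '' (closedSpan S : Set E)) = closedSpan (f '' S) := by
  refine closedSpan_eq_of_subset ?_
    (Set.Subset.trans (Set.image_mono (subset_closedSpan S)) (subset_closedSpan _))
  rintro _ ⟨x, hx, rfl⟩
  exact map_mem_closedSpan f (fun y hy => subset_closedSpan _ (Set.mem_image_of_mem f hy)) hx

lemma closedSpan_image2_closedSpan (f : E →L[ℂ] F →L[ℂ] G) (S : Set E) (T : Set F) :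
    closedSpan (Set.image2 (fun x y => f x y) (closedSpan S : Set E) (closedSpan T : Set F)) =
      closedSpan (Set.image2 (fun x y => f x y) S T) := by
  set U := closedSpan (Set.image2 (fun x y => f x y) S T) with hU
  have h0 : ∀ x ∈ S, ∀ y ∈ T, f x y ∈ U := fun x hx y hy =>
    subset_closedSpan _ (Set.mem_image2_of_mem hx hy)
  have h1 : ∀ x ∈ S, ∀ y ∈ closedSpan T, f x y ∈ U := fun x hx y hy =>
    map_mem_closedSpan (f x) (h0 x hx) hy
  have h2 : ∀ y ∈ closedSpan T, ∀ x ∈ closedSpan S, f x y ∈ U := fun y hy x hx =>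
    map_mem_closedSpan (f.flip y) (fun x' hx' => h1 x' hx' y hy) hx
  refine le_antisymm (closedSpan_le (isClosed_closedSpan _) ?_) (closedSpan_mono ?_)
  · rintro _ ⟨x, hx, y, hy, rfl⟩
    exact h2 y hy x hx
  · exact Set.image2_subset (subset_closedSpan S) (subset_closedSpan T)

end Spans

/-! ### Tensor products with identity operators -/

namespace FibreFunctor

variable {C : Type u} [Category.{v} C] [WStarCategory C] [MonoidalCategory C]
  (𝓕 : FibreFunctor.{u, v, w} C)

lemma norm_completion_le {E F : Type*} [NormedAddCommGroup E] [NormedSpace ℂ E]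
    [NormedAddCommGroup F] [NormedSpace ℂ F] (f : E →L[ℂ] F) : ‖f.completion‖ ≤ ‖f‖ := by
  refine ContinuousLinearMap.opNorm_le_bound _ (norm_nonneg _) fun x => ?_
  induction x using UniformSpace.Completion.induction_on with
  | hp => exact isClosed_le (by fun_prop) (by fun_prop)
  | ih x => simpa using f.le_opNorm x

lemma norm_amp_le {X Y : C} (a : 𝓕.obj X →L[ℂ] 𝓕.obj Y) (Z : C) : ‖𝓕.amp a Z‖ ≤ ‖a‖ := by
  refine ContinuousLinearMap.opNorm_le_bound _ (norm_nonneg _) fun x => ?_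
  have h := (a.rTensor (𝓕.obj Z)).completion.le_of_opNorm_le
    ((norm_completion_le _).trans (ContinuousLinearMap.norm_rTensor_le _ _)) ((𝓕.μ X Z).symm x)
  simpa [amp] using h

/-- The operator `id_Z ⊗ a`. -/
def wl (Z : C) {X Y : C} (a : 𝓕.obj X →L[ℂ] 𝓕.obj Y) :
    𝓕.obj (Z ⊗ X) →L[ℂ] 𝓕.obj (Z ⊗ Y) :=
  (𝓕.μ Z Y).toContinuousLinearEquiv.toContinuousLinearMap ∘L
    (a.lTensor (𝓕.obj Z)).completion ∘L
      (𝓕.μ Z X).symm.toContinuousLinearEquiv.toContinuousLinearMap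

lemma norm_wl_le (Z : C) {X Y : C} (a : 𝓕.obj X →L[ℂ] 𝓕.obj Y) : ‖𝓕.wl Z a‖ ≤ ‖a‖ := by
  have hl : ‖a.lTensor (𝓕.obj Z)‖ ≤ ‖a‖ := by
    refine ContinuousLinearMap.opNorm_le_bound _ (norm_nonneg _) fun x => ?_
    have h := (a.rTensor (𝓕.obj Z)).le_of_opNorm_le (ContinuousLinearMap.norm_rTensor_le _ _)
      (TensorProduct.commIsometry ℂ (𝓕.obj Z) (𝓕.obj X) x)
    rw [LinearIsometryEquiv.norm_map] at h
    refine le_trans (le_of_eq ?_) h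
    exact (TensorProduct.commIsometry ℂ (𝓕.obj Y) (𝓕.obj Z)).norm_map _
  refine ContinuousLinearMap.opNorm_le_bound _ (norm_nonneg _) fun x => ?_
  have h := (a.lTensor (𝓕.obj Z)).completion.le_of_opNorm_le
    ((norm_completion_le _).trans hl) ((𝓕.μ Z X).symm x)
  simpa [wl] using h

lemma wl_tmul (Z : C) {X Y : C} (a : 𝓕.obj X →L[ℂ] 𝓕.obj Y) (z : 𝓕.obj Z) (x : 𝓕.obj X) :
    𝓕.wl Z a (𝓕.tmul z x) = 𝓕.tmul z (a x) := by
  simp [wl, tmul]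

lemma wl_comp (Z : C) {X Y W : C} (a : 𝓕.obj X →L[ℂ] 𝓕.obj Y) (b : 𝓕.obj Y →L[ℂ] 𝓕.obj W) :
    𝓕.wl Z (b ∘L a) = 𝓕.wl Z b ∘L 𝓕.wl Z a := by
  apply 𝓕.ext_tmul
  intro x y
  simp [wl_tmul]

lemma wl_id (Z X : C) :
    𝓕.wl Z (ContinuousLinearMap.id ℂ (𝓕.obj X)) = ContinuousLinearMap.id ℂ _ := by
  apply 𝓕.ext_tmul
  intro x y
  simp [wl_tmul]

lemma wl_adjoint (Z : C) {X Y : C} (a : 𝓕.obj X →L[ℂ] 𝓕.obj Y) :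
    𝓕.wl Z (ContinuousLinearMap.adjoint a) = ContinuousLinearMap.adjoint (𝓕.wl Z a) := by
  apply 𝓕.ext_tmul
  intro z y
  refine ext_inner_right ℂ fun t => ?_
  have : (innerSL ℂ (𝓕.wl Z (ContinuousLinearMap.adjoint a) (𝓕.tmul z y))) =
      innerSL ℂ (ContinuousLinearMap.adjoint (𝓕.wl Z a) (𝓕.tmul z y)) := by
    apply 𝓕.ext_tmul
    intro z' x
    simp [wl_tmul, inner_tmul, ContinuousLinearMap.adjoint_inner_left]
  exact congrArg (fun f => f t) this

lemma map_whiskerLeft (Z : C) {X Y : C} (f : X ⟶ Y) : 𝓕.map (Z ◁ f) = 𝓕.wl Z (𝓕.map f) := by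
  apply 𝓕.ext_tmul
  intro z x
  rw [wl_tmul, ← id_tensorHom]
  unfold tmul
  rw [μ_natural, map_id]
  rfl

lemma wl_comp_amp {X Y X' Y' : C} (a : 𝓕.obj X →L[ℂ] 𝓕.obj Y) (b : 𝓕.obj X' →L[ℂ] 𝓕.obj Y') :
    𝓕.wl Y b ∘L 𝓕.amp a X' = 𝓕.amp a Y' ∘L 𝓕.wl X b := by
  apply 𝓕.ext_tmul
  intro x y
  simp [wl_tmul, amp_tmul]

lemma tmul_add_left {X Y : C} (x x' : 𝓕.obj X) (y : 𝓕.obj Y) :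
    𝓕.tmul (x + x') y = 𝓕.tmul x y + 𝓕.tmul x' y := by
  rw [← ketRight_apply, _root_.map_add]; rfl

lemma tmul_smul_left {X Y : C} (z : ℂ) (x : 𝓕.obj X) (y : 𝓕.obj Y) :
    𝓕.tmul (z • x) y = z • 𝓕.tmul x y := by
  rw [← ketRight_apply, _root_.map_smul]; rfl

lemma tmul_add_right {X Y : C} (x : 𝓕.obj X) (y y' : 𝓕.obj Y) :
    𝓕.tmul x (y + y') = 𝓕.tmul x y + 𝓕.tmul x y' := by
  rw [← ketLeft_apply, _root_.map_add]; rfl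

lemma tmul_smul_right {X Y : C} (z : ℂ) (x : 𝓕.obj X) (y : 𝓕.obj Y) :
    𝓕.tmul x (z • y) = z • 𝓕.tmul x y := by
  rw [← ketLeft_apply, _root_.map_smul]; rfl

lemma norm_tmul {X Y : C} (x : 𝓕.obj X) (y : 𝓕.obj Y) : ‖𝓕.tmul x y‖ = ‖x‖ * ‖y‖ := by
  simp [tmul]

/-- `a ↦ a ⊗ id` as a continuous linear map. -/
def ampL (X Y Z : C) : (𝓕.obj X →L[ℂ] 𝓕.obj Y) →L[ℂ] (𝓕.obj (X ⊗ Z) →L[ℂ] 𝓕.obj (Y ⊗ Z)) :=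
  LinearMap.mkContinuous
    { toFun := fun a => 𝓕.amp a Z
      map_add' := fun a b => 𝓕.ext_tmul fun x y => by simp [amp_tmul, tmul_add_left]
      map_smul' := fun z a => 𝓕.ext_tmul fun x y => by simp [amp_tmul, tmul_smul_left] }
    1 fun a => by simpa using 𝓕.norm_amp_le a Z

/-- `a ↦ id ⊗ a` as a continuous linear map. -/
def wlL (Z X Y : C) : (𝓕.obj X →L[ℂ] 𝓕.obj Y) →L[ℂ] (𝓕.obj (Z ⊗ X) →L[ℂ] 𝓕.obj (Z ⊗ Y)) :=
  LinearMap.mkContinuous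
    { toFun := fun a => 𝓕.wl Z a
      map_add' := fun a b => 𝓕.ext_tmul fun x y => by simp [wl_tmul, tmul_add_right]
      map_smul' := fun z a => 𝓕.ext_tmul fun x y => by simp [wl_tmul, tmul_smul_right] }
    1 fun a => by simpa using 𝓕.norm_wl_le Z a

/-- `ξ ↦ |ξ⟩ ⊗ id` as a continuous linear map. -/
def ketL (V Z : C) : 𝓕.obj V →L[ℂ] (𝓕.obj Z →L[ℂ] 𝓕.obj (V ⊗ Z)) :=
  LinearMap.mkContinuous
    { toFun := fun x => 𝓕.ketLeft x Z
      map_add' := fun a b => by ext y; simp [ketLeft_apply, tmul_add_left]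
      map_smul' := fun z a => by ext y; simp [ketLeft_apply, tmul_smul_left] }
    1 fun x => ContinuousLinearMap.opNorm_le_bound _ (by positivity) fun y => by
      simp [ketLeft_apply, norm_tmul]

lemma closedSpan_tmul (V W : C) :
    closedSpan (Set.range fun p : 𝓕.obj V × 𝓕.obj W => 𝓕.tmul p.1 p.2) = ⊤ := by
  rw [eq_top_iff]
  rintro z -
  obtain ⟨z, rfl⟩ := (𝓕.μ V W).surjective z
  induction z using UniformSpace.Completion.induction_on with
  | hp => exact (CStarAlg.isClosed_closedSpan _).preimage (𝓕.μ V W).continuous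
  | ih z =>
    induction z using TensorProduct.induction_on with
    | zero => simp only [UniformSpace.Completion.coe_zero, _root_.map_zero, Submodule.zero_mem]
    | tmul x y => exact CStarAlg.subset_closedSpan _ ⟨(x, y), rfl⟩
    | add a b ha hb =>
      simp only [UniformSpace.Completion.coe_add, _root_.map_add]
      exact Submodule.add_mem _ ha hb

lemma map_associator_tmul (X Y Z : C) (x : 𝓕.obj X) (y : 𝓕.obj Y) (z : 𝓕.obj Z) :
    𝓕.map (α_ X Y Z).hom (𝓕.tmul (𝓕.tmul x y) z) = 𝓕.tmul x (𝓕.tmul y z) :=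
  𝓕.μ_assoc X Y Z x y z

lemma map_inv_comp_map_hom {X Y : C} (f : X ≅ Y) :
    𝓕.map f.inv ∘L 𝓕.map f.hom = ContinuousLinearMap.id ℂ _ := by
  rw [← map_comp, Iso.hom_inv_id, map_id]

lemma map_hom_comp_map_inv {X Y : C} (f : X ≅ Y) :
    𝓕.map f.hom ∘L 𝓕.map f.inv = ContinuousLinearMap.id ℂ _ := by
  rw [← map_comp, Iso.inv_hom_id, map_id]

lemma map_inv_map_hom {X Y : C} (f : X ≅ Y) (x : 𝓕.obj X) : 𝓕.map f.inv (𝓕.map f.hom x) = x :=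
  congrArg (fun T => T x) (𝓕.map_inv_comp_map_hom f)

lemma map_hom_map_inv {X Y : C} (f : X ≅ Y) (y : 𝓕.obj Y) : 𝓕.map f.hom (𝓕.map f.inv y) = y :=
  congrArg (fun T => T y) (𝓕.map_hom_comp_map_inv f)

lemma map_associator_inv_tmul (X Y Z : C) (x : 𝓕.obj X) (y : 𝓕.obj Y) (z : 𝓕.obj Z) :
    𝓕.map (α_ X Y Z).inv (𝓕.tmul x (𝓕.tmul y z)) = 𝓕.tmul (𝓕.tmul x y) z := by
  rw [← map_associator_tmul, map_inv_map_hom]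

lemma map_associator_amp_wl {X Y : C} (V W : C) (a : 𝓕.obj X →L[ℂ] 𝓕.obj Y) :
    𝓕.map (α_ V Y W).hom ∘L 𝓕.amp (𝓕.wl V a) W =
      𝓕.wl V (𝓕.amp a W) ∘L 𝓕.map (α_ V X W).hom := by
  apply 𝓕.ext_tmul₃
  intro x y z
  simp [amp_tmul, wl_tmul, map_associator_tmul]

lemma map_associator_wl {X Y : C} (V W : C) (a : 𝓕.obj X →L[ℂ] 𝓕.obj Y) :
    𝓕.map (α_ V W Y).hom ∘L 𝓕.wl (V ⊗ W) a =
      𝓕.wl V (𝓕.wl W a) ∘L 𝓕.map (α_ V W X).hom := by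
  apply 𝓕.ext_tmul₃
  intro x y z
  simp [wl_tmul, map_associator_tmul]

lemma map_leftUnitor_tmul (X : C) (s : ℂ) (x : 𝓕.obj X) :
    𝓕.map (λ_ X).hom (𝓕.tmul (𝓕.ε s) x) = s • x := by
  have h : 𝓕.ε s = s • 𝓕.ε 1 := by rw [← _root_.map_smul]; simp
  rw [h, tmul_smul_left, _root_.map_smul]
  exact congrArg (s • ·) (𝓕.μ_leftUnit X x)

lemma map_leftUnitor_wl {X Y : C} (a : 𝓕.obj X →L[ℂ] 𝓕.obj Y) :
    𝓕.map (λ_ Y).hom ∘L 𝓕.wl (𝟙_ C) a = a ∘L 𝓕.map (λ_ X).hom := by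
  apply 𝓕.ext_tmul
  intro t x
  obtain ⟨s, rfl⟩ := 𝓕.ε.surjective t
  simp [wl_tmul, map_leftUnitor_tmul]

lemma ketLeft_comp {X Y : C} (V : C) (ξ : 𝓕.obj V) (a : 𝓕.obj X →L[ℂ] 𝓕.obj Y) :
    𝓕.ketLeft ξ Y ∘L a = 𝓕.wl V a ∘L 𝓕.ketLeft ξ X := by
  ext x
  simp [ketLeft_apply, wl_tmul]

lemma amp_ketLeft (V Z W : C) (ξ : 𝓕.obj V) :
    𝓕.amp (𝓕.ketLeft ξ Z) W = 𝓕.map (α_ V Z W).inv ∘L 𝓕.ketLeft ξ (Z ⊗ W) := by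
  apply 𝓕.ext_tmul
  intro x y
  simp [ketLeft_apply, amp_tmul, map_associator_inv_tmul]

lemma ketLeft_tmul (V W Z : C) (v : 𝓕.obj V) (x : 𝓕.obj W) :
    𝓕.ketLeft (𝓕.tmul v x) Z = 𝓕.map (α_ V W Z).inv ∘L 𝓕.ketLeft v (W ⊗ Z) ∘L 𝓕.ketLeft x Z := by
  ext z
  simp [ketLeft_apply, map_associator_inv_tmul]

lemma amp_comp_ketLeft {V W : C} (a : 𝓕.obj V →L[ℂ] 𝓕.obj W) (Z : C) (ξ : 𝓕.obj V) :
    𝓕.amp a Z ∘L 𝓕.ketLeft ξ Z = 𝓕.ketLeft (a ξ) Z := by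
  ext z
  simp [ketLeft_apply, amp_tmul]

lemma adjoint_ketLeft_tmul {V : C} (ξ x : 𝓕.obj V) {Z : C} (z : 𝓕.obj Z) :
    ContinuousLinearMap.adjoint (𝓕.ketLeft ξ Z) (𝓕.tmul x z) = inner ℂ ξ x • z := by
  refine ext_inner_left ℂ fun y => ?_
  rw [ContinuousLinearMap.adjoint_inner_right, ketLeft_apply, inner_tmul, inner_smul_right]

lemma adjoint_ketLeft_comp_ketLeft {V : C} (ξ η : 𝓕.obj V) (Z : C) :
    ContinuousLinearMap.adjoint (𝓕.ketLeft η Z) ∘L 𝓕.ketLeft ξ Z =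
      inner ℂ η ξ • ContinuousLinearMap.id ℂ _ := by
  ext z
  simp [ketLeft_apply, adjoint_ketLeft_tmul]

/-- `|x⟩⟨y| ⊗ id = (|x⟩ ⊗ id) (|y⟩ ⊗ id)^*`. -/
lemma amp_rankOne {V W : C} (x : 𝓕.obj W) (y : 𝓕.obj V) (Z : C) :
    𝓕.amp (InnerProductSpace.rankOne ℂ x y) Z =
      𝓕.ketLeft x Z ∘L ContinuousLinearMap.adjoint (𝓕.ketLeft y Z) := by
  apply 𝓕.ext_tmul
  intro v z
  simp [amp_tmul, ketLeft_apply, adjoint_ketLeft_tmul, tmul_smul_left]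

end FibreFunctor

/-! ### The category of operator spaces -/

/-- A monoidal category from whiskerings: the coherence of `⊗` on pairs of morphisms follows from
the naturality of the structure isomorphisms in each variable and the exchange law. -/
abbrev monoidalOfWhiskers {A : Type u} [Category.{v} A] [MonoidalCategoryStruct A]
    (tensorHom_def : ∀ {X₁ Y₁ X₂ Y₂ : A} (f : X₁ ⟶ Y₁) (g : X₂ ⟶ Y₂), f ⊗ₘ g = f ▷ X₂ ≫ Y₁ ◁ g)
    (id_whiskerRight : ∀ X Y : A, 𝟙 X ▷ Y = 𝟙 (X ⊗ Y))
    (whiskerLeft_id : ∀ X Y : A, X ◁ 𝟙 Y = 𝟙 (X ⊗ Y))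
    (comp_whiskerRight : ∀ {X Y Z : A} (f : X ⟶ Y) (g : Y ⟶ Z) (W : A),
      (f ≫ g) ▷ W = f ▷ W ≫ g ▷ W)
    (whiskerLeft_comp : ∀ (W : A) {X Y Z : A} (f : X ⟶ Y) (g : Y ⟶ Z),
      W ◁ (f ≫ g) = W ◁ f ≫ W ◁ g)
    (whisker_exchange : ∀ {X Y X' Y' : A} (f : X ⟶ Y) (g : X' ⟶ Y'),
      X ◁ g ≫ f ▷ Y' = f ▷ X' ≫ Y ◁ g)
    (associator_naturality_left : ∀ {X Y : A} (f : X ⟶ Y) (V W : A),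
      f ▷ V ▷ W ≫ (α_ Y V W).hom = (α_ X V W).hom ≫ f ▷ (V ⊗ W))
    (associator_naturality_middle : ∀ {X Y : A} (V : A) (f : X ⟶ Y) (W : A),
      (V ◁ f) ▷ W ≫ (α_ V Y W).hom = (α_ V X W).hom ≫ V ◁ f ▷ W)
    (associator_naturality_right : ∀ {X Y : A} (V W : A) (f : X ⟶ Y),
      (V ⊗ W) ◁ f ≫ (α_ V W Y).hom = (α_ V W X).hom ≫ V ◁ W ◁ f)
    (leftUnitor_naturality : ∀ {X Y : A} (f : X ⟶ Y),
      𝟙_ A ◁ f ≫ (λ_ Y).hom = (λ_ X).hom ≫ f)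
    (rightUnitor_naturality : ∀ {X Y : A} (f : X ⟶ Y),
      f ▷ 𝟙_ A ≫ (ρ_ Y).hom = (ρ_ X).hom ≫ f)
    (pentagon : ∀ W X Y Z : A, (α_ W X Y).hom ▷ Z ≫ (α_ W (X ⊗ Y) Z).hom ≫ W ◁ (α_ X Y Z).hom =
      (α_ (W ⊗ X) Y Z).hom ≫ (α_ W X (Y ⊗ Z)).hom)
    (triangle : ∀ X Y : A, (α_ X (𝟙_ A) Y).hom ≫ X ◁ (λ_ Y).hom = (ρ_ X).hom ▷ Y) :
    MonoidalCategory A where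
  tensorHom_def := tensorHom_def
  id_tensorHom_id X Y := by
    rw [tensorHom_def, id_whiskerRight, whiskerLeft_id, Category.comp_id]
  tensorHom_comp_tensorHom {X₁ Y₁ Z₁ X₂ Y₂ Z₂} f₁ f₂ g₁ g₂ := by
    simp only [tensorHom_def, comp_whiskerRight, whiskerLeft_comp, Category.assoc]
    rw [← Category.assoc (Y₁ ◁ f₂), whisker_exchange]
    simp only [Category.assoc]
  whiskerLeft_id := whiskerLeft_id
  id_whiskerRight := id_whiskerRight
  associator_naturality {X₁ X₂ X₃ Y₁ Y₂ Y₃} f₁ f₂ f₃ := by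
    simp only [tensorHom_def, comp_whiskerRight, whiskerLeft_comp, Category.assoc]
    rw [associator_naturality_right, ← Category.assoc ((Y₁ ◁ f₂) ▷ X₃),
      associator_naturality_middle, Category.assoc, ← Category.assoc,
      associator_naturality_left, Category.assoc]
  leftUnitor_naturality := leftUnitor_naturality
  rightUnitor_naturality := rightUnitor_naturality
  pentagon := pentagon
  triangle := triangle

section OperatorSpaces

variable {C : Type u} [Category.{v} C] [WStarCategory C] [MonoidalCategory C]

/-- A norm-closed space of operators. -/
@[ext]
structure OpSpace (𝓕 : FibreFunctor.{u, v, w} C) (X Y : C) where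
  carrier : Submodule ℂ (𝓕.obj X →L[ℂ] 𝓕.obj Y)
  isClosed : IsClosed (carrier : Set (𝓕.obj X →L[ℂ] 𝓕.obj Y))

namespace OpSpace

variable {𝓕 : FibreFunctor.{u, v, w} C}

/-- The norm-closed linear span of a set of operators. -/
def span {X Y : C} (S : Set (𝓕.obj X →L[ℂ] 𝓕.obj Y)) : OpSpace 𝓕 X Y :=
  ⟨closedSpan S, CStarAlg.isClosed_closedSpan S⟩

lemma exists_span {X Y : C} (f : OpSpace 𝓕 X Y) : ∃ S, f = span S :=
  ⟨_, (OpSpace.ext (closedSpan_eq_of_isClosed f.isClosed)).symm⟩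

/-- The products `t s` with `s ∈ S` and `t ∈ T`. -/
def compSet {X Y Z : C} (S : Set (𝓕.obj X →L[ℂ] 𝓕.obj Y)) (T : Set (𝓕.obj Y →L[ℂ] 𝓕.obj Z)) :
    Set (𝓕.obj X →L[ℂ] 𝓕.obj Z) := Set.image2 (fun s t => t ∘L s) S T

/-- The closed linear span of the products, in the order of composition of morphisms. -/
def comp {X Y Z : C} (f : OpSpace 𝓕 X Y) (g : OpSpace 𝓕 Y Z) : OpSpace 𝓕 X Z :=
  span (compSet (f.carrier : Set (𝓕.obj X →L[ℂ] 𝓕.obj Y)) g.carrier)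

/-- The multiples of the operator underlying a morphism. -/
def of {X Y : C} (f : X ⟶ Y) : OpSpace 𝓕 X Y := span {𝓕.map f}

/-- The closed span of the operators `a ⊗ id_Z`, `a ∈ f`. -/
def whiskerRight {X Y : C} (f : OpSpace 𝓕 X Y) (Z : C) : OpSpace 𝓕 (X ⊗ Z) (Y ⊗ Z) :=
  span ((fun a => 𝓕.amp a Z) '' (f.carrier : Set (𝓕.obj X →L[ℂ] 𝓕.obj Y)))

/-- The closed span of the operators `id_Z ⊗ a`, `a ∈ f`. -/
def whiskerLeft (Z : C) {X Y : C} (f : OpSpace 𝓕 X Y) : OpSpace 𝓕 (Z ⊗ X) (Z ⊗ Y) :=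
  span ((fun a => 𝓕.wl Z a) '' (f.carrier : Set (𝓕.obj X →L[ℂ] 𝓕.obj Y)))

/-- The adjoints of the operators in `f`. -/
def dag {X Y : C} (f : OpSpace 𝓕 X Y) : OpSpace 𝓕 Y X :=
  span ((fun a => ContinuousLinearMap.adjoint a) '' (f.carrier : Set (𝓕.obj X →L[ℂ] 𝓕.obj Y)))

/-- The space of all operators `|ξ⟩ ⊗ id_Z`. -/
def ket (𝓕 : FibreFunctor.{u, v, w} C) (V Z : C) : OpSpace 𝓕 Z (V ⊗ Z) :=
  span (Set.range fun ξ => 𝓕.ketLeft ξ Z)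

/-- The space of all operators `⟨ξ| ⊗ id_Z`. -/
def bra (𝓕 : FibreFunctor.{u, v, w} C) (V Z : C) : OpSpace 𝓕 (V ⊗ Z) Z :=
  span (Set.range fun ξ => ContinuousLinearMap.adjoint (𝓕.ketLeft ξ Z))

lemma comp_span {X Y Z : C} (S : Set (𝓕.obj X →L[ℂ] 𝓕.obj Y))
    (T : Set (𝓕.obj Y →L[ℂ] 𝓕.obj Z)) : comp (span S) (span T) = span (compSet S T) :=
  OpSpace.ext (closedSpan_image2_closedSpan
    (ContinuousLinearMap.compL ℂ (𝓕.obj X) (𝓕.obj Y) (𝓕.obj Z)).flip S T)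

lemma span_whiskerRight {X Y : C} (S : Set (𝓕.obj X →L[ℂ] 𝓕.obj Y)) (Z : C) :
    whiskerRight (span S) Z = span ((fun a => 𝓕.amp a Z) '' S) :=
  OpSpace.ext (closedSpan_image_closedSpan (𝓕.ampL X Y Z) S)

lemma whiskerLeft_span (Z : C) {X Y : C} (S : Set (𝓕.obj X →L[ℂ] 𝓕.obj Y)) :
    whiskerLeft Z (span S) = span ((fun a => 𝓕.wl Z a) '' S) :=
  OpSpace.ext (closedSpan_image_closedSpan (𝓕.wlL Z X Y) S)

lemma dag_span {X Y : C} (S : Set (𝓕.obj X →L[ℂ] 𝓕.obj Y)) :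
    dag (span S) = span ((fun a => ContinuousLinearMap.adjoint a) '' S) :=
  OpSpace.ext (closedSpan_image_closedSpan
    (ContinuousLinearMap.adjoint (𝕜 := ℂ) (E := 𝓕.obj X) (F := 𝓕.obj Y)
      ).toContinuousLinearEquiv.toContinuousLinearMap S)

lemma compSet_assoc {W X Y Z : C} (S : Set (𝓕.obj W →L[ℂ] 𝓕.obj X))
    (T : Set (𝓕.obj X →L[ℂ] 𝓕.obj Y)) (U : Set (𝓕.obj Y →L[ℂ] 𝓕.obj Z)) :
    compSet (compSet S T) U = compSet S (compSet T U) :=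
  Set.image2_assoc fun _ _ _ => rfl

lemma comp_assoc {W X Y Z : C} (f : OpSpace 𝓕 W X) (g : OpSpace 𝓕 X Y) (h : OpSpace 𝓕 Y Z) :
    comp (comp f g) h = comp f (comp g h) := by
  obtain ⟨S, rfl⟩ := exists_span f
  obtain ⟨T, rfl⟩ := exists_span g
  obtain ⟨U, rfl⟩ := exists_span h
  simp only [comp_span, compSet_assoc]

lemma of_comp {X Y Z : C} (f : X ⟶ Y) (g : Y ⟶ Z) :
    (of (f ≫ g) : OpSpace 𝓕 X Z) = comp (of f) (of g) := by
  simp [of, comp_span, compSet, 𝓕.map_comp]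

lemma id_comp {X Y : C} (f : OpSpace 𝓕 X Y) : comp (of (𝟙 X)) f = f := by
  obtain ⟨S, rfl⟩ := exists_span f
  simp [of, comp_span, compSet, 𝓕.map_id]

lemma comp_id {X Y : C} (f : OpSpace 𝓕 X Y) : comp f (of (𝟙 Y)) = f := by
  obtain ⟨S, rfl⟩ := exists_span f
  simp [of, comp_span, compSet, 𝓕.map_id]

lemma of_whiskerRight {X Y : C} (f : X ⟶ Y) (Z : C) :
    (of (f ▷ Z) : OpSpace 𝓕 _ _) = whiskerRight (of f) Z := by
  simp [of, span_whiskerRight, 𝓕.map_whiskerRight]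

lemma of_whiskerLeft (Z : C) {X Y : C} (f : X ⟶ Y) :
    (of (Z ◁ f) : OpSpace 𝓕 _ _) = whiskerLeft Z (of f) := by
  simp [of, whiskerLeft_span, 𝓕.map_whiskerLeft]

lemma comp_whiskerRight {X Y Z : C} (f : OpSpace 𝓕 X Y) (g : OpSpace 𝓕 Y Z) (W : C) :
    whiskerRight (comp f g) W = comp (whiskerRight f W) (whiskerRight g W) := by
  obtain ⟨S, rfl⟩ := exists_span f
  obtain ⟨T, rfl⟩ := exists_span g
  simp only [comp_span, span_whiskerRight, compSet, Set.image_image2, Set.image2_image_left,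
    Set.image2_image_right, 𝓕.amp_comp]

lemma whiskerLeft_comp (W : C) {X Y Z : C} (f : OpSpace 𝓕 X Y) (g : OpSpace 𝓕 Y Z) :
    whiskerLeft W (comp f g) = comp (whiskerLeft W f) (whiskerLeft W g) := by
  obtain ⟨S, rfl⟩ := exists_span f
  obtain ⟨T, rfl⟩ := exists_span g
  simp only [comp_span, whiskerLeft_span, compSet, Set.image_image2, Set.image2_image_left,
    Set.image2_image_right, 𝓕.wl_comp]

lemma whisker_exchange {X Y X' Y' : C} (f : OpSpace 𝓕 X Y) (g : OpSpace 𝓕 X' Y') :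
    comp (whiskerLeft X g) (whiskerRight f Y') = comp (whiskerRight f X') (whiskerLeft Y g) := by
  obtain ⟨S, rfl⟩ := exists_span f
  obtain ⟨T, rfl⟩ := exists_span g
  simp only [comp_span, whiskerLeft_span, span_whiskerRight, compSet, Set.image2_image_left,
    Set.image2_image_right, 𝓕.wl_comp_amp]
  rw [Set.image2_swap]

/-- A naturality square between spaces parametrised by the same set holds if it holds pointwise. -/
lemma span_comp_of {X Y X' Y' : C} {S : Set (𝓕.obj X →L[ℂ] 𝓕.obj Y)}
    {T : Set (𝓕.obj X' →L[ℂ] 𝓕.obj Y')} {ι : Type*} (p : ι → 𝓕.obj X →L[ℂ] 𝓕.obj Y)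
    (q : ι → 𝓕.obj X' →L[ℂ] 𝓕.obj Y') (I : Set ι) (hS : S = p '' I) (hT : T = q '' I)
    (f : Y ⟶ Y') (g : X ⟶ X') (h : ∀ i, 𝓕.map f ∘L p i = q i ∘L 𝓕.map g) :
    comp (span S) (of f) = comp (of g) (span T) := by
  subst hS hT
  simp only [of, comp_span, compSet, Set.image2_singleton_right, Set.image2_singleton_left,
    Set.image_image, h]

lemma associator_naturality_left {X Y : C} (f : OpSpace 𝓕 X Y) (V W : C) :
    comp (whiskerRight (whiskerRight f V) W) (of (α_ Y V W).hom) =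
      comp (of (α_ X V W).hom) (whiskerRight f (V ⊗ W)) := by
  obtain ⟨S, rfl⟩ := exists_span f
  simp only [span_whiskerRight, Set.image_image]
  exact span_comp_of (fun a => 𝓕.amp (𝓕.amp a V) W) (fun a => 𝓕.amp a (V ⊗ W)) S
    rfl rfl _ _ fun a => 𝓕.map_associator_amp a V W

lemma associator_naturality_middle {X Y : C} (V : C) (f : OpSpace 𝓕 X Y) (W : C) :
    comp (whiskerRight (whiskerLeft V f) W) (of (α_ V Y W).hom) =
      comp (of (α_ V X W).hom) (whiskerLeft V (whiskerRight f W)) := by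
  obtain ⟨S, rfl⟩ := exists_span f
  simp only [span_whiskerRight, whiskerLeft_span, Set.image_image]
  exact span_comp_of (fun a => 𝓕.amp (𝓕.wl V a) W) (fun a => 𝓕.wl V (𝓕.amp a W)) S
    rfl rfl _ _ fun a => 𝓕.map_associator_amp_wl V W a

lemma associator_naturality_right {X Y : C} (V W : C) (f : OpSpace 𝓕 X Y) :
    comp (whiskerLeft (V ⊗ W) f) (of (α_ V W Y).hom) =
      comp (of (α_ V W X).hom) (whiskerLeft V (whiskerLeft W f)) := by
  obtain ⟨S, rfl⟩ := exists_span f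
  simp only [whiskerLeft_span, Set.image_image]
  exact span_comp_of (fun a => 𝓕.wl (V ⊗ W) a) (fun a => 𝓕.wl V (𝓕.wl W a)) S
    rfl rfl _ _ fun a => 𝓕.map_associator_wl V W a

lemma leftUnitor_naturality {X Y : C} (f : OpSpace 𝓕 X Y) :
    comp (whiskerLeft (𝟙_ C) f) (of (λ_ Y).hom) = comp (of (λ_ X).hom) f := by
  obtain ⟨S, rfl⟩ := exists_span f
  simp only [whiskerLeft_span]
  exact span_comp_of (fun a => 𝓕.wl (𝟙_ C) a) (fun a => a) S rfl (Set.image_id' _).symm _ _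
      fun a => 𝓕.map_leftUnitor_wl a

lemma rightUnitor_naturality {X Y : C} (f : OpSpace 𝓕 X Y) :
    comp (whiskerRight f (𝟙_ C)) (of (ρ_ Y).hom) = comp (of (ρ_ X).hom) f := by
  obtain ⟨S, rfl⟩ := exists_span f
  simp only [span_whiskerRight]
  exact span_comp_of (fun a => 𝓕.amp a (𝟙_ C)) (fun a => a) S rfl (Set.image_id' _).symm _ _
      fun a => 𝓕.map_rightUnitor_amp a

lemma dag_dag {X Y : C} (f : OpSpace 𝓕 X Y) : dag (dag f) = f := by
  obtain ⟨S, rfl⟩ := exists_span f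
  simp [dag_span, Set.image_image]

lemma dag_comp {X Y Z : C} (f : OpSpace 𝓕 X Y) (g : OpSpace 𝓕 Y Z) :
    dag (comp f g) = comp (dag g) (dag f) := by
  obtain ⟨S, rfl⟩ := exists_span f
  obtain ⟨T, rfl⟩ := exists_span g
  simp only [comp_span, dag_span, compSet, Set.image_image2, Set.image2_image_left,
    Set.image2_image_right, ContinuousLinearMap.adjoint_comp]
  rw [Set.image2_swap]

lemma dag_whiskerRight {X Y : C} (f : OpSpace 𝓕 X Y) (Z : C) :
    dag (whiskerRight f Z) = whiskerRight (dag f) Z := by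
  obtain ⟨S, rfl⟩ := exists_span f
  simp only [dag_span, span_whiskerRight, Set.image_image, 𝓕.amp_adjoint]

lemma dag_whiskerLeft (Z : C) {X Y : C} (f : OpSpace 𝓕 X Y) :
    dag (whiskerLeft Z f) = whiskerLeft Z (dag f) := by
  obtain ⟨S, rfl⟩ := exists_span f
  simp only [dag_span, whiskerLeft_span, Set.image_image, 𝓕.wl_adjoint]

lemma dag_of {X Y : C} (f : X ⟶ Y) : (dag (of f) : OpSpace 𝓕 Y X) = of (WStarCategory.adj f) := by
  simp [of, dag_span, 𝓕.map_adj]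

lemma dag_ket (V Z : C) : dag (ket 𝓕 V Z) = bra 𝓕 V Z := by
  rw [ket, bra, dag_span, ← Set.range_comp]
  rfl

lemma ket_naturality (V : C) {Z Z' : C} (f : OpSpace 𝓕 Z Z') :
    comp f (ket 𝓕 V Z') = comp (ket 𝓕 V Z) (whiskerLeft V f) := by
  obtain ⟨S, rfl⟩ := exists_span f
  simp only [comp_span, ket, whiskerLeft_span, compSet, ← Set.image_univ,
    Set.image2_image_left, Set.image2_image_right, 𝓕.ketLeft_comp]
  rw [Set.image2_swap]

lemma ket_whiskerRight (V Z W : C) :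
    whiskerRight (ket 𝓕 V Z) W = comp (ket 𝓕 V (Z ⊗ W)) (of (α_ V Z W).inv) := by
  simp only [comp_span, ket, of, span_whiskerRight, compSet, Set.image2_singleton_right,
    ← Set.range_comp]
  refine congrArg (fun f => span (Set.range f)) (funext fun ξ => 𝓕.amp_ketLeft V Z W ξ)

lemma ket_tensor (V W Z : C) :
    ket 𝓕 (V ⊗ W) Z = comp (ket 𝓕 W Z) (comp (ket 𝓕 V (W ⊗ Z)) (of (α_ V W Z).inv)) := by
  simp only [comp_span, ket, of, compSet, Set.image2_singleton_right]
  refine OpSpace.ext ?_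
  change closedSpan _ = closedSpan _
  have h := closedSpan_image_closedSpan (𝓕.ketL (V ⊗ W) Z)
    (Set.range fun p : 𝓕.obj V × 𝓕.obj W => 𝓕.tmul p.1 p.2)
  rw [𝓕.closedSpan_tmul, Submodule.top_coe, Set.image_univ] at h
  refine h.trans (congrArg closedSpan ?_)
  ext T
  constructor
  · rintro ⟨_, ⟨⟨a, b⟩, rfl⟩, rfl⟩
    exact ⟨_, ⟨b, rfl⟩, _, ⟨_, ⟨a, rfl⟩, rfl⟩, (𝓕.ketLeft_tmul V W Z a b).symm⟩
  · rintro ⟨_, ⟨b, rfl⟩, _, ⟨_, ⟨a, rfl⟩, rfl⟩, rfl⟩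
    exact ⟨_, ⟨(a, b), rfl⟩, 𝓕.ketLeft_tmul V W Z a b⟩

lemma ket_bra_ket (V Z : C) :
    comp (ket 𝓕 V Z) (comp (bra 𝓕 V Z) (ket 𝓕 V Z)) = ket 𝓕 V Z := by
  have e (a b c : 𝓕.obj V) : (𝓕.ketLeft a Z ∘L ContinuousLinearMap.adjoint (𝓕.ketLeft b Z)) ∘L
      𝓕.ketLeft c Z = inner ℂ b c • 𝓕.ketLeft a Z := by
    rw [ContinuousLinearMap.comp_assoc, 𝓕.adjoint_ketLeft_comp_ketLeft,
      ContinuousLinearMap.comp_smul, ContinuousLinearMap.comp_id]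
  simp only [comp_span, ket, bra, compSet]
  refine OpSpace.ext (closedSpan_eq_of_subset ?_ ?_)
  · rintro _ ⟨_, ⟨c, rfl⟩, _, ⟨_, ⟨b, rfl⟩, _, ⟨a, rfl⟩, rfl⟩, rfl⟩
    change (𝓕.ketLeft a Z ∘L ContinuousLinearMap.adjoint (𝓕.ketLeft b Z)) ∘L 𝓕.ketLeft c Z ∈ _
    rw [e]
    exact Submodule.smul_mem _ _ (CStarAlg.subset_closedSpan _ ⟨a, rfl⟩)
  · rintro _ ⟨a, rfl⟩
    simp only
    by_cases ha : a = 0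
    · subst ha
      rw [show 𝓕.ketLeft (0 : 𝓕.obj V) Z = 0 from _root_.map_zero (𝓕.ketL V Z)]
      exact Submodule.zero_mem _
    · have h : 𝓕.ketLeft a Z = (inner ℂ a a : ℂ)⁻¹ • ((inner ℂ a a : ℂ) • 𝓕.ketLeft a Z) := by
        rw [smul_smul, inv_mul_cancel₀ (by simpa using ha), one_smul]
      rw [h, ← e]
      exact Submodule.smul_mem _ _ (CStarAlg.subset_closedSpan _
        ⟨_, ⟨a, rfl⟩, _, ⟨_, ⟨a, rfl⟩, _, ⟨a, rfl⟩, rfl⟩, rfl⟩)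

/-- An isomorphism is surjective on vectors, so it maps the space of kets onto the space of
kets. -/
lemma ket_comp_whiskerRight {V W : C} (f : V ≅ W) (Z : C) :
    comp (ket 𝓕 V Z) (whiskerRight (of f.hom) Z) = ket 𝓕 W Z := by
  simp only [comp_span, ket, of, span_whiskerRight, Set.image_singleton, compSet,
    Set.image2_singleton_right, ← Set.range_comp, Function.comp_def, 𝓕.amp_comp_ketLeft]
  have h : Function.Surjective (𝓕.map f.hom) := fun y => ⟨_, 𝓕.map_hom_map_inv f y⟩
  exact congrArg span (h.range_comp fun ξ => 𝓕.ketLeft ξ Z)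

end OpSpace

/-- A copy of the objects of `C`, with spaces of operators as morphisms. -/
structure OpCat (𝓕 : FibreFunctor.{u, v, w} C) where
  as : C

namespace OpCat

variable {𝓕 : FibreFunctor.{u, v, w} C}

instance : Category (OpCat 𝓕) where
  Hom X Y := OpSpace 𝓕 X.as Y.as
  id X := OpSpace.of (𝟙 X.as)
  comp f g := f.comp g
  id_comp f := f.id_comp
  comp_id f := f.comp_id
  assoc f g h := f.comp_assoc g h

/-- A morphism of `C` as a morphism of `OpCat 𝓕`: the line spanned by its operator. -/
def of {X Y : C} (f : X ⟶ Y) : (⟨X⟩ : OpCat 𝓕) ⟶ ⟨Y⟩ := OpSpace.of f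

lemma of_comp {X Y Z : C} (f : X ⟶ Y) (g : Y ⟶ Z) :
    (of (f ≫ g) : (⟨X⟩ : OpCat 𝓕) ⟶ ⟨Z⟩) = of f ≫ of g := OpSpace.of_comp f g

lemma of_id (X : C) : of (𝟙 X) = 𝟙 (⟨X⟩ : OpCat 𝓕) := rfl

/-- An isomorphism of `C` as an isomorphism of `OpCat 𝓕`. -/
def ofIso {X Y : C} (f : X ≅ Y) : (⟨X⟩ : OpCat 𝓕) ≅ ⟨Y⟩ where
  hom := of f.hom
  inv := of f.inv
  hom_inv_id := by rw [← of_comp, Iso.hom_inv_id, of_id]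
  inv_hom_id := by rw [← of_comp, Iso.inv_hom_id, of_id]

instance : MonoidalCategoryStruct (OpCat 𝓕) where
  tensorObj X Y := ⟨X.as ⊗ Y.as⟩
  whiskerLeft Z _ _ f := OpSpace.whiskerLeft Z.as f
  whiskerRight f Z := OpSpace.whiskerRight f Z.as
  tensorUnit := ⟨𝟙_ C⟩
  associator X Y Z := ofIso (α_ X.as Y.as Z.as)
  leftUnitor X := ofIso (λ_ X.as)
  rightUnitor X := ofIso (ρ_ X.as)
  tensorHom {_ Y₁ X₂ _} f g :=
    OpSpace.comp (OpSpace.whiskerRight f X₂.as) (OpSpace.whiskerLeft Y₁.as g)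

lemma of_whiskerRight {X Y : C} (f : X ⟶ Y) (Z : C) :
    (of (f ▷ Z) : (⟨X⟩ : OpCat 𝓕) ⊗ ⟨Z⟩ ⟶ ⟨Y⟩ ⊗ ⟨Z⟩) = of f ▷ ⟨Z⟩ := OpSpace.of_whiskerRight f Z

lemma of_whiskerLeft (Z : C) {X Y : C} (f : X ⟶ Y) :
    (of (Z ◁ f) : (⟨Z⟩ : OpCat 𝓕) ⊗ ⟨X⟩ ⟶ ⟨Z⟩ ⊗ ⟨Y⟩) = ⟨Z⟩ ◁ of f := OpSpace.of_whiskerLeft Z f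

instance : MonoidalCategory (OpCat 𝓕) :=
  monoidalOfWhiskers
    (tensorHom_def := fun _ _ => rfl)
    (id_whiskerRight := fun X Y => (of_whiskerRight (𝟙 X.as) Y.as).symm.trans
      (congrArg of (id_whiskerRight X.as Y.as)))
    (whiskerLeft_id := fun X Y => (of_whiskerLeft X.as (𝟙 Y.as)).symm.trans
      (congrArg of (whiskerLeft_id X.as Y.as)))
    (comp_whiskerRight := fun f g W => OpSpace.comp_whiskerRight f g W.as)
    (whiskerLeft_comp := fun W _ _ _ f g => OpSpace.whiskerLeft_comp W.as f g)
    (whisker_exchange := fun f g => OpSpace.whisker_exchange f g)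
    (associator_naturality_left := fun f V W => OpSpace.associator_naturality_left f V.as W.as)
    (associator_naturality_middle := fun V f W => OpSpace.associator_naturality_middle V.as f W.as)
    (associator_naturality_right := fun V W f => OpSpace.associator_naturality_right V.as W.as f)
    (leftUnitor_naturality := fun f => OpSpace.leftUnitor_naturality f)
    (rightUnitor_naturality := fun f => OpSpace.rightUnitor_naturality f)
    (pentagon := fun W X Y Z => by
      have h := congrArg (of (𝓕 := 𝓕)) (pentagon W.as X.as Y.as Z.as)
      rw [of_comp, of_comp, of_comp] at h
      exact (congrArg₂ (fun a b => a ≫ _ ≫ b) (of_whiskerRight _ _)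
        (of_whiskerLeft _ _)).symm.trans h)
    (triangle := fun X Y => by
      have h := congrArg (of (𝓕 := 𝓕)) (triangle X.as Y.as)
      rw [of_comp] at h
      exact ((congrArg (_ ≫ ·) (of_whiskerLeft _ _)).symm.trans h).trans
        (of_whiskerRight _ _))

variable [MonoidalWStarCategory C]

instance : KetBra (OpCat 𝓕) where
  ket V Z := OpSpace.ket 𝓕 V.as Z.as
  bra V Z := OpSpace.bra 𝓕 V.as Z.as
  dag f := OpSpace.dag f
  dag_dag f := OpSpace.dag_dag f
  dag_comp f g := OpSpace.dag_comp f g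
  dag_whiskerRight f Z := OpSpace.dag_whiskerRight f Z.as
  dag_whiskerLeft Z f := OpSpace.dag_whiskerLeft Z.as f
  dag_associator _ _ _ := (OpSpace.dag_of _).trans (congrArg OpSpace.of
    (adj_hom_eq_inv _ (MonoidalWStarCategory.associator_unitary _ _ _)))
  dag_ket V Z := OpSpace.dag_ket V.as Z.as
  ket_naturality V _ _ f := OpSpace.ket_naturality V.as f
  ket_whiskerRight V Z W := OpSpace.ket_whiskerRight V.as Z.as W.as
  ket_tensor V W Z := OpSpace.ket_tensor V.as W.as Z.as
  ket_bra_ket V Z := OpSpace.ket_bra_ket V.as Z.as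

end OpCat
end OperatorSpaces

/-! ### Compact operators and slices -/

section Compacts

variable {H K : Type*} [NormedAddCommGroup H] [InnerProductSpace ℂ H]
  [NormedAddCommGroup K] [InnerProductSpace ℂ K]

open CStarAlg (closedSpan_le subset_closedSpan isClosed_closedSpan)

lemma isCompactOperator_rankOne (x : K) (y : H) :
    IsCompactOperator (InnerProductSpace.rankOne ℂ x y) := by
  have h : IsCompactOperator (ContinuousLinearMap.id ℂ ℂ) :=
    isCompactOperator_id_iff_locallyCompactSpace.2 inferInstance
  exact (h.comp_clm (innerSL ℂ y)).clm_comp (ContinuousLinearMap.toSpanSingleton ℂ x)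

/-- Compact operators between Hilbert spaces are norm limits of finite rank operators: compress by
the projection onto the span of a finite `ε`-net of the image of the unit ball. -/
lemma compacts_eq_closedSpan_rankOne [CompleteSpace H] [CompleteSpace K] :
    compacts H K = closedSpan (Set.range fun p : K × H => InnerProductSpace.rankOne ℂ p.1 p.2) := by
  apply le_antisymm
  · intro T hT
    have hT' : IsCompactOperator T := hT
    have hc := (hT'.isCompact_closure_image_closedBall (f := (T : H →ₗ[ℂ] K)) 1).totallyBounded
    rw [← SetLike.mem_coe, ← (isClosed_closedSpan _).closure_eq, Metric.mem_closure_iff]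
    intro ε hε
    -- Half of `ε`, so that the operator norm, a supremum of errors below `ε / 2`, stays below `ε`.
    obtain ⟨t, ht, hcov⟩ := Metric.totallyBounded_iff.1 hc (ε / 2) (by positivity)
    let U : Submodule ℂ K := Submodule.span ℂ t
    have : FiniteDimensional ℂ U := FiniteDimensional.span_of_finite ℂ ht
    refine ⟨U.starProjection ∘L T, ?_, ?_⟩
    · rw [(stdOrthonormalBasis ℂ U).starProjection_eq_sum_rankOne,
        ContinuousLinearMap.finsetSum_comp]
      refine Submodule.sum_mem _ fun i _ => ?_
      rw [InnerProductSpace.rankOne_comp]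
      exact subset_closedSpan _ ⟨(_, _), rfl⟩
    · rw [dist_eq_norm]
      refine lt_of_le_of_lt (ContinuousLinearMap.opNorm_le_of_unit_norm (by positivity)
        fun x hx => ?_) (half_lt_self hε)
      have hmem : T x ∈ closure ((T : H →ₗ[ℂ] K) '' Metric.closedBall 0 1) :=
        subset_closure ⟨x, by simp [hx], rfl⟩
      obtain ⟨y, hy, hxy⟩ := Set.mem_iUnion₂.1 (hcov hmem)
      have hmin : ‖T x - U.starProjection (T x)‖ ≤ ‖T x - y‖ := by
        rw [Submodule.starProjection_minimal]
        exact ciInf_le (f := fun z : U => ‖T x - z‖)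
          ⟨0, Set.forall_mem_range.2 fun _ => norm_nonneg _⟩ ⟨y, Submodule.subset_span hy⟩
      rw [Metric.mem_ball, dist_eq_norm] at hxy
      exact hmin.trans hxy.le
  · refine closedSpan_le ?_ ?_
    · have := compactOperator_topologicalClosure (σ₁₂ := RingHom.id ℂ) (M₁ := H) (M₂ := K)
      rw [compacts, ← this]
      exact Submodule.isClosed_topologicalClosure _
    · rintro _ ⟨p, rfl⟩
      exact isCompactOperator_rankOne p.1 p.2

end Compacts

section Slices

variable {C : Type u} [Category.{v} C] [WStarCategory C] [MonoidalCategory C]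
  (𝓕 : FibreFunctor.{u, v, w} C)

lemma exists_norm_sub_lt_of_mem_closedSpan {E : Type*} [NormedAddCommGroup E] [NormedSpace ℂ E]
    {S : Set E} {x : E} (hx : x ∈ closedSpan S) {ε : ℝ} (hε : 0 < ε) :
    ∃ y ∈ Submodule.span ℂ S, ‖x - y‖ < ε := by
  obtain ⟨y, hy, h⟩ := Metric.mem_closure_iff.1
    (show x ∈ closure (Submodule.span ℂ S : Set E) from hx) ε hε
  exact ⟨y, hy, by rwa [← dist_eq_norm]⟩

namespace FibreFunctor

lemma norm_ketRight_le (H : C) {K : C} (y : 𝓕.obj K) : ‖𝓕.ketRight H y‖ ≤ ‖y‖ :=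
  ContinuousLinearMap.opNorm_le_bound _ (norm_nonneg _) fun x => by
    rw [ketRight_apply, norm_tmul, mul_comm]

/-- The operator `(⟨η| ⊗ id) T (|ξ⟩ ⊗ id)` has the matrix coefficients that define the slice of `T`
by the functional `⟨η, · ξ⟩`. -/
lemma inner_slice {H K H' K' : C} (T : 𝓕.obj (H ⊗ K) →L[ℂ] 𝓕.obj (H' ⊗ K')) (ξ : 𝓕.obj H)
    (η : 𝓕.obj H') (x : 𝓕.obj K) (y : 𝓕.obj K') :
    inner ℂ y ((ContinuousLinearMap.adjoint (𝓕.ketLeft η K') ∘L T ∘L 𝓕.ketLeft ξ K) x) =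
      inner ℂ η ((ContinuousLinearMap.adjoint (𝓕.ketRight H' y) ∘L T ∘L 𝓕.ketRight H x) ξ) := by
  simp [ContinuousLinearMap.adjoint_inner_right, ketLeft_apply, ketRight_apply]

/-- The functional `T ↦ ⟨η, T ξ⟩`. -/
def vectorFunctional {H K : Type*} [NormedAddCommGroup H] [InnerProductSpace ℂ H]
    [NormedAddCommGroup K] [InnerProductSpace ℂ K] (ξ : H) (η : K) : StrongDual ℂ (H →L[ℂ] K) :=
  innerSL ℂ η ∘L ContinuousLinearMap.apply ℂ K ξ

/-- The slices by vector functionals already span all slices: slicing is contractive in the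
functional, and the vector functionals span a dense space of normal functionals. -/
lemma closedSpan_leftSlices {H K H' K' : C} (T : 𝓕.obj (H ⊗ K) →L[ℂ] 𝓕.obj (H' ⊗ K')) :
    closedSpan (𝓕.leftSlices T) = closedSpan {S | ∃ (ξ : 𝓕.obj H) (η : 𝓕.obj H'),
      S = ContinuousLinearMap.adjoint (𝓕.ketLeft η K') ∘L T ∘L 𝓕.ketLeft ξ K} := by
  set V := {S | ∃ (ξ : 𝓕.obj H) (η : 𝓕.obj H'),
      S = ContinuousLinearMap.adjoint (𝓕.ketLeft η K') ∘L T ∘L 𝓕.ketLeft ξ K} with hV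
  refine closedSpan_eq_of_subset ?_ ?_
  · rintro S ⟨ω, hω, hS⟩
    -- A slice by a functional in the algebraic span is a combination of vector slices.
    have hspan : ∀ ω' ∈ Submodule.span ℂ {ω : StrongDual ℂ (𝓕.obj H →L[ℂ] 𝓕.obj H') |
        ∃ (ξ : 𝓕.obj H) (η : 𝓕.obj H'), ∀ T, ω T = inner ℂ η (T ξ)},
        ∃ S' ∈ closedSpan V, ∀ (x : 𝓕.obj K) (y : 𝓕.obj K'), inner ℂ y (S' x) =
          ω' (ContinuousLinearMap.adjoint (𝓕.ketRight H' y) ∘L T ∘L 𝓕.ketRight H x) := by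
      intro ω' hω'
      induction hω' using Submodule.span_induction with
      | mem ω' h =>
        obtain ⟨ξ, η, h⟩ := h
        exact ⟨_, CStarAlg.subset_closedSpan _ ⟨ξ, η, rfl⟩, fun x y => by
          rw [h, inner_slice]⟩
      | zero => exact ⟨0, Submodule.zero_mem _, by simp⟩
      | add a b _ _ ha hb =>
        obtain ⟨A, hA, hA'⟩ := ha
        obtain ⟨B, hB, hB'⟩ := hb
        exact ⟨A + B, Submodule.add_mem _ hA hB, fun x y => by
          simp only [_root_.add_apply, inner_add_right, hA', hB']⟩
      | smul z a _ ha =>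
        obtain ⟨A, hA, hA'⟩ := ha
        exact ⟨z • A, Submodule.smul_mem _ z hA, fun x y => by
          simp only [_root_.smul_apply, inner_smul_right, hA', smul_eq_mul]⟩
    rw [← (CStarAlg.isClosed_closedSpan V).closure_eq, Metric.mem_closure_iff]
    intro ε hε
    obtain ⟨ω', hω'span, hdist⟩ := exists_norm_sub_lt_of_mem_closedSpan hω
      (ε := ε / (‖T‖ + 1)) (by positivity)
    obtain ⟨S', hS'mem, hS'⟩ := hspan ω' hω'span
    refine ⟨S', hS'mem, ?_⟩
    rw [dist_eq_norm]
    have hle : ‖S - S'‖ ≤ ‖ω - ω'‖ * ‖T‖ := by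
      refine ContinuousLinearMap.opNorm_le_of_re_inner_le (by positivity) fun x y hx hy => ?_
      refine (RCLike.re_le_norm _).trans ?_
      rw [norm_inner_symm, _root_.sub_apply, inner_sub_right, hS, hS', ← _root_.sub_apply]
      refine ((ω - ω').le_opNorm _).trans ?_
      gcongr
      refine (ContinuousLinearMap.opNorm_comp_le _ _).trans ?_
      have h1 : ‖ContinuousLinearMap.adjoint (𝓕.ketRight H' y)‖ ≤ 1 := by
        rw [LinearIsometryEquiv.norm_map]
        exact (𝓕.norm_ketRight_le H' y).trans hy.le
      have h2 : ‖T ∘L 𝓕.ketRight H x‖ ≤ ‖T‖ * 1 :=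
        (ContinuousLinearMap.opNorm_comp_le _ _).trans (by
          gcongr
          exact (𝓕.norm_ketRight_le H x).trans hx.le)
      calc _ ≤ 1 * (‖T‖ * 1) := by gcongr
        _ = ‖T‖ := by ring
    refine hle.trans_lt ?_
    rw [lt_div_iff₀ (by positivity)] at hdist
    nlinarith [norm_nonneg (ω - ω'), norm_nonneg T]
  · rintro _ ⟨ξ, η, rfl⟩
    refine CStarAlg.subset_closedSpan _ ⟨vectorFunctional ξ η,
      CStarAlg.subset_closedSpan _ ⟨ξ, η, fun T => rfl⟩, fun x y => ?_⟩
    rw [inner_slice]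
    rfl

end FibreFunctor

namespace OpSpace

variable {𝓕}

lemma ket_comp_of_comp_bra {H K H' K' : C} (f : H ⊗ K ⟶ H' ⊗ K') :
    (comp (ket 𝓕 H K) (comp (of f) (bra 𝓕 H' K'))).carrier =
      closedSpan (𝓕.leftSlices (𝓕.map f)) := by
  rw [𝓕.closedSpan_leftSlices]
  simp only [ket, of, bra, comp_span, compSet, Set.image2_singleton_left]
  refine congrArg closedSpan (Set.ext fun S => ?_)
  constructor
  · rintro ⟨_, ⟨ξ, rfl⟩, _, ⟨_, ⟨η, rfl⟩, rfl⟩, rfl⟩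
    exact ⟨ξ, η, rfl⟩
  · rintro ⟨ξ, η, rfl⟩
    exact ⟨_, ⟨ξ, rfl⟩, _, ⟨_, ⟨η, rfl⟩, rfl⟩, rfl⟩

/-- `[K(H, K) ⊗ id]` is spanned by the products of kets and bras. -/
lemma compacts_whiskerRight {H K : C} (f : OpSpace 𝓕 H K)
    (hf : f.carrier = compacts (𝓕.obj H) (𝓕.obj K)) (Z : C) :
    whiskerRight f Z = comp (bra 𝓕 H Z) (ket 𝓕 K Z) := by
  have h : f = span (Set.range fun p : 𝓕.obj K × 𝓕.obj H => InnerProductSpace.rankOne ℂ p.1 p.2) :=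
    OpSpace.ext (hf.trans compacts_eq_closedSpan_rankOne)
  rw [h, span_whiskerRight, bra, ket, comp_span]
  refine congrArg span (Set.ext fun S => ?_)
  constructor
  · rintro ⟨_, ⟨p, rfl⟩, rfl⟩
    exact ⟨_, ⟨p.2, rfl⟩, _, ⟨p.1, rfl⟩, (𝓕.amp_rankOne p.1 p.2 Z).symm⟩
  · rintro ⟨_, ⟨y, rfl⟩, _, ⟨x, rfl⟩, rfl⟩
    exact ⟨_, ⟨(x, y), rfl⟩, 𝓕.amp_rankOne x y Z⟩

end OpSpace

namespace OpCat

variable {𝓕}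

open KetBra

/-- The isomorphism underlying a unitary morphism. -/
def unitaryIso {X Y : C} (f : X ⟶ Y) (hf : IsUnitaryMor f) : X ≅ Y where
  hom := f
  inv := WStarCategory.adj f
  hom_inv_id := hf.1
  inv_hom_id := hf.2

lemma at₂₃_of {L : C} (f : L ⊗ L ⟶ L ⊗ L) :
    at₂₃ (L := (⟨L⟩ : OpCat 𝓕)) (of f) = of ((α_ L L L).hom ≫ L ◁ f ≫ (α_ L L L).inv) := by
  rw [of_comp, of_comp]
  exact congrArg (fun g => _ ≫ g ≫ _) (of_whiskerLeft L f).symm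

section

variable [BraidedCategory C]

/-- The braiding of `C` in the category of operator spaces. -/
def braiding (𝓕 : FibreFunctor.{u, v, w} C) (X Y : OpCat 𝓕) : X ⊗ Y ≅ Y ⊗ X :=
  ofIso (β_ X.as Y.as)

lemma transparent_of {X : C} (f : X ⟶ X) : Transparent (braiding 𝓕) (of f) where
  slide_left Z := by
    have h := congrArg (of (𝓕 := 𝓕)) (BraidedCategory.braiding_naturality_left f Z.as)
    rw [of_comp, of_comp] at h
    exact ((congrArg₂ _ (of_whiskerRight _ _) rfl).symm.trans h).trans
      (congrArg _ (of_whiskerLeft _ _))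
  slide_right Z := by
    have h := congrArg (of (𝓕 := 𝓕)) (BraidedCategory.braiding_naturality_right Z.as f)
    rw [of_comp, of_comp] at h
    exact ((congrArg₂ _ (of_whiskerLeft _ _) rfl).symm.trans h).trans
      (congrArg _ (of_whiskerRight _ _))

end

variable [MonoidalWStarCategory C]

lemma absorbs_ofIso {V W : C} (f : V ≅ W) (hf : IsUnitaryMor f.hom) :
    Absorbs (ofIso f : (⟨V⟩ : OpCat 𝓕) ≅ ⟨W⟩) :=
  ⟨(OpSpace.dag_of _).trans (congrArg OpSpace.of (adj_hom_eq_inv f hf)),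
    fun Z => OpSpace.ket_comp_whiskerRight f Z.as⟩

lemma slice_of_carrier {K H : C} (X : K ⊗ H ⟶ K ⊗ H) :
    OpSpace.carrier (slice (K := (⟨K⟩ : OpCat 𝓕)) (H := ⟨H⟩) (of X)) = legAlgebra 𝓕 X :=
  OpSpace.ket_comp_of_comp_bra X

variable [BraidedCategory C]

lemma regularBraiding (hc : IsBiRegularBraiding 𝓕) : RegularBraiding (braiding 𝓕) where
  hexagon_forward X Y Z := by
    have h := congrArg (of (𝓕 := 𝓕)) (BraidedCategory.hexagon_forward X.as Y.as Z.as)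
    rw [of_comp, of_comp, of_comp, of_comp] at h
    refine Eq.trans h (congrArg₂ _ (of_whiskerRight _ _) (congrArg _ (of_whiskerLeft _ _)))
  hexagon_reverse X Y Z := by
    have h := congrArg (of (𝓕 := 𝓕)) (BraidedCategory.hexagon_reverse X.as Y.as Z.as)
    rw [of_comp, of_comp, of_comp, of_comp] at h
    refine Eq.trans h (congrArg₂ _ (of_whiskerLeft _ _) (congrArg _ (of_whiskerRight _ _)))
  absorbs X Y := absorbs_ofIso _ (hc.unitary X.as Y.as)
  regular H K Z := OpSpace.compacts_whiskerRight _
    ((OpSpace.ket_comp_of_comp_bra _).trans (hc.regular_op H.as K.as)) Z.as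

lemma regularMultiplicativeUnitary {L : C} {F : L ⊗ L ⟶ L ⊗ L}
    (hF : IsMultiplicativeUnitary F) (hreg : IsBiRegular 𝓕 F) :
    RegularMultiplicativeUnitary (L := (⟨L⟩ : OpCat 𝓕)) (braiding 𝓕)
      (ofIso (unitaryIso F hF.unitary)) where
  absorbs := absorbs_ofIso _ hF.unitary
  transparent := transparent_of F
  pentagon := by
    have h := hF.pentagon
    dsimp only at h
    have e : at₂₃ (L := (⟨L⟩ : OpCat 𝓕)) (ofIso (unitaryIso F hF.unitary)).hom =
        of ((α_ L L L).hom ≫ L ◁ F ≫ (α_ L L L).inv) := at₂₃_of F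
    rw [e]
    generalize (α_ L L L).hom ≫ L ◁ F ≫ (α_ L L L).inv = G at h ⊢
    have h' := congrArg (of (𝓕 := 𝓕)) h
    rw [of_comp, of_comp, of_comp, of_comp, of_comp, of_whiskerRight, of_whiskerRight,
      of_whiskerRight] at h'
    exact h'
  regular Z := by
    have e : slice (K := (⟨L⟩ : OpCat 𝓕)) (H := ⟨L⟩)
        ((ofIso (unitaryIso F hF.unitary)).inv ≫ (braiding 𝓕 ⟨L⟩ ⟨L⟩).hom) =
        slice (K := (⟨L⟩ : OpCat 𝓕)) (H := ⟨L⟩) (of (WStarCategory.adj F ≫ (β_ L L).hom)) :=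
      congrArg slice (of_comp _ _).symm
    rw [e]
    exact OpSpace.compacts_whiskerRight _
      ((OpSpace.ket_comp_of_comp_bra _).trans hreg.regular_op) Z.as

end OpCat
end Slices

/-! ### Tensor products with jointly epimorphic inclusions -/

section Inclusions

/-- A tensor product on objects whose two inclusions are jointly epimorphic. The tensor product of
morphisms, the associators and the unit isomorphisms are then determined by their restrictions along
the inclusions, and only their existence is required. There is at most one morphism out of the
unit object, and the unit isomorphisms are inverse to inclusions. -/
structure InclusionTensor (A : Type u) [Category.{v} A] where
  box : A → A → A
  unit : A
  inl : ∀ P Q : A, P ⟶ box P Q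
  inr : ∀ P Q : A, Q ⟶ box P Q
  hom_ext : ∀ {P Q R : A} {f g : box P Q ⟶ R}, inl P Q ≫ f = inl P Q ≫ g →
    inr P Q ≫ f = inr P Q ≫ g → f = g
  exists_map : ∀ {P Q P' Q' : A} (f : P ⟶ P') (g : Q ⟶ Q'), ∃ h : box P Q ⟶ box P' Q',
    inl P Q ≫ h = f ≫ inl P' Q' ∧ inr P Q ≫ h = g ≫ inr P' Q'
  exists_assoc : ∀ P Q R : A, ∃ h : box (box P Q) R ⟶ box P (box Q R),
    inl P Q ≫ inl (box P Q) R ≫ h = inl P (box Q R) ∧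
    inr P Q ≫ inl (box P Q) R ≫ h = inl Q R ≫ inr P (box Q R) ∧
    inr (box P Q) R ≫ h = inr Q R ≫ inr P (box Q R)
  exists_assoc_inv : ∀ P Q R : A, ∃ h : box P (box Q R) ⟶ box (box P Q) R,
    inl P (box Q R) ≫ h = inl P Q ≫ inl (box P Q) R ∧
    inl Q R ≫ inr P (box Q R) ≫ h = inr P Q ≫ inl (box P Q) R ∧
    inr Q R ≫ inr P (box Q R) ≫ h = inr (box P Q) R
  unit_hom_ext : ∀ {P : A} (f g : unit ⟶ P), f = g
  exists_leftUnitor : ∀ P : A, ∃ h : box unit P ⟶ P, inr unit P ≫ h = 𝟙 P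
  exists_rightUnitor : ∀ P : A, ∃ h : box P unit ⟶ P, inl P unit ≫ h = 𝟙 P

namespace InclusionTensor

variable {A : Type u} [Category.{v} A] (T : InclusionTensor A)

/-- The tensor product of morphisms. -/
def map {P Q P' Q' : A} (f : P ⟶ P') (g : Q ⟶ Q') : T.box P Q ⟶ T.box P' Q' :=
  (T.exists_map f g).choose

@[simp]
lemma inl_map {P Q P' Q' : A} (f : P ⟶ P') (g : Q ⟶ Q') :
    T.inl P Q ≫ T.map f g = f ≫ T.inl P' Q' := (T.exists_map f g).choose_spec.1

@[simp]
lemma inl_map_assoc {P Q P' Q' : A} (f : P ⟶ P') (g : Q ⟶ Q') {Z : A} (h : T.box P' Q' ⟶ Z) :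
    T.inl P Q ≫ T.map f g ≫ h = f ≫ T.inl P' Q' ≫ h := by
  simpa only [Category.assoc] using T.inl_map f g =≫ h

@[simp]
lemma inr_map {P Q P' Q' : A} (f : P ⟶ P') (g : Q ⟶ Q') :
    T.inr P Q ≫ T.map f g = g ≫ T.inr P' Q' := (T.exists_map f g).choose_spec.2

@[simp]
lemma inr_map_assoc {P Q P' Q' : A} (f : P ⟶ P') (g : Q ⟶ Q') {Z : A} (h : T.box P' Q' ⟶ Z) :
    T.inr P Q ≫ T.map f g ≫ h = g ≫ T.inr P' Q' ≫ h := by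
  simpa only [Category.assoc] using T.inr_map f g =≫ h

/-- The associator as a morphism. -/
def assocHom (P Q R : A) : T.box (T.box P Q) R ⟶ T.box P (T.box Q R) :=
  (T.exists_assoc P Q R).choose

/-- The inverse of the associator as a morphism. -/
def assocInv (P Q R : A) : T.box P (T.box Q R) ⟶ T.box (T.box P Q) R :=
  (T.exists_assoc_inv P Q R).choose

@[simp]
lemma inl_inl_assocHom (P Q R : A) : T.inl P Q ≫ T.inl (T.box P Q) R ≫ T.assocHom P Q R =
    T.inl P (T.box Q R) := (T.exists_assoc P Q R).choose_spec.1

@[simp]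
lemma inl_inl_assocHom_assoc (P Q R : A) {Z : A} (h : T.box P (T.box Q R) ⟶ Z) :
    T.inl P Q ≫ T.inl (T.box P Q) R ≫ T.assocHom P Q R ≫ h = T.inl P (T.box Q R) ≫ h := by
  simpa only [Category.assoc] using T.inl_inl_assocHom P Q R =≫ h

@[simp]
lemma inr_inl_assocHom (P Q R : A) : T.inr P Q ≫ T.inl (T.box P Q) R ≫ T.assocHom P Q R =
    T.inl Q R ≫ T.inr P (T.box Q R) := (T.exists_assoc P Q R).choose_spec.2.1

@[simp]
lemma inr_inl_assocHom_assoc (P Q R : A) {Z : A} (h : T.box P (T.box Q R) ⟶ Z) :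
    T.inr P Q ≫ T.inl (T.box P Q) R ≫ T.assocHom P Q R ≫ h =
      T.inl Q R ≫ T.inr P (T.box Q R) ≫ h := by
  simpa only [Category.assoc] using T.inr_inl_assocHom P Q R =≫ h

@[simp]
lemma inr_assocHom (P Q R : A) : T.inr (T.box P Q) R ≫ T.assocHom P Q R =
    T.inr Q R ≫ T.inr P (T.box Q R) := (T.exists_assoc P Q R).choose_spec.2.2

@[simp]
lemma inr_assocHom_assoc (P Q R : A) {Z : A} (h : T.box P (T.box Q R) ⟶ Z) :
    T.inr (T.box P Q) R ≫ T.assocHom P Q R ≫ h = T.inr Q R ≫ T.inr P (T.box Q R) ≫ h := by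
  simpa only [Category.assoc] using T.inr_assocHom P Q R =≫ h

@[simp]
lemma inl_assocInv (P Q R : A) : T.inl P (T.box Q R) ≫ T.assocInv P Q R =
    T.inl P Q ≫ T.inl (T.box P Q) R := (T.exists_assoc_inv P Q R).choose_spec.1

@[simp]
lemma inl_assocInv_assoc (P Q R : A) {Z : A} (h : T.box (T.box P Q) R ⟶ Z) :
    T.inl P (T.box Q R) ≫ T.assocInv P Q R ≫ h = T.inl P Q ≫ T.inl (T.box P Q) R ≫ h := by
  simpa only [Category.assoc] using T.inl_assocInv P Q R =≫ h

@[simp]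
lemma inl_inr_assocInv (P Q R : A) : T.inl Q R ≫ T.inr P (T.box Q R) ≫ T.assocInv P Q R =
    T.inr P Q ≫ T.inl (T.box P Q) R := (T.exists_assoc_inv P Q R).choose_spec.2.1

@[simp]
lemma inl_inr_assocInv_assoc (P Q R : A) {Z : A} (h : T.box (T.box P Q) R ⟶ Z) :
    T.inl Q R ≫ T.inr P (T.box Q R) ≫ T.assocInv P Q R ≫ h =
      T.inr P Q ≫ T.inl (T.box P Q) R ≫ h := by
  simpa only [Category.assoc] using T.inl_inr_assocInv P Q R =≫ h

@[simp]
lemma inr_inr_assocInv (P Q R : A) : T.inr Q R ≫ T.inr P (T.box Q R) ≫ T.assocInv P Q R =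
    T.inr (T.box P Q) R := (T.exists_assoc_inv P Q R).choose_spec.2.2

@[simp]
lemma inr_inr_assocInv_assoc (P Q R : A) {Z : A} (h : T.box (T.box P Q) R ⟶ Z) :
    T.inr Q R ≫ T.inr P (T.box Q R) ≫ T.assocInv P Q R ≫ h = T.inr (T.box P Q) R ≫ h := by
  simpa only [Category.assoc] using T.inr_inr_assocInv P Q R =≫ h

/-- The associator. -/
def assoc (P Q R : A) : T.box (T.box P Q) R ≅ T.box P (T.box Q R) where
  hom := T.assocHom P Q R
  inv := T.assocInv P Q R
  hom_inv_id := by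
    refine T.hom_ext (T.hom_ext ?_ ?_) ?_ <;> simp
  inv_hom_id := by
    refine T.hom_ext ?_ (T.hom_ext ?_ ?_) <;> simp

/-- The left unit isomorphism. -/
def leftUnitor (P : A) : T.box T.unit P ≅ P where
  hom := (T.exists_leftUnitor P).choose
  inv := T.inr T.unit P
  hom_inv_id := by
    refine T.hom_ext (T.unit_hom_ext _ _) ?_
    rw [reassoc_of% (T.exists_leftUnitor P).choose_spec, Category.comp_id]
  inv_hom_id := (T.exists_leftUnitor P).choose_spec

/-- The right unit isomorphism. -/
def rightUnitor (P : A) : T.box P T.unit ≅ P where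
  hom := (T.exists_rightUnitor P).choose
  inv := T.inl P T.unit
  hom_inv_id := by
    refine T.hom_ext ?_ (T.unit_hom_ext _ _)
    rw [reassoc_of% (T.exists_rightUnitor P).choose_spec, Category.comp_id]
  inv_hom_id := (T.exists_rightUnitor P).choose_spec

@[simp]
lemma inr_leftUnitor (P : A) : T.inr T.unit P ≫ (T.leftUnitor P).hom = 𝟙 P :=
  (T.leftUnitor P).inv_hom_id

@[simp]
lemma inr_leftUnitor_assoc (P : A) {Z : A} (h : P ⟶ Z) :
    T.inr T.unit P ≫ (T.leftUnitor P).hom ≫ h = h := by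
  simpa only [Category.assoc, Category.id_comp] using T.inr_leftUnitor P =≫ h

@[simp]
lemma inl_rightUnitor (P : A) : T.inl P T.unit ≫ (T.rightUnitor P).hom = 𝟙 P :=
  (T.rightUnitor P).inv_hom_id

@[simp]
lemma inl_rightUnitor_assoc (P : A) {Z : A} (h : P ⟶ Z) :
    T.inl P T.unit ≫ (T.rightUnitor P).hom ≫ h = h := by
  simpa only [Category.assoc, Category.id_comp] using T.inl_rightUnitor P =≫ h

/-- The data of the monoidal category. -/
abbrev monoidalStruct : MonoidalCategoryStruct A where
  tensorObj := T.box
  tensorHom f g := T.map f g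
  whiskerLeft P _ _ g := T.map (𝟙 P) g
  whiskerRight f Q := T.map f (𝟙 Q)
  tensorUnit := T.unit
  associator := T.assoc
  leftUnitor := T.leftUnitor
  rightUnitor := T.rightUnitor

/-- The coherence of the monoidal category can be checked along the inclusions. -/
abbrev monoidal : MonoidalCategory A :=
  letI := T.monoidalStruct
  MonoidalCategory.ofTensorHom
    (id_tensorHom_id := fun P Q => T.hom_ext
      (show T.inl P Q ≫ T.map (𝟙 P) (𝟙 Q) = T.inl P Q ≫ 𝟙 (T.box P Q) by simp)
      (show T.inr P Q ≫ T.map (𝟙 P) (𝟙 Q) = T.inr P Q ≫ 𝟙 (T.box P Q) by simp))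
    (id_tensorHom := fun _ _ _ _ => rfl)
    (tensorHom_id := fun _ _ => rfl)
    (tensorHom_comp_tensorHom := fun f₁ f₂ g₁ g₂ => T.hom_ext
      (show T.inl _ _ ≫ T.map f₁ f₂ ≫ T.map g₁ g₂ = _ ≫ T.map _ _ by simp)
      (show T.inr _ _ ≫ T.map f₁ f₂ ≫ T.map g₁ g₂ = _ ≫ T.map _ _ by simp))
    (associator_naturality := fun {X₁ X₂ X₃ Y₁ Y₂ Y₃} f₁ f₂ f₃ => by
      change T.map (T.map f₁ f₂) f₃ ≫ T.assocHom Y₁ Y₂ Y₃ =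
        T.assocHom X₁ X₂ X₃ ≫ T.map f₁ (T.map f₂ f₃)
      refine T.hom_ext (T.hom_ext ?_ ?_) ?_ <;> simp)
    (leftUnitor_naturality := fun {X Y} f => by
      change T.map (𝟙 T.unit) f ≫ (T.leftUnitor Y).hom = (T.leftUnitor X).hom ≫ f
      exact T.hom_ext (T.unit_hom_ext _ _) (by simp))
    (rightUnitor_naturality := fun {X Y} f => by
      change T.map f (𝟙 T.unit) ≫ (T.rightUnitor Y).hom = (T.rightUnitor X).hom ≫ f
      exact T.hom_ext (by simp) (T.unit_hom_ext _ _))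
    (pentagon := fun W X Y Z => by
      change T.map (T.assocHom W X Y) (𝟙 Z) ≫ T.assocHom W (T.box X Y) Z ≫
        T.map (𝟙 W) (T.assocHom X Y Z) = T.assocHom (T.box W X) Y Z ≫ T.assocHom W X (T.box Y Z)
      refine T.hom_ext (T.hom_ext (T.hom_ext ?_ ?_) ?_) ?_ <;> simp)
    (triangle := fun X Y => by
      change T.assocHom X T.unit Y ≫ T.map (𝟙 X) (T.leftUnitor Y).hom =
        T.map (T.rightUnitor X).hom (𝟙 Y)
      refine T.hom_ext (T.hom_ext ?_ (T.unit_hom_ext _ _)) ?_ <;> simp)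

end InclusionTensor
end Inclusions

/-! ### Objects of `A(C)` as operator spaces -/

section Objects

variable {C : Type u} [Category.{v} C] [WStarCategory C] [MonoidalCategory C]
  {𝓕 : FibreFunctor.{u, v, w} C}

namespace OpSpace

/-- A space of operators is nondegenerate if the vectors in the ranges of its elements are total. -/
def Nondegenerate {X Y : C} (f : OpSpace 𝓕 X Y) : Prop :=
  closedSpan {y : 𝓕.obj Y | ∃ a ∈ f.carrier, ∃ x, y = a x} = ⊤

lemma Nondegenerate.span {X Y : C} {S : Set (𝓕.obj X →L[ℂ] 𝓕.obj Y)}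
    (h : closedSpan {y : 𝓕.obj Y | ∃ a ∈ S, ∃ x, y = a x} = ⊤) :
    (OpSpace.span S : OpSpace 𝓕 X Y).Nondegenerate := by
  rw [Nondegenerate, eq_top_iff, ← h]
  refine closedSpan_mono ?_
  rintro _ ⟨a, ha, x, rfl⟩
  exact ⟨a, CStarAlg.subset_closedSpan _ ha, x, rfl⟩

lemma Nondegenerate.comp {X Y Z : C} {f : OpSpace 𝓕 X Y} {g : OpSpace 𝓕 Y Z}
    (hf : f.Nondegenerate) (hg : g.Nondegenerate) : (f.comp g).Nondegenerate := by
  refine Nondegenerate.span ?_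
  rw [eq_top_iff, ← hg]
  refine CStarAlg.closedSpan_le (CStarAlg.isClosed_closedSpan _) ?_
  rintro _ ⟨b, hb, y, rfl⟩
  refine map_mem_closedSpan b ?_ (hf.ge (Submodule.mem_top (x := y)))
  rintro _ ⟨a, ha, x, rfl⟩
  exact CStarAlg.subset_closedSpan _ ⟨b ∘L a, ⟨a, ha, b, hb, rfl⟩, x, rfl⟩

lemma Nondegenerate.whiskerRight {X Y : C} {f : OpSpace 𝓕 X Y} (hf : f.Nondegenerate) (Z : C) :
    (f.whiskerRight Z).Nondegenerate := by
  refine Nondegenerate.span ?_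
  rw [eq_top_iff, ← 𝓕.closedSpan_tmul]
  refine CStarAlg.closedSpan_le (CStarAlg.isClosed_closedSpan _) ?_
  rintro _ ⟨⟨y, z⟩, rfl⟩
  refine map_mem_closedSpan (𝓕.ketRight Y z) ?_ (hf.ge (Submodule.mem_top (x := y)))
  rintro _ ⟨a, ha, x, rfl⟩
  exact CStarAlg.subset_closedSpan _ ⟨_, ⟨a, ha, rfl⟩, 𝓕.tmul x z, by
    rw [𝓕.ketRight_apply, 𝓕.amp_tmul]⟩

lemma Nondegenerate.of_iso {X Y : C} (f : X ≅ Y) : (of f.hom : OpSpace 𝓕 X Y).Nondegenerate := by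
  refine Nondegenerate.span ?_
  rw [eq_top_iff]
  exact fun y _ => CStarAlg.subset_closedSpan _
    ⟨_, rfl, 𝓕.map f.inv y, (𝓕.map_hom_map_inv f y).symm⟩

lemma nondegenerate_ket (V Z : C) : (ket 𝓕 V Z).Nondegenerate := by
  refine Nondegenerate.span ?_
  rw [eq_top_iff, ← 𝓕.closedSpan_tmul]
  refine closedSpan_mono ?_
  rintro _ ⟨⟨x, z⟩, rfl⟩
  exact ⟨_, ⟨x, rfl⟩, z, rfl⟩

lemma nondegenerate_bra (V : C) : (bra 𝓕 V V).Nondegenerate := by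
  refine Nondegenerate.span ?_
  rw [eq_top_iff]
  intro y _
  by_cases hy : y = 0
  · rw [hy]; exact Submodule.zero_mem _
  · refine CStarAlg.subset_closedSpan _ ⟨_, ⟨y, rfl⟩, (inner ℂ y y)⁻¹ • 𝓕.tmul y y, ?_⟩
    rw [_root_.map_smul, 𝓕.adjoint_ketLeft_tmul, smul_smul,
      inv_mul_cancel₀ (inner_self_ne_zero.2 hy), one_smul]

lemma mem_comp {X Y Z : C} {f : OpSpace 𝓕 X Y} {g : OpSpace 𝓕 Y Z} {a : 𝓕.obj X →L[ℂ] 𝓕.obj Y}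
    {b : 𝓕.obj Y →L[ℂ] 𝓕.obj Z} (ha : a ∈ f.carrier) (hb : b ∈ g.carrier) :
    b ∘L a ∈ (f.comp g).carrier :=
  CStarAlg.subset_closedSpan _ ⟨a, ha, b, hb, rfl⟩

/-- A selfadjoint idempotent and nondegenerate space of operators is a `C^*`-algebra. -/
lemma isNondegCStarSubalgebra {X : C} {f : OpSpace 𝓕 X X} (hmul : f.comp f = f) (hdag : f.dag = f)
    (hnd : f.Nondegenerate) : IsNondegCStarSubalgebra f.carrier where
  isClosed := f.isClosed
  mul_mem ha hb := by
    rw [← hmul]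
    exact mem_comp hb ha
  star_mem ha := by
    rw [← hdag]
    exact CStarAlg.subset_closedSpan _ ⟨_, ha, rfl⟩
  nondegenerate := hnd

end OpSpace

namespace AObj

open KetBra

/-- The algebra of an object, as a morphism of the category of operator spaces. -/
def space (P : AObj 𝓕) : (⟨P.H⟩ : OpCat 𝓕) ⟶ ⟨P.H⟩ := ⟨P.alg, P.isObj.isCStar.isClosed⟩

lemma space_comp_space (P : AObj 𝓕) : P.space ≫ P.space = P.space := by
  refine OpSpace.ext ?_
  refine Eq.trans ?_ P.toCStarAlg.closedSpan_mul
  refine congrArg closedSpan (Set.ext fun T => ⟨?_, ?_⟩)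
  · rintro ⟨b, hb, a, ha, rfl⟩
    exact ⟨⟨a, P.toCStarAlg.alg_le_mult ha⟩, ha, b, hb, rfl⟩
  · rintro ⟨a, ha, b, hb, rfl⟩
    exact ⟨b, hb, a.1, ha, rfl⟩

lemma space_whiskerRight_comp (P : AObj 𝓕) (Z : OpCat 𝓕) :
    P.space ▷ Z ≫ P.space ▷ Z = P.space ▷ Z := by
  rw [← comp_whiskerRight, P.space_comp_space]

lemma nondegenerate_space (P : AObj 𝓕) : OpSpace.Nondegenerate P.space :=
  P.isObj.isCStar.nondegenerate

section

variable [MonoidalWStarCategory C]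

lemma exists_space_eq_slice (P : AObj 𝓕) : ∃ (K : C) (X : K ⊗ P.H ⟶ K ⊗ P.H),
    P.space = slice (K := (⟨K⟩ : OpCat 𝓕)) (H := ⟨P.H⟩) (OpCat.of X) := by
  obtain ⟨K, X, h⟩ := P.isObj.exists_leg
  exact ⟨K, X, OpSpace.ext (h.trans (OpCat.slice_of_carrier X).symm)⟩

lemma dag_space (P : AObj 𝓕) : dag P.space = P.space := by
  refine OpSpace.ext (le_antisymm ?_ ?_)
  · refine CStarAlg.closedSpan_le P.isObj.isCStar.isClosed ?_
    rintro _ ⟨a, ha, rfl⟩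
    exact P.isObj.isCStar.star_mem ha
  · intro a ha
    exact CStarAlg.subset_closedSpan _ ⟨_, P.isObj.isCStar.star_mem ha, star_star a⟩

end

variable [BraidedCategory C]

/-- The space of all `1 ⊠ b`, with `b` in the algebra of the second object. -/
abbrev spaceR (P Q : AObj 𝓕) : (⟨P.H⟩ : OpCat 𝓕) ⊗ ⟨Q.H⟩ ⟶ ⟨P.H⟩ ⊗ ⟨Q.H⟩ :=
  incR (OpCat.braiding 𝓕) ⟨P.H⟩ Q.space

/-- `A ⊠ B` as a morphism of the category of operator spaces. -/
abbrev boxSpace (P Q : AObj 𝓕) : (⟨P.H⟩ : OpCat 𝓕) ⊗ ⟨Q.H⟩ ⟶ ⟨P.H⟩ ⊗ ⟨Q.H⟩ :=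
  spaceR P Q ≫ P.space ▷ ⟨Q.H⟩

lemma spaceR_eq (P Q : AObj 𝓕) : spaceR P Q = OpSpace.span (inc₂ P Q '' Q.alg) := by
  change OpSpace.comp (OpSpace.of (β_ Q.H P.H).inv)
    (OpSpace.comp (OpSpace.span _) (OpSpace.of (β_ Q.H P.H).hom)) = _
  simp only [OpSpace.of, OpSpace.comp_span, OpSpace.compSet, Set.image2_singleton_left,
    Set.image2_singleton_right, Set.image_image]
  rfl

lemma boxSpace_carrier (P Q : AObj 𝓕) : (boxSpace P Q).carrier = boxAlg P Q := by
  change (OpSpace.comp (spaceR P Q) (OpSpace.span _)).carrier = _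
  rw [spaceR_eq, OpSpace.comp_span]
  refine congrArg closedSpan (Set.ext fun T => ⟨?_, ?_⟩)
  · rintro ⟨_, ⟨b, hb, rfl⟩, _, ⟨a, ha, rfl⟩, rfl⟩
    exact ⟨a, ha, b, hb, rfl⟩
  · rintro ⟨a, ha, b, hb, rfl⟩
    exact ⟨_, ⟨b, hb, rfl⟩, _, ⟨a, ha, rfl⟩, rfl⟩

lemma nondegenerate_boxSpace (P Q : AObj 𝓕) : OpSpace.Nondegenerate (boxSpace P Q) := by
  have h1 := OpSpace.Nondegenerate.of_iso (𝓕 := 𝓕) (β_ Q.H P.H).symm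
  have h2 := OpSpace.Nondegenerate.of_iso (𝓕 := 𝓕) (β_ Q.H P.H)
  exact (h1.comp ((Q.nondegenerate_space.whiskerRight P.H).comp h2)).comp
    (P.nondegenerate_space.whiskerRight Q.H)

lemma spaceR_comp_spaceR (P Q : AObj 𝓕) : spaceR P Q ≫ spaceR P Q = spaceR P Q := by
  simp only [incR, Category.assoc, Iso.hom_inv_id_assoc]
  rw [← comp_whiskerRight_assoc, Q.space_comp_space]

variable [MonoidalWStarCategory C]

/-- `A ⊠ 1` and `1 ⊠ B` commute as spaces, since both algebras consist of slices. -/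
lemma spaceR_comm (hc : IsBiRegularBraiding 𝓕) (P Q : AObj 𝓕) :
    spaceR P Q ≫ P.space ▷ ⟨Q.H⟩ = P.space ▷ ⟨Q.H⟩ ≫ spaceR P Q := by
  obtain ⟨K, X, hX⟩ := P.exists_space_eq_slice
  obtain ⟨M, Y, hY⟩ := Q.exists_space_eq_slice
  have hP := P.dag_space
  have hQ := Q.dag_space
  rw [spaceR]
  rw [hX, hY] at *
  exact incR_comp_slice (OpCat.regularBraiding hc) (OpCat.transparent_of X)
    (OpCat.transparent_of Y) hP hQ

lemma boxSpace_comp_boxSpace (hc : IsBiRegularBraiding 𝓕) (P Q : AObj 𝓕) :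
    boxSpace P Q ≫ boxSpace P Q = boxSpace P Q := by
  rw [boxSpace]
  nth_rewrite 1 [spaceR_comm hc]
  rw [Category.assoc, ← Category.assoc (spaceR P Q), spaceR_comp_spaceR, ← Category.assoc,
    ← spaceR_comm hc, Category.assoc, space_whiskerRight_comp]

lemma dag_boxSpace (hc : IsBiRegularBraiding 𝓕) (P Q : AObj 𝓕) :
    dag (boxSpace P Q) = boxSpace P Q := by
  have hb := (OpCat.regularBraiding hc).absorbs
  rw [boxSpace, spaceR_comm hc]
  simp only [incR, dag_comp, dag_whiskerRight, P.dag_space, Q.dag_space, (hb _ _).1,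
    (hb _ _).dag_inv, Category.assoc]
  simpa only [incR, Category.assoc] using spaceR_comm hc P Q

lemma isObj_box (hc : IsBiRegularBraiding 𝓕) (P Q : AObj 𝓕) : IsObj 𝓕 (P.H ⊗ Q.H) (boxAlg P Q) where
  isCStar := by
    rw [← boxSpace_carrier]
    exact OpSpace.isNondegCStarSubalgebra (boxSpace_comp_boxSpace hc P Q) (dag_boxSpace hc P Q)
      (nondegenerate_boxSpace P Q)
  exists_leg := by
    obtain ⟨K, X, hX⟩ := P.exists_space_eq_slice
    obtain ⟨M, Y, hY⟩ := Q.exists_space_eq_slice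
    obtain ⟨Z, hZ⟩ : ∃ Z : (M ⊗ K) ⊗ (P.H ⊗ Q.H) ⟶ (M ⊗ K) ⊗ (P.H ⊗ Q.H), OpCat.of Z =
        boxLeg (OpCat.braiding 𝓕) (K₁ := ⟨K⟩) (K₂ := ⟨M⟩) (H₁ := ⟨P.H⟩) (H₂ := ⟨Q.H⟩)
          (OpCat.of X) (OpCat.of Y) := by
      refine ⟨(α_ M K (P.H ⊗ Q.H)).hom ≫ M ◁ ((α_ K P.H Q.H).inv ≫ (β_ Q.H (K ⊗ P.H)).inv) ≫
        (α_ M Q.H (K ⊗ P.H)).inv ≫ Y ▷ (K ⊗ P.H) ≫ (α_ M Q.H (K ⊗ P.H)).hom ≫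
        M ◁ (Q.H ◁ X ≫ (β_ Q.H (K ⊗ P.H)).hom ≫ (α_ K P.H Q.H).hom) ≫
          (α_ M K (P.H ⊗ Q.H)).inv, ?_⟩
      rw [boxLeg]
      simp only [OpCat.of_comp, OpCat.of_whiskerLeft, OpCat.of_whiskerRight]
      rfl
    refine ⟨M ⊗ K, Z, ?_⟩
    rw [← OpCat.slice_of_carrier, hZ, ← boxSpace_carrier]
    refine congrArg OpSpace.carrier (Eq.trans ?_ (slice_boxLeg (OpCat.regularBraiding hc)
      (OpCat.transparent_of X) (OpCat.transparent_of Y)).symm)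
    rw [boxSpace, spaceR_comm hc, spaceR, hX, hY]

end AObj
end Objects

/-! ### The monoidal category of bounded operators -/

section BoundedOperators

variable {C : Type u} [Category.{v} C] [WStarCategory C] [MonoidalCategory C]

/-- The category with the objects of `C` and with all bounded operators between the underlying
Hilbert spaces as morphisms. It is monoidal, and contains the image of the fibre functor. -/
structure BddCat (𝓕 : FibreFunctor.{u, v, w} C) where
  as : C

namespace BddCat

variable {𝓕 : FibreFunctor.{u, v, w} C}

instance : Category (BddCat 𝓕) where
  Hom X Y := 𝓕.obj X.as →L[ℂ] 𝓕.obj Y.as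
  id X := ContinuousLinearMap.id ℂ (𝓕.obj X.as)
  comp f g := g ∘L f

/-- The operator underlying a morphism. -/
def op {X Y : C} (f : X ⟶ Y) : (⟨X⟩ : BddCat 𝓕) ⟶ ⟨Y⟩ := 𝓕.map f

lemma op_comp {X Y Z : C} (f : X ⟶ Y) (g : Y ⟶ Z) :
    (op (f ≫ g) : (⟨X⟩ : BddCat 𝓕) ⟶ ⟨Z⟩) = op f ≫ op g := 𝓕.map_comp f g

lemma op_id (X : C) : op (𝟙 X) = 𝟙 (⟨X⟩ : BddCat 𝓕) := 𝓕.map_id X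

/-- The operator underlying an isomorphism. -/
def opIso {X Y : C} (f : X ≅ Y) : (⟨X⟩ : BddCat 𝓕) ≅ ⟨Y⟩ where
  hom := op f.hom
  inv := op f.inv
  hom_inv_id := by rw [← op_comp, Iso.hom_inv_id, op_id]
  inv_hom_id := by rw [← op_comp, Iso.inv_hom_id, op_id]

instance : MonoidalCategoryStruct (BddCat 𝓕) where
  tensorObj X Y := ⟨X.as ⊗ Y.as⟩
  whiskerLeft Z _ _ f := 𝓕.wl Z.as f
  whiskerRight f Z := 𝓕.amp f Z.as
  tensorUnit := ⟨𝟙_ C⟩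
  associator X Y Z := opIso (α_ X.as Y.as Z.as)
  leftUnitor X := opIso (λ_ X.as)
  rightUnitor X := opIso (ρ_ X.as)
  tensorHom {_ Y₁ X₂ _} f g := 𝓕.wl Y₁.as g ∘L 𝓕.amp f X₂.as

lemma op_whiskerRight {X Y : C} (f : X ⟶ Y) (Z : C) :
    (op (f ▷ Z) : (⟨X⟩ : BddCat 𝓕) ⊗ ⟨Z⟩ ⟶ ⟨Y⟩ ⊗ ⟨Z⟩) = op f ▷ ⟨Z⟩ := 𝓕.map_whiskerRight f Z

lemma op_whiskerLeft (Z : C) {X Y : C} (f : X ⟶ Y) :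
    (op (Z ◁ f) : (⟨Z⟩ : BddCat 𝓕) ⊗ ⟨X⟩ ⟶ ⟨Z⟩ ⊗ ⟨Y⟩) = ⟨Z⟩ ◁ op f := 𝓕.map_whiskerLeft Z f

instance : MonoidalCategory (BddCat 𝓕) :=
  monoidalOfWhiskers
    (tensorHom_def := fun _ _ => rfl)
    (id_whiskerRight := fun X Y => 𝓕.amp_id X.as Y.as)
    (whiskerLeft_id := fun X Y => 𝓕.wl_id X.as Y.as)
    (comp_whiskerRight := fun f g W => 𝓕.amp_comp f g W.as)
    (whiskerLeft_comp := fun W _ _ _ f g => 𝓕.wl_comp W.as f g)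
    (whisker_exchange := fun f g => (𝓕.wl_comp_amp f g).symm)
    (associator_naturality_left := fun f V W => 𝓕.map_associator_amp f V.as W.as)
    (associator_naturality_middle := fun V f W => 𝓕.map_associator_amp_wl V.as W.as f)
    (associator_naturality_right := fun V W f => 𝓕.map_associator_wl V.as W.as f)
    (leftUnitor_naturality := fun f => 𝓕.map_leftUnitor_wl f)
    (rightUnitor_naturality := fun f => 𝓕.map_rightUnitor_amp f)
    (pentagon := fun W X Y Z => by
      have h := congrArg (op (𝓕 := 𝓕)) (pentagon W.as X.as Y.as Z.as)
      rw [op_comp, op_comp, op_comp] at h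
      exact (congrArg₂ (fun a b => a ≫ _ ≫ b) (op_whiskerRight _ _)
        (op_whiskerLeft _ _)).symm.trans h)
    (triangle := fun X Y => by
      have h := congrArg (op (𝓕 := 𝓕)) (triangle X.as Y.as)
      rw [op_comp] at h
      exact ((congrArg (_ ≫ ·) (op_whiskerLeft _ _)).symm.trans h).trans
        (op_whiskerRight _ _))

lemma op_associator_hom (X Y Z : C) :
    (op (α_ X Y Z).hom : _ ⟶ (_ : BddCat 𝓕)) = (α_ (⟨X⟩ : BddCat 𝓕) ⟨Y⟩ ⟨Z⟩).hom := rfl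

lemma op_associator_inv (X Y Z : C) :
    (op (α_ X Y Z).inv : _ ⟶ (_ : BddCat 𝓕)) = (α_ (⟨X⟩ : BddCat 𝓕) ⟨Y⟩ ⟨Z⟩).inv := rfl

end BddCat

namespace FibreFunctor

variable {𝓕 : FibreFunctor.{u, v, w} C}

lemma adjoint_map_hom {X Y : C} (f : X ≅ Y) (hf : IsUnitaryMor f.hom) :
    ContinuousLinearMap.adjoint (𝓕.map f.hom) = 𝓕.map f.inv := by
  rw [← 𝓕.map_adj, adj_hom_eq_inv f hf]

lemma adjoint_map_inv {X Y : C} (f : X ≅ Y) (hf : IsUnitaryMor f.hom) :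
    ContinuousLinearMap.adjoint (𝓕.map f.inv) = 𝓕.map f.hom := by
  rw [← adjoint_map_hom f hf, ContinuousLinearMap.adjoint_adjoint]

end FibreFunctor
end BoundedOperators

/-! ### Compressions and the morphisms of `A(C)` -/

section Morphisms

open CStarAlg (closedSpan_le subset_closedSpan isClosed_closedSpan)

lemma eqOn_closedSpan {E F : Type*} [NormedAddCommGroup E] [NormedSpace ℂ E]
    [NormedAddCommGroup F] [NormedSpace ℂ F] {s : Set E} {S T : E →L[ℂ] F}
    (h : ∀ x ∈ s, S x = T x) {x : E} (hx : x ∈ closedSpan s) : S x = T x := by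
  have hle : closedSpan s ≤ LinearMap.eqLocus (S : E →ₗ[ℂ] F) (T : E →ₗ[ℂ] F) :=
    closedSpan_le (isClosed_eq S.continuous T.continuous) h
  exact hle hx

lemma ext_of_closedSpan_eq_top {E F : Type*} [NormedAddCommGroup E] [NormedSpace ℂ E]
    [NormedAddCommGroup F] [NormedSpace ℂ F] {s : Set E} (hs : closedSpan s = ⊤) {S T : E →L[ℂ] F}
    (h : ∀ x ∈ s, S x = T x) : S = T := by
  ext x
  exact eqOn_closedSpan h (hs.ge (Submodule.mem_top (x := x)))

variable {C : Type u} [Category.{v} C] [WStarCategory C] [MonoidalCategory C]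

namespace FibreFunctor

variable (𝓕 : FibreFunctor.{u, v, w} C)

/-- The compression `a ↦ V (a ⊗ id) V^*`. -/
def conj {X K Y : C} (V : X ⊗ K ⟶ Y) : (𝓕.obj X →L[ℂ] 𝓕.obj X) →L[ℂ] (𝓕.obj Y →L[ℂ] 𝓕.obj Y) :=
  ContinuousLinearMap.compL ℂ (𝓕.obj Y) (𝓕.obj (X ⊗ K)) (𝓕.obj Y) (𝓕.map V) ∘L
    (ContinuousLinearMap.compL ℂ (𝓕.obj Y) (𝓕.obj (X ⊗ K)) (𝓕.obj (X ⊗ K))).flip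
      (ContinuousLinearMap.adjoint (𝓕.map V)) ∘L 𝓕.ampL X X K

lemma conj_apply {X K Y : C} (V : X ⊗ K ⟶ Y) (a : 𝓕.obj X →L[ℂ] 𝓕.obj X) :
    𝓕.conj V a = 𝓕.map V ∘L 𝓕.amp a K ∘L ContinuousLinearMap.adjoint (𝓕.map V) := rfl

variable {𝓕}

/-- The operator of `V` is a coisometry: `V V^* = id`. -/
def IsCoisometry {X Y : C} (𝓕 : FibreFunctor.{u, v, w} C) (V : X ⟶ Y) : Prop :=
  𝓕.map V ∘L ContinuousLinearMap.adjoint (𝓕.map V) = ContinuousLinearMap.id ℂ (𝓕.obj Y)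

lemma conj_one {X K Y : C} {V : X ⊗ K ⟶ Y} (hV : 𝓕.IsCoisometry V) : 𝓕.conj V 1 = 1 := by
  rw [conj_apply, ContinuousLinearMap.one_def, 𝓕.amp_id, ContinuousLinearMap.id_comp]
  exact hV

lemma conj_star {X K Y : C} (V : X ⊗ K ⟶ Y) (a : 𝓕.obj X →L[ℂ] 𝓕.obj X) :
    𝓕.conj V (star a) = star (𝓕.conj V a) := by
  simp only [ContinuousLinearMap.star_eq_adjoint, conj_apply, 𝓕.amp_adjoint,
    ContinuousLinearMap.adjoint_comp, ContinuousLinearMap.adjoint_adjoint,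
    ContinuousLinearMap.comp_assoc]

lemma conj_mul_of_intertwines {X K Y : C} {V : X ⊗ K ⟶ Y} {a : 𝓕.obj X →L[ℂ] 𝓕.obj X}
    (h : 𝓕.map V ∘L 𝓕.amp a K = 𝓕.conj V a ∘L 𝓕.map V) (b : 𝓕.obj X →L[ℂ] 𝓕.obj X) :
    𝓕.conj V (a * b) = 𝓕.conj V a * 𝓕.conj V b := by
  rw [conj_apply, ContinuousLinearMap.mul_def, 𝓕.amp_comp, ← ContinuousLinearMap.comp_assoc,
    ← ContinuousLinearMap.comp_assoc, h]
  rfl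

/-- If a compression `a ↦ V (a ⊗ id) V^*` is multiplicative on `a a^*`, then `V` intertwines
`a ⊗ id` and the compression of `a`. -/
lemma intertwines_of_conj_mul_star {X K Y : C} {V : X ⊗ K ⟶ Y} (hV : 𝓕.IsCoisometry V)
    {a : 𝓕.obj X →L[ℂ] 𝓕.obj X}
    (h : 𝓕.conj V (a * star a) = 𝓕.conj V a * star (𝓕.conj V a)) :
    𝓕.map V ∘L 𝓕.amp a K = 𝓕.conj V a ∘L 𝓕.map V := by
  set v := 𝓕.map V with hv
  set x := 𝓕.amp a K with hx
  set y := 𝓕.conj V a with hy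
  have hyx : y = v ∘L x ∘L v.adjoint := rfl
  have hV' : v ∘L v.adjoint = ContinuousLinearMap.id ℂ (𝓕.obj Y) := hV
  -- The defect `V x - y V` times its adjoint is `V x x^* V^* - y y^*`.
  have h1 : v ∘L x ∘L x.adjoint ∘L v.adjoint = y ∘L y.adjoint := by
    rw [conj_apply, ContinuousLinearMap.mul_def, 𝓕.amp_comp, ContinuousLinearMap.star_eq_adjoint,
      𝓕.amp_adjoint] at h
    exact h
  set d := (v ∘L x - y ∘L v).adjoint with hd
  have hd' : d = x.adjoint ∘L v.adjoint - v.adjoint ∘L y.adjoint := by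
    rw [hd, _root_.map_sub, ContinuousLinearMap.adjoint_comp, ContinuousLinearMap.adjoint_comp]
  have e2 : (v ∘L x) ∘L v.adjoint ∘L y.adjoint = y ∘L y.adjoint := by
    rw [hyx]; rfl
  have e3 : (y ∘L v) ∘L x.adjoint ∘L v.adjoint = y ∘L y.adjoint := by
    rw [hyx, ContinuousLinearMap.adjoint_comp, ContinuousLinearMap.adjoint_comp,
      ContinuousLinearMap.adjoint_adjoint]; rfl
  have e4 : (y ∘L v) ∘L v.adjoint ∘L y.adjoint = y ∘L y.adjoint := by
    rw [ContinuousLinearMap.comp_assoc, ← ContinuousLinearMap.comp_assoc v, hV',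
      ContinuousLinearMap.id_comp]
  have h2 : d.adjoint ∘L d = 0 := by
    rw [hd, ContinuousLinearMap.adjoint_adjoint, ← hd, hd', ContinuousLinearMap.comp_sub,
      ContinuousLinearMap.sub_comp, ContinuousLinearMap.sub_comp, e2, e3, e4]
    rw [ContinuousLinearMap.comp_assoc, h1]
    simp
  have h3 : d = 0 := by
    have := ContinuousLinearMap.norm_adjoint_comp_self d
    rw [h2, norm_zero] at this
    exact norm_eq_zero.1 (mul_self_eq_zero.1 this.symm)
  rw [hd, LinearIsometryEquiv.map_eq_zero_iff] at h3
  exact sub_eq_zero.1 h3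

end FibreFunctor

namespace AObj

variable {𝓕 : FibreFunctor.{u, v, w} C}

open FibreFunctor

lemma ext_alg (P : AObj 𝓕) {E : Type*} [NormedAddCommGroup E] [NormedSpace ℂ E]
    {S T : 𝓕.obj P.H →L[ℂ] E} (h : ∀ a ∈ P.alg, S ∘L a = T ∘L a) : S = T := by
  refine ext_of_closedSpan_eq_top P.isObj.isCStar.nondegenerate ?_
  rintro _ ⟨a, ha, x, rfl⟩
  exact congrArg (fun f => f x) (h a ha)

lemma ext_amp (P : AObj 𝓕) (K : C) {E : Type*} [NormedAddCommGroup E] [NormedSpace ℂ E]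
    {S T : 𝓕.obj (P.H ⊗ K) →L[ℂ] E} (h : ∀ a ∈ P.alg, S ∘L 𝓕.amp a K = T ∘L 𝓕.amp a K) :
    S = T := by
  refine 𝓕.ext_tmul fun x k => ?_
  have h' : S ∘L 𝓕.ketRight P.H k = T ∘L 𝓕.ketRight P.H k := P.ext_alg fun a ha => by
    ext x
    simpa [𝓕.amp_tmul, 𝓕.ketRight_apply] using congrArg (fun f => f (𝓕.tmul x k)) (h a ha)
  exact congrArg (fun f => f x) h'

/-- Intertwining relations on a `C^*`-algebra extend to its multipliers. -/
lemma intertwines_mult (P : AObj 𝓕) {K Y : C} {V : P.H ⊗ K ⟶ Y}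
    (h : ∀ a ∈ P.alg, 𝓕.map V ∘L 𝓕.amp a K = 𝓕.conj V a ∘L 𝓕.map V)
    {m : 𝓕.obj P.H →L[ℂ] 𝓕.obj P.H} (hm : m ∈ P.toCStarAlg.mult) :
    𝓕.map V ∘L 𝓕.amp m K = 𝓕.conj V m ∘L 𝓕.map V := by
  refine P.ext_amp K fun a ha => ?_
  have h1 : 𝓕.conj V (m * a) = 𝓕.conj V m * 𝓕.conj V a := by
    have h2 := conj_mul_of_intertwines (h _ (P.isObj.isCStar.star_mem ha)) (star m)
    rw [← star_mul, conj_star, conj_star, conj_star, ← star_mul] at h2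
    exact star_injective h2
  rw [ContinuousLinearMap.comp_assoc, ← 𝓕.amp_comp, ContinuousLinearMap.comp_assoc, h a ha,
    ← ContinuousLinearMap.comp_assoc]
  exact (h _ (hm a ha).1).trans (congrArg (· ∘L 𝓕.map V) h1)

variable [MonoidalWStarCategory C]

/-- A coisometry that intertwines the algebra with its compression defines a morphism. -/
lemma exists_hom {P Q : AObj 𝓕} {K : C} (V : P.H ⊗ K ⟶ Q.H) (hV : 𝓕.IsCoisometry V)
    (hint : ∀ a ∈ P.alg, 𝓕.map V ∘L 𝓕.amp a K = 𝓕.conj V a ∘L 𝓕.map V)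
    (hnd : closedSpan (Set.image2 (fun a b => 𝓕.conj V a * b) P.alg Q.alg) = Q.alg) :
    ∃ f : P ⟶ Q, ∀ m, f.val m = 𝓕.conj V m.1 := by
  have hint' : ∀ m ∈ P.toCStarAlg.mult, 𝓕.map V ∘L 𝓕.amp m K = 𝓕.conj V m ∘L 𝓕.map V :=
    fun m hm => P.intertwines_mult hint hm
  have hmul : ∀ m ∈ P.toCStarAlg.mult, ∀ n, 𝓕.conj V (m * n) = 𝓕.conj V m * 𝓕.conj V n :=
    fun m hm => conj_mul_of_intertwines (hint' m hm)
  -- By nondegeneracy `b` is a limit of sums of `f(a) b'`, and `f(m) f(a) = f(m a)` with `m a ∈ P`.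
  have hleft : ∀ m ∈ P.toCStarAlg.mult, ∀ b ∈ Q.alg, 𝓕.conj V m * b ∈ Q.alg := by
    intro m hm b hb
    rw [← hnd] at hb ⊢
    refine map_mem_closedSpan (ContinuousLinearMap.mul ℂ _ (𝓕.conj V m)) ?_ hb
    rintro _ ⟨a, ha, b, hb, rfl⟩
    refine subset_closedSpan _ ⟨m * a, (hm a ha).1, b, hb, ?_⟩
    dsimp only
    rw [hmul m hm a, mul_assoc]
    rfl
  have hmult : ∀ m ∈ P.toCStarAlg.mult, 𝓕.conj V m ∈ Q.toCStarAlg.mult := by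
    refine fun m hm b hb => ⟨hleft m hm b hb, ?_⟩
    have h := Q.isObj.isCStar.star_mem (hleft _ (star_mem hm) _ (Q.isObj.isCStar.star_mem hb))
    rwa [conj_star, ← star_mul, star_star] at h
  let φ : P.toCStarAlg.mult →⋆ₐ[ℂ] Q.toCStarAlg.mult :=
    { toFun := fun m => ⟨𝓕.conj V m.1, hmult _ m.2⟩
      map_one' := Subtype.ext (conj_one hV)
      map_mul' := fun m n => Subtype.ext (hmul m.1 m.2 n.1)
      map_zero' := Subtype.ext (_root_.map_zero (𝓕.conj V))
      map_add' := fun m n => Subtype.ext (_root_.map_add (𝓕.conj V) m.1 n.1)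
      commutes' := fun z => Subtype.ext (by
        rw [Algebra.algebraMap_eq_smul_one, Algebra.algebraMap_eq_smul_one]
        exact (_root_.map_smul (𝓕.conj V) z 1).trans (congrArg (z • ·) (conj_one hV)))
      map_star' := fun m => Subtype.ext (conj_star V m.1) }
  refine ⟨⟨⟨φ, ?_⟩, K, V, ?_, fun m => rfl⟩, fun m => rfl⟩
  · refine Eq.trans (congrArg closedSpan (Set.ext fun T => ⟨?_, ?_⟩)) hnd
    · rintro ⟨a, ha, b, hb, rfl⟩
      exact ⟨a.1, ha, b, hb, rfl⟩
    · rintro ⟨a, ha, b, hb, rfl⟩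
      exact ⟨⟨a, P.toCStarAlg.alg_le_mult ha⟩, ha, b, hb, rfl⟩
  · rw [← ContinuousLinearMap.comp_assoc, hV, ContinuousLinearMap.id_comp]

/-- Since a morphism maps `1` to `1`, its partial isometry `V` is a coisometry, and it intertwines
`a ⊗ id` with the value of the morphism at `a`. -/
lemma Hom.exists_conj {P Q : AObj 𝓕} (f : P ⟶ Q) : ∃ (K : C) (V : P.H ⊗ K ⟶ Q.H),
    𝓕.IsCoisometry V ∧ (∀ m, f.val m = 𝓕.conj V m.1) ∧
    ∀ m : P.toCStarAlg.mult, 𝓕.map V ∘L 𝓕.amp (X := P.H) (Y := P.H) m.1 K =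
      f.val m ∘L 𝓕.map V := by
  obtain ⟨K, V, -, hV⟩ := f.exists_form
  have hV' : ∀ m, f.val m = 𝓕.conj V m.1 := hV
  have hco : 𝓕.IsCoisometry V := by
    have h1 := (hV' 1).symm
    have h2 : f.val 1 = ContinuousLinearMap.id ℂ _ := congrArg Subtype.val (map_one f.toHom.toHom)
    rw [h2, conj_apply] at h1
    have h3 : 𝓕.amp (X := P.H) (Y := P.H) (1 : P.toCStarAlg.mult).1 K =
      ContinuousLinearMap.id ℂ _ := 𝓕.amp_id P.H K
    rw [h3, ContinuousLinearMap.id_comp] at h1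
    exact h1
  refine ⟨K, V, hco, hV', fun m => ?_⟩
  rw [hV']
  refine intertwines_of_conj_mul_star hco ?_
  rw [← conj_star]
  refine (hV' (m * star m)).symm.trans (Eq.trans ?_ (congrArg₂ (· * ·) (hV' m) (hV' (star m))))
  exact congrArg Subtype.val (map_mul f.toHom.toHom m (star m))

/-- A morphism is determined by its values on the algebra. -/
lemma Hom.ext_alg {P Q : AObj 𝓕} {f g : P ⟶ Q}
    (h : ∀ m : P.toCStarAlg.mult, m.1 ∈ P.alg → f.val m = g.val m) : f = g := by
  have hval : ∀ m, f.val m = g.val m := by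
    intro m
    refine Q.ext_alg fun b hb => ?_
    rw [← show closedSpan _ = Q.alg from f.toHom.nondegenerate] at hb
    refine eqOn_closedSpan (S := ContinuousLinearMap.mul ℂ _ (f.val m))
      (T := ContinuousLinearMap.mul ℂ _ (g.val m)) ?_ hb
    rintro _ ⟨a, ha, b, hb, rfl⟩
    have h1 : f.val m * f.val a = f.val (m * a) :=
      (congrArg Subtype.val (map_mul f.toHom.toHom m a)).symm
    have h2 : g.val m * g.val a = g.val (m * a) :=
      (congrArg Subtype.val (map_mul g.toHom.toHom m a)).symm
    change f.val m * (f.val a * b) = g.val m * (f.val a * b)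
    rw [← mul_assoc, ← mul_assoc, h1, h a ha, h2, h (m * a) (m.2 a.1 ha).1]
  refine Hom.ext' (CStarAlg.Hom.ext' ?_)
  exact StarAlgHom.ext fun m => Subtype.ext (hval m)

end AObj
end Morphisms

/-! ### The tensor product and its inclusions -/

section Box

open CStarAlg (closedSpan_le subset_closedSpan isClosed_closedSpan)

variable {C : Type u} [Category.{v} C] [WStarCategory C] [MonoidalCategory C]
variable {𝓕 : FibreFunctor.{u, v, w} C}

namespace OpSpace

lemma closedSpan_image2_mul {X : C} (f g : OpSpace 𝓕 X X) {Y : Type*} {A : Set Y}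
    {φ : Y → 𝓕.obj X →L[ℂ] 𝓕.obj X} (hg : g = OpSpace.span (φ '' A)) :
    closedSpan (Set.image2 (fun a b => φ a * b) A f.carrier) = (f.comp g).carrier := by
  obtain rfl := hg
  conv_rhs => rw [← show OpSpace.span f.carrier = f from
    OpSpace.ext (closedSpan_eq_of_isClosed f.isClosed), OpSpace.comp_span]
  rw [OpSpace.compSet, Set.image2_image_right, Set.image2_swap]
  rfl

end OpSpace

namespace FibreFunctor

lemma isCoisometry_of_unitary {X Y : C} {f : X ⟶ Y} (hf : IsUnitaryMor f) :
    𝓕.IsCoisometry f := by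
  rw [IsCoisometry, ← map_adj, ← map_comp, hf.2, map_id]

lemma conj_id {X K : C} (a : 𝓕.obj X →L[ℂ] 𝓕.obj X) : 𝓕.conj (𝟙 (X ⊗ K)) a = 𝓕.amp a K := by
  rw [conj_apply, 𝓕.map_id, ContinuousLinearMap.adjoint_id, ContinuousLinearMap.id_comp,
    ContinuousLinearMap.comp_id]

lemma conj_iso {X K Y : C} (V : X ⊗ K ≅ Y) (hV : IsUnitaryMor V.hom)
    (a : 𝓕.obj X →L[ℂ] 𝓕.obj X) :
    𝓕.conj V.hom a = 𝓕.map V.hom ∘L 𝓕.amp a K ∘L 𝓕.map V.inv := by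
  rw [conj_apply, adjoint_map_hom V hV]

lemma intertwines_of_iso {X K Y : C} (V : X ⊗ K ≅ Y) (hV : IsUnitaryMor V.hom)
    (a : 𝓕.obj X →L[ℂ] 𝓕.obj X) :
    𝓕.map V.hom ∘L 𝓕.amp a K = 𝓕.conj V.hom a ∘L 𝓕.map V.hom := by
  rw [conj_iso V hV, ContinuousLinearMap.comp_assoc, ContinuousLinearMap.comp_assoc,
    map_inv_comp_map_hom, ContinuousLinearMap.comp_id]

end FibreFunctor

namespace AObj

open FibreFunctor KetBra

lemma amp_mul_star {X : C} (a : 𝓕.obj X →L[ℂ] 𝓕.obj X) (Z : C) :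
    𝓕.amp (a * star a) Z = 𝓕.amp a Z * star (𝓕.amp a Z) := by
  rw [ContinuousLinearMap.star_eq_adjoint, ContinuousLinearMap.star_eq_adjoint, ← 𝓕.amp_adjoint]
  exact 𝓕.amp_comp _ _ _

section

variable [MonoidalWStarCategory C]

lemma Hom.comp_val {P Q R : AObj 𝓕} (f : P ⟶ Q) (g : Q ⟶ R) (m : P.toCStarAlg.mult) :
    (f ≫ g).val m = g.val (f.toHom.toHom m) := rfl

lemma Hom.intertwines_of_conj_eq {P R : AObj 𝓕} (f : P ⟶ R) {X K : C} {V : X ⊗ K ⟶ R.H}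
    (hV : 𝓕.IsCoisometry V) {i : (𝓕.obj P.H →L[ℂ] 𝓕.obj P.H) → 𝓕.obj X →L[ℂ] 𝓕.obj X}
    (hi : ∀ a ∈ P.alg, i (a * star a) = i a * star (i a))
    (h : ∀ m : P.toCStarAlg.mult, m.1 ∈ P.alg → 𝓕.conj V (i m.1) = f.val m)
    (m : P.toCStarAlg.mult) (hm : m.1 ∈ P.alg) :
    𝓕.map V ∘L 𝓕.amp (i m.1) K = f.val m ∘L 𝓕.map V := by
  rw [← h m hm]
  refine intertwines_of_conj_mul_star hV ?_
  rw [← hi _ hm, h m hm]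
  refine (h (m * star m) (P.isObj.isCStar.mul_mem hm (P.isObj.isCStar.star_mem hm))).trans ?_
  refine (congrArg Subtype.val (map_mul f.toHom.toHom m (star m))).trans ?_
  exact congrArg (f.val m * ·) (congrArg Subtype.val (map_star f.toHom.toHom m))

end

variable [BraidedCategory C]

lemma conj_braiding (hc : IsBiRegularBraiding 𝓕) (P Q : AObj 𝓕)
    (b : 𝓕.obj Q.H →L[ℂ] 𝓕.obj Q.H) : 𝓕.conj (β_ Q.H P.H).hom b = inc₂ P Q b :=
  conj_iso (β_ Q.H P.H) (hc.unitary _ _) b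

lemma inc₂_mul_star (hc : IsBiRegularBraiding 𝓕) (P Q : AObj 𝓕)
    (b : 𝓕.obj Q.H →L[ℂ] 𝓕.obj Q.H) :
    inc₂ P Q (b * star b) = inc₂ P Q b * star (inc₂ P Q b) := by
  rw [← conj_braiding hc, ← conj_braiding hc, ← conj_star]
  exact conj_mul_of_intertwines (intertwines_of_iso _ (hc.unitary _ _) _) _

variable [MonoidalWStarCategory C]

/-- The tensor product of two objects of `A(C)`. -/
abbrev box (hc : IsBiRegularBraiding 𝓕) (P Q : AObj 𝓕) : AObj 𝓕 :=
  ⟨P.H ⊗ Q.H, boxAlg P Q, isObj_box hc P Q⟩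

lemma exists_inl (hc : IsBiRegularBraiding 𝓕) (P Q : AObj 𝓕) :
    ∃ f : P ⟶ box hc P Q, ∀ m, f.val m = inc₁ P Q m.1 := by
  have hu := isUnitaryMor_id (P.H ⊗ Q.H)
  obtain ⟨f, hf⟩ := exists_hom (P := P) (Q := box hc P Q) (K := Q.H) (𝟙 (P.H ⊗ Q.H))
    (isCoisometry_of_unitary hu) (fun a _ => intertwines_of_iso (Iso.refl _) hu a) (by
      change closedSpan (Set.image2 (fun a b => 𝓕.conj (𝟙 (P.H ⊗ Q.H)) a * b) P.alg
        (boxAlg P Q)) = boxAlg P Q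
      simp only [conj_id]
      rw [← boxSpace_carrier]
      refine (OpSpace.closedSpan_image2_mul (boxSpace P Q) (P.space ▷ ⟨Q.H⟩) rfl).trans ?_
      refine congrArg OpSpace.carrier (show boxSpace P Q ≫ P.space ▷ ⟨Q.H⟩ = boxSpace P Q from ?_)
      rw [boxSpace, Category.assoc, space_whiskerRight_comp])
  exact ⟨f, fun m => (hf m).trans (conj_id _)⟩

lemma exists_inr (hc : IsBiRegularBraiding 𝓕) (P Q : AObj 𝓕) :
    ∃ f : Q ⟶ box hc P Q, ∀ m, f.val m = inc₂ P Q m.1 := by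
  have hu := hc.unitary Q.H P.H
  obtain ⟨f, hf⟩ := exists_hom (P := Q) (Q := box hc P Q) (K := P.H) (β_ Q.H P.H).hom
    (isCoisometry_of_unitary hu) (fun a _ => intertwines_of_iso (β_ Q.H P.H) hu a) (by
      change closedSpan (Set.image2 (fun a b => 𝓕.conj (β_ Q.H P.H).hom a * b) Q.alg
        (boxAlg P Q)) = boxAlg P Q
      simp only [conj_braiding hc]
      rw [← boxSpace_carrier]
      refine (OpSpace.closedSpan_image2_mul (boxSpace P Q) (spaceR P Q) (spaceR_eq P Q)).trans ?_
      refine congrArg OpSpace.carrier (show boxSpace P Q ≫ spaceR P Q = boxSpace P Q from ?_)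
      rw [boxSpace, spaceR_comm hc, Category.assoc, spaceR_comp_spaceR])
  exact ⟨f, fun m => (hf m).trans (conj_braiding hc P Q _)⟩

/-- The inclusion `a ↦ a ⊠ 1`. -/
def inl (hc : IsBiRegularBraiding 𝓕) (P Q : AObj 𝓕) : P ⟶ box hc P Q := (exists_inl hc P Q).choose

/-- The inclusion `b ↦ 1 ⊠ b`. -/
def inr (hc : IsBiRegularBraiding 𝓕) (P Q : AObj 𝓕) : Q ⟶ box hc P Q := (exists_inr hc P Q).choose

lemma inl_val (hc : IsBiRegularBraiding 𝓕) (P Q : AObj 𝓕) (m : P.toCStarAlg.mult) :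
    (inl hc P Q).val m = inc₁ P Q m.1 := (exists_inl hc P Q).choose_spec m

lemma inr_val (hc : IsBiRegularBraiding 𝓕) (P Q : AObj 𝓕) (m : Q.toCStarAlg.mult) :
    (inr hc P Q).val m = inc₂ P Q m.1 := (exists_inr hc P Q).choose_spec m

/-- Morphisms out of `P ⊠ Q` are determined by their restrictions to `P` and `Q`. -/
lemma box_hom_ext (hc : IsBiRegularBraiding 𝓕) {P Q R : AObj 𝓕} {f g : box hc P Q ⟶ R}
    (h₁ : inl hc P Q ≫ f = inl hc P Q ≫ g) (h₂ : inr hc P Q ≫ f = inr hc P Q ≫ g) : f = g := by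
  obtain ⟨K, V, -, hV, -⟩ := f.exists_conj
  obtain ⟨M, W, -, hW, -⟩ := g.exists_conj
  refine Hom.ext_alg fun m hm => ?_
  rw [hV, hW]
  refine eqOn_closedSpan (S := 𝓕.conj V) (T := 𝓕.conj W) ?_
    (show m.1 ∈ closedSpan _ from hm)
  rintro _ ⟨a, ha, b, hb, rfl⟩
  set a' : P.toCStarAlg.mult := ⟨a, P.toCStarAlg.alg_le_mult ha⟩
  set b' : Q.toCStarAlg.mult := ⟨b, Q.toCStarAlg.alg_le_mult hb⟩
  set n : (box hc P Q).toCStarAlg.mult := (inl hc P Q).toHom.toHom a' * (inr hc P Q).toHom.toHom b'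
  have hn : n.1 = inc₁ P Q a * inc₂ P Q b :=
    congrArg₂ (· * ·) (inl_val hc P Q a') (inr_val hc P Q b')
  have hfg : f.toHom.toHom n = g.toHom.toHom n := by
    have e₁ : f.toHom.toHom ((inl hc P Q).toHom.toHom a') =
        g.toHom.toHom ((inl hc P Q).toHom.toHom a') := congrArg (fun h => h.toHom.toHom a') h₁
    have e₂ : f.toHom.toHom ((inr hc P Q).toHom.toHom b') =
        g.toHom.toHom ((inr hc P Q).toHom.toHom b') := congrArg (fun h => h.toHom.toHom b') h₂
    rw [map_mul, map_mul, e₁, e₂]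
  have h := (hV n).symm.trans ((congrArg Subtype.val hfg).trans (hW n))
  rwa [hn] at h

/-- Two morphisms `P ⟶ R` and `Q ⟶ R` that are compressed from `a ⊠ 1` and `1 ⊠ b` by the same
coisometry extend to a morphism `P ⊠ Q ⟶ R`. -/
lemma exists_boxDesc (hc : IsBiRegularBraiding 𝓕) {P Q R : AObj 𝓕} (f : P ⟶ R) (g : Q ⟶ R) {K : C}
    (V : (P.H ⊗ Q.H) ⊗ K ⟶ R.H) (hV : 𝓕.IsCoisometry V)
    (hf : ∀ m : P.toCStarAlg.mult, m.1 ∈ P.alg → 𝓕.conj V (inc₁ P Q m.1) = f.val m)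
    (hg : ∀ m : Q.toCStarAlg.mult, m.1 ∈ Q.alg → 𝓕.conj V (inc₂ P Q m.1) = g.val m) :
    ∃ h : box hc P Q ⟶ R, inl hc P Q ≫ h = f ∧ inr hc P Q ≫ h = g ∧
      ∀ m, h.val m = 𝓕.conj V m.1 := by
  have hf' := f.intertwines_of_conj_eq hV (fun a _ => amp_mul_star a Q.H) hf
  have hg' := g.intertwines_of_conj_eq hV (fun b _ => inc₂_mul_star hc P Q b) hg
  -- Since `V` intertwines `a ⊠ 1`, compression along `V` is multiplicative on `(a ⊠ 1) (1 ⊠ b)`.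
  have hmul : ∀ (m : P.toCStarAlg.mult) (n : Q.toCStarAlg.mult), m.1 ∈ P.alg → n.1 ∈ Q.alg →
      𝓕.conj V (inc₁ P Q m.1 * inc₂ P Q n.1) = f.val m * g.val n := by
    intro m n hm hn
    rw [conj_mul_of_intertwines ((hf' m hm).trans (congrArg (· ∘L 𝓕.map V) (hf m hm).symm)),
      hf m hm, hg n hn]
  -- Both sides are linear and continuous in `T`, so the products `(a ⊠ 1) (1 ⊠ b)` suffice.
  have hint : ∀ T ∈ boxAlg P Q, 𝓕.map V ∘L 𝓕.amp T K = 𝓕.conj V T ∘L 𝓕.map V := by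
    intro T hT
    refine eqOn_closedSpan
      (S := ContinuousLinearMap.compL ℂ _ _ _ (𝓕.map V) ∘L 𝓕.ampL (P.H ⊗ Q.H) (P.H ⊗ Q.H) K)
      (T := (ContinuousLinearMap.compL ℂ _ _ _).flip (𝓕.map V) ∘L 𝓕.conj V) ?_
      (show T ∈ closedSpan _ from hT)
    rintro _ ⟨a, ha, b, hb, rfl⟩
    set a' : P.toCStarAlg.mult := ⟨a, P.toCStarAlg.alg_le_mult ha⟩
    set b' : Q.toCStarAlg.mult := ⟨b, Q.toCStarAlg.alg_le_mult hb⟩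
    change 𝓕.map V ∘L 𝓕.amp (inc₁ P Q a'.1 * inc₂ P Q b'.1) K =
      𝓕.conj V (inc₁ P Q a'.1 * inc₂ P Q b'.1) ∘L 𝓕.map V
    rw [hmul a' b' ha hb, ContinuousLinearMap.mul_def, 𝓕.amp_comp,
      ← ContinuousLinearMap.comp_assoc, hf' a' ha, ContinuousLinearMap.comp_assoc, hg' b' hb]
    rfl
  -- `[f(P) g(Q) R] = [f(P) R] = R` by nondegeneracy of `g` and of `f`.
  have hnd : closedSpan (Set.image2 (fun a b => 𝓕.conj V a * b) (boxAlg P Q) R.alg) = R.alg := by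
    apply le_antisymm
    · refine closedSpan_le R.isObj.isCStar.isClosed ?_
      rintro _ ⟨T, hT, r, hr, rfl⟩
      have hR : closedSpan (R.alg : Set (𝓕.obj R.H →L[ℂ] 𝓕.obj R.H)) = R.alg :=
        closedSpan_eq_of_isClosed R.isObj.isCStar.isClosed
      rw [SetLike.mem_coe, ← hR]
      refine map_mem_closedSpan
        ((ContinuousLinearMap.mul ℂ (𝓕.obj R.H →L[ℂ] 𝓕.obj R.H)).flip r ∘L 𝓕.conj V) ?_
        (show T ∈ closedSpan _ from hT)
      rintro _ ⟨a, ha, b, hb, rfl⟩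
      refine subset_closedSpan _ ?_
      change 𝓕.conj V (inc₁ P Q a * inc₂ P Q b) * r ∈ R.alg
      rw [hmul ⟨a, P.toCStarAlg.alg_le_mult ha⟩ ⟨b, Q.toCStarAlg.alg_le_mult hb⟩ ha hb, mul_assoc]
      exact f.toHom.mul_mem _ (g.toHom.mul_mem _ hr)
    · intro r hr
      rw [← show closedSpan _ = R.alg from f.toHom.nondegenerate] at hr
      refine closedSpan_le (isClosed_closedSpan _) ?_ hr
      rintro _ ⟨m, hm, r, hr, rfl⟩
      rw [← show closedSpan _ = R.toCStarAlg.alg from g.toHom.nondegenerate] at hr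
      refine map_mem_closedSpan (ContinuousLinearMap.mul ℂ _ (f.val m)) ?_ hr
      rintro _ ⟨n, hn, r, hr, rfl⟩
      refine subset_closedSpan _ ⟨inc₁ P Q m.1 * inc₂ P Q n.1,
        subset_closedSpan _ ⟨m.1, hm, n.1, hn, rfl⟩, r, hr, ?_⟩
      dsimp only
      rw [hmul m n hm hn]
      exact mul_assoc _ _ _
  obtain ⟨h, hh⟩ := exists_hom (P := box hc P Q) (Q := R) V hV hint hnd
  refine ⟨h, Hom.ext_alg fun m hm => ?_, Hom.ext_alg fun m hm => ?_, hh⟩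
  · rw [← hf m hm]
    exact (hh _).trans (congrArg _ (inl_val hc P Q m))
  · rw [← hg m hm]
    exact (hh _).trans (congrArg _ (inr_val hc P Q m))

end AObj
end Box

/-! ### Calculus of compressions -/

section Compressions

variable {C : Type u} [Category.{v} C] [WStarCategory C] [MonoidalCategory C]

section

variable [MonoidalWStarCategory C]

lemma adj_whiskerRight {X Y : C} (f : X ⟶ Y) (Z : C) :
    WStarCategory.adj (f ▷ Z) = WStarCategory.adj f ▷ Z := by
  rw [← tensorHom_id, MonoidalWStarCategory.adj_tensor, adj_id, tensorHom_id]

lemma adj_whiskerLeft (Z : C) {X Y : C} (f : X ⟶ Y) :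
    WStarCategory.adj (Z ◁ f) = Z ◁ WStarCategory.adj f := by
  rw [← id_tensorHom, MonoidalWStarCategory.adj_tensor, adj_id, id_tensorHom]

lemma IsUnitaryMor.whiskerRight {X Y : C} {f : X ⟶ Y} (hf : IsUnitaryMor f) (Z : C) :
    IsUnitaryMor (f ▷ Z) := by
  rw [IsUnitaryMor, adj_whiskerRight, ← comp_whiskerRight, ← comp_whiskerRight, hf.1, hf.2,
    id_whiskerRight, id_whiskerRight]
  exact ⟨rfl, rfl⟩

lemma IsUnitaryMor.whiskerLeft (Z : C) {X Y : C} {f : X ⟶ Y} (hf : IsUnitaryMor f) :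
    IsUnitaryMor (Z ◁ f) := by
  rw [IsUnitaryMor, adj_whiskerLeft, ← whiskerLeft_comp, ← whiskerLeft_comp, hf.1, hf.2,
    whiskerLeft_id, whiskerLeft_id]
  exact ⟨rfl, rfl⟩

lemma isUnitaryMor_slide {X Y Z Y' Z' : C} {x : Y ⊗ Z ⟶ Y' ⊗ Z'} (hx : IsUnitaryMor x) :
    IsUnitaryMor ((α_ X Y Z).hom ≫ X ◁ x ≫ (α_ X Y' Z').inv) :=
  (MonoidalWStarCategory.associator_unitary _ _ _).comp ((hx.whiskerLeft X).comp
    (MonoidalWStarCategory.associator_unitary _ _ _).inv)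

end

variable {𝓕 : FibreFunctor.{u, v, w} C}

namespace FibreFunctor

lemma IsCoisometry.unitary_comp {X Y Z : C} {u : X ⟶ Y} (hu : IsUnitaryMor u) {V : Y ⟶ Z}
    (hV : 𝓕.IsCoisometry V) : 𝓕.IsCoisometry (u ≫ V) := by
  rw [IsCoisometry, map_comp, ContinuousLinearMap.adjoint_comp, ContinuousLinearMap.comp_assoc,
    ← ContinuousLinearMap.comp_assoc (𝓕.map u),
    show 𝓕.map u ∘L ContinuousLinearMap.adjoint (𝓕.map u) = _ from isCoisometry_of_unitary hu,
    ContinuousLinearMap.id_comp]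
  exact hV

lemma IsCoisometry.comp {X Y Z : C} {V : X ⟶ Y} (hV : 𝓕.IsCoisometry V) {W : Y ⟶ Z}
    (hW : 𝓕.IsCoisometry W) : 𝓕.IsCoisometry (V ≫ W) := by
  rw [IsCoisometry, map_comp, ContinuousLinearMap.adjoint_comp, ContinuousLinearMap.comp_assoc,
    ← ContinuousLinearMap.comp_assoc (𝓕.map V),
    show 𝓕.map V ∘L ContinuousLinearMap.adjoint (𝓕.map V) = _ from hV,
    ContinuousLinearMap.id_comp]
  exact hW

lemma IsCoisometry.whiskerRight {X Y : C} {V : X ⟶ Y} (hV : 𝓕.IsCoisometry V) (Z : C) :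
    𝓕.IsCoisometry (V ▷ Z) := by
  rw [IsCoisometry, map_whiskerRight, ← amp_adjoint, ← amp_comp,
    show 𝓕.map V ∘L ContinuousLinearMap.adjoint (𝓕.map V) = _ from hV, amp_id]

lemma IsCoisometry.whiskerLeft (Z : C) {X Y : C} {V : X ⟶ Y} (hV : 𝓕.IsCoisometry V) :
    𝓕.IsCoisometry (Z ◁ V) := by
  rw [IsCoisometry, map_whiskerLeft, ← wl_adjoint, ← wl_comp,
    show 𝓕.map V ∘L ContinuousLinearMap.adjoint (𝓕.map V) = _ from hV, wl_id]

lemma IsCoisometry.tensor {X Y X' Y' : C} {V : X ⟶ Y} (hV : 𝓕.IsCoisometry V) {W : X' ⟶ Y'}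
    (hW : 𝓕.IsCoisometry W) : 𝓕.IsCoisometry (V ⊗ₘ W) := by
  rw [MonoidalCategory.tensorHom_def]
  exact (hV.whiskerRight _).comp (hW.whiskerLeft _)

/-- If `a ⊗ id` slides through the unitary `u` and becomes `b ⊗ id`, then `u` can be dropped from a
compression of `a`. -/
lemma conj_unitary_comp {X K Y M Z : C} {u : X ⊗ K ⟶ Y ⊗ M} (hu : IsUnitaryMor u) (V : Y ⊗ M ⟶ Z)
    {a : 𝓕.obj X →L[ℂ] 𝓕.obj X} {b : 𝓕.obj Y →L[ℂ] 𝓕.obj Y}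
    (h : 𝓕.map u ∘L 𝓕.amp a K = 𝓕.amp b M ∘L 𝓕.map u) : 𝓕.conj (u ≫ V) a = 𝓕.conj V b := by
  have h' : 𝓕.map u ∘L 𝓕.amp a K ∘L ContinuousLinearMap.adjoint (𝓕.map u) = 𝓕.amp b M := by
    rw [← ContinuousLinearMap.comp_assoc, h, ContinuousLinearMap.comp_assoc,
      show 𝓕.map u ∘L ContinuousLinearMap.adjoint (𝓕.map u) = _ from isCoisometry_of_unitary hu,
      ContinuousLinearMap.comp_id]
  rw [conj_apply, conj_apply, map_comp, ContinuousLinearMap.adjoint_comp, ← h']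
  rfl

/-- Compressing twice is compressing along a composite. -/
lemma conj_conj {X Z X' K Y : C} (U : X ⊗ Z ⟶ X') (V : X' ⊗ K ⟶ Y)
    (a : 𝓕.obj X →L[ℂ] 𝓕.obj X) : 𝓕.conj V (𝓕.conj U a) = 𝓕.conj (U ▷ K ≫ V) (𝓕.amp a Z) := by
  rw [conj_apply, conj_apply, conj_apply, map_comp, map_whiskerRight, amp_comp, amp_comp,
    amp_adjoint, ContinuousLinearMap.adjoint_comp]
  rfl

lemma conj_comp {X K Y Z : C} (V : X ⊗ K ⟶ Y) (g : Y ⟶ Z) (a : 𝓕.obj X →L[ℂ] 𝓕.obj X) :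
    𝓕.conj (V ≫ g) a = 𝓕.map g ∘L 𝓕.conj V a ∘L ContinuousLinearMap.adjoint (𝓕.map g) := by
  rw [conj_apply, conj_apply, map_comp, ContinuousLinearMap.adjoint_comp]
  rfl

lemma conj_rightUnitor_comp [MonoidalWStarCategory C] {X Z : C} (g : X ⟶ Z)
    (a : 𝓕.obj X →L[ℂ] 𝓕.obj X) :
    𝓕.conj ((ρ_ X).hom ≫ g) a = 𝓕.map g ∘L a ∘L ContinuousLinearMap.adjoint (𝓕.map g) := by
  rw [conj_comp, conj_iso (ρ_ X) (MonoidalWStarCategory.rightUnitor_unitary X),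
    ← ContinuousLinearMap.comp_assoc (𝓕.map (ρ_ X).hom), map_rightUnitor_amp,
    ContinuousLinearMap.comp_assoc a, map_hom_comp_map_inv, ContinuousLinearMap.comp_id]

lemma conj_tensorHom {X K X' Y Y' : C} (V : X ⊗ K ⟶ X') {W : Y ⟶ Y'} (hW : 𝓕.IsCoisometry W)
    (a : 𝓕.obj X →L[ℂ] 𝓕.obj X) :
    𝓕.conj (V ⊗ₘ W) (𝓕.amp a K) = 𝓕.amp (𝓕.conj V a) Y' := by
  have h : 𝓕.map (X' ◁ W) ∘L ContinuousLinearMap.adjoint (𝓕.map (X' ◁ W)) = _ := hW.whiskerLeft X'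
  rw [MonoidalCategory.tensorHom_def, conj_comp, ← Category.comp_id (V ▷ Y), ← conj_conj, conj_id,
    map_whiskerLeft, ← ContinuousLinearMap.comp_assoc, wl_comp_amp,
    ContinuousLinearMap.comp_assoc, ← map_whiskerLeft, h, ContinuousLinearMap.comp_id]

/-- An operator on the first of three tensor factors commutes with a morphism on the other two. -/
lemma map_slide {X Y Y' Z Z' : C} (x : Y ⊗ Z ⟶ Y' ⊗ Z') (a : 𝓕.obj X →L[ℂ] 𝓕.obj X) :
    𝓕.map ((α_ X Y Z).hom ≫ X ◁ x ≫ (α_ X Y' Z').inv) ∘L 𝓕.amp (𝓕.amp a Y) Z =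
      𝓕.amp (𝓕.amp a Y') Z' ∘L 𝓕.map ((α_ X Y Z).hom ≫ X ◁ x ≫ (α_ X Y' Z').inv) := by
  let f : (⟨X⟩ : BddCat 𝓕) ⟶ ⟨X⟩ := a
  change f ▷ ⟨Y⟩ ▷ ⟨Z⟩ ≫ BddCat.op _ = BddCat.op _ ≫ f ▷ ⟨Y'⟩ ▷ ⟨Z'⟩
  rw [BddCat.op_comp, BddCat.op_comp, BddCat.op_associator_hom, BddCat.op_associator_inv,
    BddCat.op_whiskerLeft, associator_naturality_left_assoc, ← whisker_exchange_assoc]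
  simp only [Category.assoc]
  rw [← associator_inv_naturality_left]
  rfl

lemma conj_comp_inv {X K Y Z : C} {V : X ⊗ K ⟶ Y} {g : Z ≅ Y} (hg : IsUnitaryMor g.hom)
    {a : 𝓕.obj X →L[ℂ] 𝓕.obj X} {b : 𝓕.obj Z →L[ℂ] 𝓕.obj Z}
    (h : 𝓕.map g.hom ∘L b ∘L ContinuousLinearMap.adjoint (𝓕.map g.hom) = 𝓕.conj V a) :
    𝓕.conj (V ≫ g.inv) a = b := by
  have hi : ContinuousLinearMap.adjoint (𝓕.map g.inv) = 𝓕.map g.hom := adjoint_map_inv g hg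
  have hh : ContinuousLinearMap.adjoint (𝓕.map g.hom) = 𝓕.map g.inv := adjoint_map_hom g hg
  rw [conj_comp, ← h, hi, hh]
  simp only [ContinuousLinearMap.comp_assoc, map_inv_comp_map_hom, ContinuousLinearMap.comp_id]
  rw [← ContinuousLinearMap.comp_assoc, map_inv_comp_map_hom, ContinuousLinearMap.id_comp]

/-- `a ⊗ 1 ⊗ 1` under the associator. -/
lemma conj_associator_amp [MonoidalWStarCategory C] (X Y Z : C) (a : 𝓕.obj X →L[ℂ] 𝓕.obj X) :
    𝓕.conj (α_ X Y Z).hom (𝓕.amp a Y) = 𝓕.amp a (Y ⊗ Z) := by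
  rw [← Category.comp_id (α_ X Y Z).hom,
    conj_unitary_comp (MonoidalWStarCategory.associator_unitary _ _ _) _
      (𝓕.map_associator_amp a _ _), conj_id]

end FibreFunctor

end Compressions

/-! ### Identities in braided categories -/

section Diagrams

variable {C : Type u} [Category.{v} C] [MonoidalCategory C] [BraidedCategory C]

open BraidedCategory

/-- The left side carries `b` on `Q` to `1 ⊠ b ⊠ 1`; on the right side `b` slides through the
bracketed morphism, which does not act on `Q`. -/
lemma braiding_associator (P Q R : C) : (β_ Q P).hom ▷ R ≫ (α_ P Q R).hom =
    ((α_ Q P R).hom ≫ Q ◁ (β_ R P).inv ≫ (α_ Q R P).inv) ≫ (β_ (Q ⊗ R) P).hom := by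
  simp

/-- The Yang-Baxter equation, arranged so that an operator on `R` slides through the bracketed
morphism. -/
lemma braiding_tensor_associator (P Q R : C) : (β_ R (P ⊗ Q)).hom ≫ (α_ P Q R).hom =
    (R ◁ (β_ Q P).inv ≫ (α_ R Q P).inv) ≫ (β_ R Q).hom ▷ P ≫ (β_ (Q ⊗ R) P).hom := by
  rw [Category.assoc, ← cancel_epi (R ◁ (β_ Q P).hom)]
  simpa using (yang_baxter R Q P).symm

/-- The middle-four interchange `(P ⊗ Q) ⊗ (K ⊗ M) ⟶ (P ⊗ K) ⊗ (Q ⊗ M)` after a crossing of `Q`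
and `P`, rewritten as a crossing of `Q ⊗ M` and `P ⊗ K`, before which nothing acts on `Q`. -/
lemma braiding_tensorμ (P Q K M : C) : (β_ Q P).hom ▷ (K ⊗ M) ≫ tensorμ P Q K M =
    ((α_ Q P (K ⊗ M)).hom ≫ Q ◁ ((α_ P K M).inv ≫ (β_ M (P ⊗ K)).inv) ≫
      (α_ Q M (P ⊗ K)).inv) ≫ (β_ (Q ⊗ M) (P ⊗ K)).hom := by
  rw [braiding_tensor_left_hom Q M (P ⊗ K)]
  simp only [whiskerLeft_comp, Category.assoc, Iso.inv_hom_id_assoc, whiskerLeft_inv_hom_assoc]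
  simp [tensorμ]

end Diagrams

/-! ### Tensor products of morphisms and associators -/

section Tensor

open CStarAlg (closedSpan_le subset_closedSpan isClosed_closedSpan)

variable {C : Type u} [Category.{v} C] [WStarCategory C] [MonoidalCategory C]
  [MonoidalWStarCategory C] [BraidedCategory C] {𝓕 : FibreFunctor.{u, v, w} C}

namespace AObj

open FibreFunctor MonoidalWStarCategory BraidedCategory

/-- If `f` and `g` are compressions along `V` and `W`, then `f ⊠ g` is the compression along `V ⊗ W`
after exchanging the middle factors with the braiding. -/
lemma exists_boxMap (hc : IsBiRegularBraiding 𝓕) {P Q P' Q' : AObj 𝓕} (f : P ⟶ P') (g : Q ⟶ Q') :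
    ∃ h : box hc P Q ⟶ box hc P' Q',
      inl hc P Q ≫ h = f ≫ inl hc P' Q' ∧ inr hc P Q ≫ h = g ≫ inr hc P' Q' := by
  obtain ⟨K, V, hV, hfV, -⟩ := f.exists_conj
  obtain ⟨M, W, hW, hgW, -⟩ := g.exists_conj
  have hx : IsUnitaryMor ((α_ Q.H K M).inv ≫ (β_ Q.H K).hom ▷ M ≫ (α_ K Q.H M).hom) :=
    (associator_unitary _ _ _).inv.comp
      (((hc.unitary _ _).whiskerRight M).comp (associator_unitary _ _ _))
  have hμ : tensorμ P.H Q.H K M = (α_ P.H Q.H (K ⊗ M)).hom ≫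
      P.H ◁ ((α_ Q.H K M).inv ≫ (β_ Q.H K).hom ▷ M ≫ (α_ K Q.H M).hom) ≫
        (α_ P.H K (Q.H ⊗ M)).inv := by
    simp [tensorμ]
  have hμu : IsUnitaryMor (tensorμ P.H Q.H K M) := hμ ▸ isUnitaryMor_slide hx
  have hf : ∀ m : P.toCStarAlg.mult, m.1 ∈ P.alg →
      𝓕.conj (tensorμ P.H Q.H K M ≫ (V ⊗ₘ W)) (inc₁ P Q m.1) = (f ≫ inl hc P' Q').val m := by
    intro m _
    rw [Hom.comp_val, inl_val, inc₁, hμ,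
      conj_unitary_comp (isUnitaryMor_slide hx) _ (map_slide _ _), conj_tensorHom _ hW, ← hfV]
    rfl
  have hg : ∀ m : Q.toCStarAlg.mult, m.1 ∈ Q.alg →
      𝓕.conj (tensorμ P.H Q.H K M ≫ (V ⊗ₘ W)) (inc₂ P Q m.1) = (g ≫ inr hc P' Q').val m := by
    intro m _
    have hy : IsUnitaryMor ((α_ P.H K M).inv ≫ (β_ M (P.H ⊗ K)).inv) :=
      (associator_unitary _ _ _).inv.comp (hc.unitary _ _).inv
    rw [Hom.comp_val, inr_val, ← conj_braiding hc, conj_conj, ← Category.assoc, braiding_tensorμ,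
      Category.assoc, conj_unitary_comp (isUnitaryMor_slide hy) _ (map_slide _ _),
      ← braiding_naturality, conj_comp, conj_tensorHom _ hV, ← hgW, ← conj_braiding hc]
    rfl
  obtain ⟨h, h₁, h₂, -⟩ := exists_boxDesc hc (f ≫ inl hc P' Q') (g ≫ inr hc P' Q')
    (tensorμ P.H Q.H K M ≫ (V ⊗ₘ W)) (.unitary_comp hμu (hV.tensor hW)) hf hg
  exact ⟨h, h₁, h₂⟩

/-- `1 ⊠ b ⊠ 1` under the associator. -/
lemma conj_associator_inc₂ (hc : IsBiRegularBraiding 𝓕) (P Q R : AObj 𝓕)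
    (b : 𝓕.obj Q.H →L[ℂ] 𝓕.obj Q.H) :
    𝓕.conj (α_ P.H Q.H R.H).hom (inc₂ P Q b) =
      𝓕.conj (β_ (Q.H ⊗ R.H) P.H).hom (𝓕.amp b R.H) := by
  rw [← conj_braiding hc, conj_conj, braiding_associator,
    conj_unitary_comp (isUnitaryMor_slide (hc.unitary _ _).inv) _ (map_slide _ _)]

/-- `1 ⊠ 1 ⊠ c` under the associator. -/
lemma conj_associator_inc₂_inc₂ (hc : IsBiRegularBraiding 𝓕) (P Q R : AObj 𝓕)
    (c : 𝓕.obj R.H →L[ℂ] 𝓕.obj R.H) :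
    𝓕.conj ((β_ R.H (P.H ⊗ Q.H)).hom ≫ (α_ P.H Q.H R.H).hom) c =
      𝓕.conj (β_ (Q.H ⊗ R.H) P.H).hom (inc₂ Q R c) := by
  have hu : IsUnitaryMor (R.H ◁ (β_ Q.H P.H).inv ≫ (α_ R.H Q.H P.H).inv) :=
    ((hc.unitary _ _).inv.whiskerLeft _).comp (associator_unitary _ _ _).inv
  rw [← conj_braiding hc, conj_conj, braiding_tensor_associator, conj_unitary_comp hu]
  let f : (⟨R.H⟩ : BddCat 𝓕) ⟶ ⟨R.H⟩ := c
  change f ▷ (⟨P.H⟩ ⊗ ⟨Q.H⟩) ≫ BddCat.op _ = BddCat.op _ ≫ f ▷ ⟨Q.H⟩ ▷ ⟨P.H⟩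
  rw [BddCat.op_comp, BddCat.op_whiskerLeft, BddCat.op_associator_inv, Category.assoc,
    ← associator_inv_naturality_left, ← whisker_exchange_assoc]
  rfl

/-- The restriction of the associator to `(P ⊠ Q) ⊠ 1`. -/
lemma exists_inlAssoc (hc : IsBiRegularBraiding 𝓕) (P Q R : AObj 𝓕) :
    ∃ k : box hc P Q ⟶ box hc P (box hc Q R), inl hc P Q ≫ k = inl hc P (box hc Q R) ∧
      inr hc P Q ≫ k = inl hc Q R ≫ inr hc P (box hc Q R) ∧
      ∀ m, k.val m = 𝓕.conj (α_ P.H Q.H R.H).hom m.1 := by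
  have h₁ : ∀ m : P.toCStarAlg.mult, m.1 ∈ P.alg →
      𝓕.conj (α_ P.H Q.H R.H).hom (inc₁ P Q m.1) = (inl hc P (box hc Q R)).val m := by
    intro m _
    rw [inl_val]
    exact conj_associator_amp P.H Q.H R.H m.1
  have h₂ : ∀ m : Q.toCStarAlg.mult, m.1 ∈ Q.alg →
      𝓕.conj (α_ P.H Q.H R.H).hom (inc₂ P Q m.1) =
        (inl hc Q R ≫ inr hc P (box hc Q R)).val m := by
    intro m _
    rw [Hom.comp_val, inr_val, ← conj_braiding hc P (box hc Q R)]
    exact (conj_associator_inc₂ hc P Q R m.1).trans (congrArg _ (inl_val hc Q R m).symm)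
  exact exists_boxDesc hc (inl hc P (box hc Q R)) (inl hc Q R ≫ inr hc P (box hc Q R))
    (α_ P.H Q.H R.H).hom (isCoisometry_of_unitary (associator_unitary _ _ _)) h₁ h₂

lemma exists_boxAssoc (hc : IsBiRegularBraiding 𝓕) (P Q R : AObj 𝓕) :
    ∃ h : box hc (box hc P Q) R ⟶ box hc P (box hc Q R),
      inl hc P Q ≫ inl hc (box hc P Q) R ≫ h = inl hc P (box hc Q R) ∧
      inr hc P Q ≫ inl hc (box hc P Q) R ≫ h = inl hc Q R ≫ inr hc P (box hc Q R) ∧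
      inr hc (box hc P Q) R ≫ h = inr hc Q R ≫ inr hc P (box hc Q R) := by
  have hα := associator_unitary P.H Q.H R.H
  obtain ⟨k, hk₁, hk₂, hk⟩ := exists_inlAssoc hc P Q R
  have h₃ : ∀ m : (box hc P Q).toCStarAlg.mult, m.1 ∈ (box hc P Q).alg →
      𝓕.conj ((ρ_ _).hom ≫ (α_ P.H Q.H R.H).hom) (inc₁ (box hc P Q) R m.1) = k.val m := by
    intro m _
    rw [conj_rightUnitor_comp, hk]
    rfl
  have h₄ : ∀ m : R.toCStarAlg.mult, m.1 ∈ R.alg →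
      𝓕.conj ((ρ_ _).hom ≫ (α_ P.H Q.H R.H).hom) (inc₂ (box hc P Q) R m.1) =
        (inr hc Q R ≫ inr hc P (box hc Q R)).val m := by
    intro m _
    rw [conj_rightUnitor_comp, ← conj_braiding hc, ← conj_comp, Hom.comp_val, inr_val,
      ← conj_braiding hc]
    exact (conj_associator_inc₂_inc₂ hc P Q R m.1).trans (congrArg _ (inr_val hc Q R m).symm)
  obtain ⟨h, hh₁, hh₂, -⟩ := exists_boxDesc hc k (inr hc Q R ≫ inr hc P (box hc Q R))
    ((ρ_ _).hom ≫ (α_ P.H Q.H R.H).hom)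
    (.unitary_comp (rightUnitor_unitary _) (isCoisometry_of_unitary hα)) h₃ h₄
  exact ⟨h, by rw [hh₁, hk₁], by rw [hh₁, hk₂], hh₂⟩

/-- The inverse associator: the inclusions of `Q` and `R` extend to `k` on `Q ⊠ R`, a compression
along the braiding, and then the inclusion of `P` and `k` extend to `P ⊠ (Q ⊠ R)`. -/
lemma exists_boxAssoc_inv (hc : IsBiRegularBraiding 𝓕) (P Q R : AObj 𝓕) :
    ∃ h : box hc P (box hc Q R) ⟶ box hc (box hc P Q) R,
      inl hc P (box hc Q R) ≫ h = inl hc P Q ≫ inl hc (box hc P Q) R ∧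
      inl hc Q R ≫ inr hc P (box hc Q R) ≫ h = inr hc P Q ≫ inl hc (box hc P Q) R ∧
      inr hc Q R ≫ inr hc P (box hc Q R) ≫ h = inr hc (box hc P Q) R := by
  have hα := associator_unitary P.H Q.H R.H
  have hβ := hc.unitary (Q.H ⊗ R.H) P.H
  have h₁ : ∀ m : Q.toCStarAlg.mult, m.1 ∈ Q.alg →
      𝓕.conj ((β_ (Q.H ⊗ R.H) P.H).hom ≫ (α_ P.H Q.H R.H).inv) (inc₁ Q R m.1) =
        (inr hc P Q ≫ inl hc (box hc P Q) R).val m := by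
    intro m _
    rw [Hom.comp_val, inl_val]
    refine (conj_comp_inv hα (b := 𝓕.amp (inc₂ P Q m.1) R.H) ?_).trans
      (congrArg (fun T => 𝓕.amp T R.H) (inr_val hc P Q m).symm)
    exact conj_associator_inc₂ hc P Q R m.1
  have h₂ : ∀ m : R.toCStarAlg.mult, m.1 ∈ R.alg →
      𝓕.conj ((β_ (Q.H ⊗ R.H) P.H).hom ≫ (α_ P.H Q.H R.H).inv) (inc₂ Q R m.1) =
        (inr hc (box hc P Q) R).val m := by
    intro m _
    rw [inr_val]
    refine conj_comp_inv hα ?_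
    rw [← conj_associator_inc₂_inc₂ hc, conj_comp]
    exact congrArg (fun T => _ ∘L T ∘L _) (conj_braiding hc (box hc P Q) R m.1).symm
  obtain ⟨k, hk₁, hk₂, hk⟩ := exists_boxDesc hc (inr hc P Q ≫ inl hc (box hc P Q) R)
    (inr hc (box hc P Q) R) ((β_ (Q.H ⊗ R.H) P.H).hom ≫ (α_ P.H Q.H R.H).inv)
    (isCoisometry_of_unitary (hβ.comp hα.inv)) h₁ h₂
  have h₃ : ∀ m : P.toCStarAlg.mult, m.1 ∈ P.alg →
      𝓕.conj ((ρ_ _).hom ≫ (α_ P.H Q.H R.H).inv) (inc₁ P (box hc Q R) m.1) =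
        (inl hc P Q ≫ inl hc (box hc P Q) R).val m := by
    intro m _
    rw [conj_rightUnitor_comp, Hom.comp_val, inl_val, inc₁, inc₁]
    refine Eq.trans ?_ (congrArg (fun T => 𝓕.amp T R.H) (inl_val hc P Q m).symm)
    refine Eq.trans ?_ (conj_comp_inv (V := 𝟙 _) hα (conj_associator_amp P.H Q.H R.H m.1 |>.trans
      (conj_id _).symm))
    rw [conj_comp, conj_id]
  have h₄ : ∀ m : (box hc Q R).toCStarAlg.mult, m.1 ∈ (box hc Q R).alg →
      𝓕.conj ((ρ_ _).hom ≫ (α_ P.H Q.H R.H).inv) (inc₂ P (box hc Q R) m.1) = k.val m := by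
    intro m _
    rw [conj_rightUnitor_comp, ← conj_braiding hc, ← conj_comp, hk]
  obtain ⟨h, hh₁, hh₂, -⟩ := exists_boxDesc hc (inl hc P Q ≫ inl hc (box hc P Q) R) k
    ((ρ_ _).hom ≫ (α_ P.H Q.H R.H).inv)
    (.unitary_comp (rightUnitor_unitary _) (isCoisometry_of_unitary hα.inv)) h₃ h₄
  exact ⟨h, hh₁, by rw [hh₂, hk₁], by rw [hh₂, hk₂]⟩

end AObj
end Tensor

/-! ### The monoidal category `A(C)` -/

section Monoidal

open CStarAlg (closedSpan_le subset_closedSpan isClosed_closedSpan)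

variable {C : Type u} [Category.{v} C] [WStarCategory C] [MonoidalCategory C]
  {𝓕 : FibreFunctor.{u, v, w} C}

namespace FibreFunctor

/-- The operators on the Hilbert space of the unit object are scalars. -/
lemma exists_eq_smul_one (T : 𝓕.obj (𝟙_ C) →L[ℂ] 𝓕.obj (𝟙_ C)) : ∃ z : ℂ, T = z • 1 := by
  refine ⟨𝓕.ε.symm (T (𝓕.ε 1)), ?_⟩
  ext x
  obtain ⟨s, rfl⟩ := 𝓕.ε.surjective x
  have h : 𝓕.ε s = s • 𝓕.ε 1 := by rw [← _root_.map_smul, smul_eq_mul, mul_one]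
  apply 𝓕.ε.symm.injective
  rw [h, _root_.map_smul, _root_.map_smul, _root_.map_smul, _root_.map_smul]
  simp [mul_comm]

end FibreFunctor

namespace AObj

open FibreFunctor MonoidalWStarCategory

lemma isObj_unit : IsObj 𝓕 (𝟙_ C) ⊤ where
  isCStar :=
    { isClosed := isClosed_univ
      mul_mem := fun _ _ => trivial
      star_mem := fun _ => trivial
      nondegenerate := eq_top_iff.2 fun x _ => subset_closedSpan _ ⟨1, trivial, x, rfl⟩ }
  exists_leg := by
    refine ⟨𝟙_ C, 𝟙 _, (eq_top_iff.2 fun T _ => ?_).symm⟩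
    have h1 : (1 : 𝓕.obj (𝟙_ C) →L[ℂ] 𝓕.obj (𝟙_ C)) ∈ legAlgebra 𝓕 (𝟙 (𝟙_ C ⊗ 𝟙_ C)) := by
      rw [legAlgebra, closedSpan_leftSlices]
      refine subset_closedSpan _ ⟨𝓕.ε 1, 𝓕.ε 1, ?_⟩
      rw [𝓕.map_id, ContinuousLinearMap.id_comp, 𝓕.adjoint_ketLeft_comp_ketLeft]
      simp [ContinuousLinearMap.one_def]
    obtain ⟨z, rfl⟩ := exists_eq_smul_one T
    exact Submodule.smul_mem _ z h1

variable (𝓕) in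
/-- The unit object: the scalars acting on the unit object of the category. -/
abbrev unit : AObj 𝓕 := ⟨𝟙_ C, ⊤, isObj_unit⟩

variable [MonoidalWStarCategory C]

lemma unit_hom_ext {P : AObj 𝓕} (f g : unit 𝓕 ⟶ P) : f = g := by
  obtain ⟨K, V, hV, hf, -⟩ := f.exists_conj
  obtain ⟨M, W, hW, hg, -⟩ := g.exists_conj
  refine Hom.ext_alg fun m _ => ?_
  rw [hf, hg]
  obtain ⟨z, hz⟩ := exists_eq_smul_one (𝓕 := 𝓕) m.1
  rw [hz, _root_.map_smul, _root_.map_smul, conj_one hV, conj_one hW]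

/-- The inclusion of the scalars, compressed along the left unit isomorphism. -/
lemma exists_init (P : AObj 𝓕) : ∃ f : unit 𝓕 ⟶ P, ∀ m, f.val m = 𝓕.conj (λ_ P.H).hom m.1 := by
  have hu := leftUnitor_unitary P.H
  refine exists_hom (P := unit 𝓕) (λ_ P.H).hom (isCoisometry_of_unitary hu)
    (fun a _ => intertwines_of_iso (λ_ P.H) hu a) (le_antisymm ?_ ?_)
  · refine closedSpan_le P.isObj.isCStar.isClosed ?_
    rintro _ ⟨a, -, b, hb, rfl⟩
    obtain ⟨z, rfl⟩ := exists_eq_smul_one a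
    dsimp only
    rw [_root_.map_smul, conj_one (isCoisometry_of_unitary hu), smul_mul_assoc, one_mul]
    exact P.alg.smul_mem z hb
  · intro b hb
    refine subset_closedSpan _ ⟨1, trivial, b, hb, ?_⟩
    dsimp only
    rw [conj_one (isCoisometry_of_unitary hu), one_mul]

lemma conj_rightUnitor {X : C} (a : 𝓕.obj X →L[ℂ] 𝓕.obj X) : 𝓕.conj (ρ_ X).hom a = a := by
  rw [← Category.comp_id (ρ_ X).hom, conj_rightUnitor_comp, 𝓕.map_id,
    ContinuousLinearMap.adjoint_id, ContinuousLinearMap.id_comp, ContinuousLinearMap.comp_id]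

variable [BraidedCategory C]

lemma exists_boxLeftUnitor (hc : IsBiRegularBraiding 𝓕) (P : AObj 𝓕) :
    ∃ h : box hc (unit 𝓕) P ⟶ P, inr hc (unit 𝓕) P ≫ h = 𝟙 P := by
  obtain ⟨f, hf⟩ := P.exists_init
  have h₁ : ∀ m : (unit 𝓕).toCStarAlg.mult, m.1 ∈ (unit 𝓕).alg →
      𝓕.conj ((ρ_ _).hom ≫ (λ_ P.H).hom) (inc₁ (unit 𝓕) P m.1) = f.val m := by
    intro m _
    rw [conj_rightUnitor_comp, hf]
    rfl
  have h₂ : ∀ m : P.toCStarAlg.mult, m.1 ∈ P.alg →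
      𝓕.conj ((ρ_ _).hom ≫ (λ_ P.H).hom) (inc₂ (unit 𝓕) P m.1) = Hom.val (𝟙 P) m := by
    intro m _
    rw [conj_rightUnitor_comp, ← conj_braiding hc, ← conj_comp, braiding_leftUnitor,
      conj_rightUnitor]
    rfl
  obtain ⟨h, -, hh, -⟩ := exists_boxDesc hc f (𝟙 P) ((ρ_ _).hom ≫ (λ_ P.H).hom)
    (isCoisometry_of_unitary ((rightUnitor_unitary _).comp (leftUnitor_unitary _))) h₁ h₂
  exact ⟨h, hh⟩

lemma exists_boxRightUnitor (hc : IsBiRegularBraiding 𝓕) (P : AObj 𝓕) :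
    ∃ h : box hc P (unit 𝓕) ⟶ P, inl hc P (unit 𝓕) ≫ h = 𝟙 P := by
  obtain ⟨f, hf⟩ := P.exists_init
  have h₁ : ∀ m : P.toCStarAlg.mult, m.1 ∈ P.alg →
      𝓕.conj ((ρ_ _).hom ≫ (ρ_ P.H).hom) (inc₁ P (unit 𝓕) m.1) = Hom.val (𝟙 P) m := by
    intro m _
    rw [conj_rightUnitor_comp]
    exact conj_rightUnitor (X := P.H) m.1
  have h₂ : ∀ m : (unit 𝓕).toCStarAlg.mult, m.1 ∈ (unit 𝓕).alg →
      𝓕.conj ((ρ_ _).hom ≫ (ρ_ P.H).hom) (inc₂ P (unit 𝓕) m.1) = f.val m := by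
    intro m _
    rw [conj_rightUnitor_comp, ← conj_braiding hc, ← conj_comp, braiding_rightUnitor, hf]
  obtain ⟨h, hh, -, -⟩ := exists_boxDesc hc (𝟙 P) f ((ρ_ _).hom ≫ (ρ_ P.H).hom)
    (isCoisometry_of_unitary ((rightUnitor_unitary _).comp (rightUnitor_unitary _))) h₁ h₂
  exact ⟨h, hh⟩

/-- The tensor product of `A(C)` with its inclusions. -/
def inclusionTensor (hc : IsBiRegularBraiding 𝓕) : InclusionTensor (AObj 𝓕) where
  box := box hc
  unit := unit 𝓕
  inl := inl hc
  inr := inr hc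
  hom_ext := box_hom_ext hc
  exists_map := exists_boxMap hc
  exists_assoc := exists_boxAssoc hc
  exists_assoc_inv := exists_boxAssoc_inv hc
  unit_hom_ext := unit_hom_ext
  exists_leftUnitor := exists_boxLeftUnitor hc
  exists_rightUnitor := exists_boxRightUnitor hc

end AObj

open AObj

variable [MonoidalWStarCategory C]

lemma prodSpan_eq {P Q R : AObj 𝓕} (f : P ⟶ R) (g : Q ⟶ R)
    {i : (𝓕.obj P.H →L[ℂ] 𝓕.obj P.H) → 𝓕.obj R.H →L[ℂ] 𝓕.obj R.H}
    {j : (𝓕.obj Q.H →L[ℂ] 𝓕.obj Q.H) → 𝓕.obj R.H →L[ℂ] 𝓕.obj R.H}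
    (hf : ∀ m : P.toCStarAlg.mult, m.1 ∈ P.alg → f.val m = i m.1)
    (hg : ∀ m : Q.toCStarAlg.mult, m.1 ∈ Q.alg → g.val m = j m.1) :
    CStarAlg.prodSpan f.toHom g.toHom =
      closedSpan {T | ∃ a ∈ P.alg, ∃ b ∈ Q.alg, T = i a * j b} := by
  refine congrArg closedSpan (Set.ext fun T => ⟨?_, ?_⟩)
  · rintro ⟨a, ha, b, hb, rfl⟩
    exact ⟨a.1, ha, b.1, hb, congrArg₂ (· * ·) (hf a ha) (hg b hb)⟩
  · rintro ⟨a, ha, b, hb, rfl⟩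
    let a' : P.toCStarAlg.mult := ⟨a, P.toCStarAlg.alg_le_mult ha⟩
    let b' : Q.toCStarAlg.mult := ⟨b, Q.toCStarAlg.alg_le_mult hb⟩
    exact ⟨a', ha, b', hb, congrArg₂ (· * ·) (hf a' ha).symm (hg b' hb).symm⟩

variable [BraidedCategory C]

/-- The structure of a monoidal category of `C^*`-algebras on `A(C)`. -/
def boxMonoidalCategory (hc : IsBiRegularBraiding 𝓕) : BoxMonoidalCategory 𝓕 where
  isObj_box := isObj_box hc
  monoidal := (inclusionTensor hc).monoidal
  unit_eq := rfl
  tensorObj_eq _ _ := rfl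
  cstar :=
    letI := (inclusionTensor hc).monoidal
    { 𝔄 := AObj.forget 𝓕
      faithful := ⟨fun h => Hom.ext' h⟩
      ι₁ := inl hc
      ι₂ := inr hc
      ι₁_natural := (inclusionTensor hc).inl_map
      ι₂_natural := (inclusionTensor hc).inr_map
      crossed := fun P Q => (prodSpan_eq (inl hc P Q) (inr hc P Q) (fun m _ => inl_val hc P Q m)
        (fun m _ => inr_val hc P Q m)).symm
      ι₁_ι₁ := (inclusionTensor hc).inl_inl_assocHom
      ι₂_ι₁ := (inclusionTensor hc).inr_inl_assocHom
      ι₂_ι₂ := (inclusionTensor hc).inr_assocHom }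
  functor_eq := rfl
  ι₁_eq P Q m _ := (congrArg (fun f => Hom.val f m) (Category.comp_id (inl hc P Q))).trans
    (inl_val hc P Q m)
  ι₂_eq P Q m _ := (congrArg (fun f => Hom.val f m) (Category.comp_id (inr hc P Q))).trans
    (inr_val hc P Q m)

end Monoidal

/-! ### The bialgebra `A(F)` -/

section Bialgebra

open CStarAlg (closedSpan_le subset_closedSpan isClosed_closedSpan)
open AObj KetBra FibreFunctor MonoidalWStarCategory BraidedCategory

variable {C : Type u} [Category.{v} C] [WStarCategory C] [MonoidalCategory C]
  {𝓕 : FibreFunctor.{u, v, w} C}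

lemma closedSpan_mul_eq {X Y Z : C} {A : Submodule ℂ (𝓕.obj Y →L[ℂ] 𝓕.obj Y)}
    {B : Submodule ℂ (𝓕.obj Z →L[ℂ] 𝓕.obj Z)}
    (i : (𝓕.obj Y →L[ℂ] 𝓕.obj Y) → 𝓕.obj X →L[ℂ] 𝓕.obj X)
    (j : (𝓕.obj Z →L[ℂ] 𝓕.obj Z) → 𝓕.obj X →L[ℂ] 𝓕.obj X) :
    closedSpan {T | ∃ a ∈ A, ∃ b ∈ B, T = i a * j b} =
      ((OpSpace.span (j '' B)).comp (OpSpace.span (i '' A)) : OpSpace 𝓕 X X).carrier := by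
  rw [OpSpace.comp_span]
  refine congrArg closedSpan (Set.ext fun T => ⟨?_, ?_⟩)
  · rintro ⟨a, ha, b, hb, rfl⟩
    exact ⟨_, ⟨b, hb, rfl⟩, _, ⟨a, ha, rfl⟩, rfl⟩
  · rintro ⟨_, ⟨b, hb, rfl⟩, _, ⟨a, ha, rfl⟩, rfl⟩
    exact ⟨a, ha, b, hb, rfl⟩

variable [MonoidalWStarCategory C] [BraidedCategory C]

/-- `A(F)` is an object: the pentagon equation and regularity make it a selfadjoint algebra, and it
is nondegenerate because `F` is invertible. -/
lemma isObj_legAlgebra (hc : IsBiRegularBraiding 𝓕) {L : C} {F : L ⊗ L ⟶ L ⊗ L}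
    (hF : IsMultiplicativeUnitary F) (hreg : IsBiRegular 𝓕 F) :
    IsObj 𝓕 L (legAlgebra 𝓕 F) where
  isCStar := by
    have hR := OpCat.regularMultiplicativeUnitary hF hreg
    have hnd := (OpSpace.nondegenerate_ket (𝓕 := 𝓕) L L).comp
      ((OpSpace.Nondegenerate.of_iso (OpCat.unitaryIso F hF.unitary)).comp
        (OpSpace.nondegenerate_bra L))
    rw [← OpCat.slice_of_carrier]
    exact OpSpace.isNondegCStarSubalgebra (hR.slice_comp_slice (OpCat.regularBraiding hc))
      (hR.dag_slice (OpCat.regularBraiding hc)) hnd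
  exists_leg := ⟨L, F, rfl⟩

/-- The object `(L, A(F))`. -/
abbrev legObj (hc : IsBiRegularBraiding 𝓕) {L : C} {F : L ⊗ L ⟶ L ⊗ L}
    (hF : IsMultiplicativeUnitary F) (hreg : IsBiRegular 𝓕 F) : AObj 𝓕 :=
  ⟨L, legAlgebra 𝓕 F, isObj_legAlgebra hc hF hreg⟩

variable (hc : IsBiRegularBraiding 𝓕) {L : C} {F : L ⊗ L ⟶ L ⊗ L}
    (hF : IsMultiplicativeUnitary F) (hreg : IsBiRegular 𝓕 F)

lemma legObj_space : (legObj hc hF hreg).space =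
    slice (K := (⟨L⟩ : OpCat 𝓕)) (H := ⟨L⟩) (OpCat.ofIso (OpCat.unitaryIso F hF.unitary)).hom :=
  OpSpace.ext (OpCat.slice_of_carrier F).symm

/-- The space of operators `F (a ⊗ id) F^*` with `a ∈ A(F)`. -/
abbrev comulSpace : (⟨L⟩ : OpCat 𝓕) ⊗ ⟨L⟩ ⟶ ⟨L⟩ ⊗ ⟨L⟩ :=
  (OpCat.ofIso (OpCat.unitaryIso F hF.unitary)).inv ≫ (legObj hc hF hreg).space ▷ ⟨L⟩ ≫
    (OpCat.ofIso (OpCat.unitaryIso F hF.unitary)).hom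

lemma comulSpace_eq : comulSpace hc hF hreg =
    OpSpace.span (𝓕.conj F '' (legObj hc hF hreg).alg) := by
  change OpSpace.comp (OpSpace.of (WStarCategory.adj F))
    (OpSpace.comp (OpSpace.span _) (OpSpace.of F)) = _
  simp only [OpSpace.of, OpSpace.comp_span, OpSpace.compSet, Set.image2_singleton_left,
    Set.image2_singleton_right, Set.image_image, 𝓕.map_adj]
  rfl

lemma spaceR_comp_comulSpace :
    spaceR (legObj hc hF hreg) (legObj hc hF hreg) ≫ comulSpace hc hF hreg =
      boxSpace (legObj hc hF hreg) (legObj hc hF hreg) := by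
  have hR := OpCat.regularMultiplicativeUnitary hF hreg
  rw [boxSpace, comulSpace, spaceR, legObj_space]
  exact hR.incR_comp_comul (OpCat.regularBraiding hc)

lemma space_comp_comulSpace :
    (legObj hc hF hreg).space ▷ ⟨L⟩ ≫ comulSpace hc hF hreg =
      boxSpace (legObj hc hF hreg) (legObj hc hF hreg) := by
  have hR := OpCat.regularMultiplicativeUnitary hF hreg
  rw [boxSpace, spaceR_comm hc, comulSpace, spaceR, legObj_space]
  exact hR.slice_comp_comul (OpCat.regularBraiding hc)

lemma boxSpace_comp_comulSpace :
    boxSpace (legObj hc hF hreg) (legObj hc hF hreg) ≫ comulSpace hc hF hreg =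
      boxSpace (legObj hc hF hreg) (legObj hc hF hreg) := by
  have h := space_comp_comulSpace hc hF hreg
  nth_rewrite 1 [boxSpace]
  rw [Category.assoc, h, boxSpace, ← Category.assoc, spaceR_comp_spaceR]

/-- The comultiplication `Δ(a) = F (a ⊗ id) F^*`. -/
lemma exists_comul : ∃ Δ : legObj hc hF hreg ⟶ box hc (legObj hc hF hreg) (legObj hc hF hreg),
    ∀ m, Δ.val m = 𝓕.conj F m.1 := by
  have hnd : closedSpan (Set.image2 (fun a b => 𝓕.conj F a * b) (legObj hc hF hreg).alg
      (boxAlg (legObj hc hF hreg) (legObj hc hF hreg))) =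
      boxAlg (legObj hc hF hreg) (legObj hc hF hreg) := by
    rw [← boxSpace_carrier]
    exact (OpSpace.closedSpan_image2_mul (boxSpace (legObj hc hF hreg) (legObj hc hF hreg)) _
      (comulSpace_eq hc hF hreg)).trans
      (congrArg OpSpace.carrier (boxSpace_comp_comulSpace hc hF hreg))
  exact exists_hom (P := legObj hc hF hreg)
    (Q := box hc (legObj hc hF hreg) (legObj hc hF hreg)) F
    (isCoisometry_of_unitary hF.unitary)
    (fun a _ => intertwines_of_iso (OpCat.unitaryIso F hF.unitary) hF.unitary a) hnd

/-- `A(F) ⊠ A(F) = [Δ(A(F)) (A(F) ⊠ 1)]`. -/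
lemma podles₁ {Δ : legObj hc hF hreg ⟶ box hc (legObj hc hF hreg) (legObj hc hF hreg)}
    (hΔ : ∀ m, Δ.val m = 𝓕.conj F m.1) :
    boxAlg (legObj hc hF hreg) (legObj hc hF hreg) =
      CStarAlg.prodSpan Δ.toHom (inl hc (legObj hc hF hreg) (legObj hc hF hreg)).toHom := by
  rw [prodSpan_eq _ _ (fun m _ => hΔ m) (fun m _ => inl_val hc _ _ m)]
  refine Eq.trans ?_ (closedSpan_mul_eq (A := legAlgebra 𝓕 F) (B := legAlgebra 𝓕 F) (𝓕.conj F)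
      (inc₁ (legObj hc hF hreg) (legObj hc hF hreg))).symm
  rw [← boxSpace_carrier, ← space_comp_comulSpace, comulSpace_eq]
  rfl

/-- `A(F) ⊠ A(F) = [Δ(A(F)) (1 ⊠ A(F))]`. -/
lemma podles₂ {Δ : legObj hc hF hreg ⟶ box hc (legObj hc hF hreg) (legObj hc hF hreg)}
    (hΔ : ∀ m, Δ.val m = 𝓕.conj F m.1) :
    boxAlg (legObj hc hF hreg) (legObj hc hF hreg) =
      CStarAlg.prodSpan Δ.toHom (inr hc (legObj hc hF hreg) (legObj hc hF hreg)).toHom := by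
  rw [prodSpan_eq _ _ (fun m _ => hΔ m) (fun m _ => inr_val hc _ _ m)]
  refine Eq.trans ?_ (closedSpan_mul_eq (A := legAlgebra 𝓕 F) (B := legAlgebra 𝓕 F) (𝓕.conj F)
      (inc₂ (legObj hc hF hreg) (legObj hc hF hreg))).symm
  rw [← boxSpace_carrier, ← spaceR_comp_comulSpace, comulSpace_eq, spaceR_eq]
  rfl

end Bialgebra

/-! ### Coassociativity -/

section Coassociativity

open AObj FibreFunctor MonoidalWStarCategory BraidedCategory

variable {C : Type u} [Category.{v} C] [MonoidalCategory C] [BraidedCategory C]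

/-- The braiding on the second and third tensor factors. -/
abbrev braiding₂₃ (L : C) : (L ⊗ L) ⊗ L ⟶ (L ⊗ L) ⊗ L :=
  (α_ L L L).hom ≫ L ◁ (β_ L L).hom ≫ (α_ L L L).inv

/-- The inverse braiding on the second and third tensor factors. -/
abbrev braidingInv₂₃ (L : C) : (L ⊗ L) ⊗ L ⟶ (L ⊗ L) ⊗ L :=
  (α_ L L L).hom ≫ L ◁ (β_ L L).inv ≫ (α_ L L L).inv

lemma braidingInv₂₃_braiding₂₃_assoc (L : C) {Z : C} (h : (L ⊗ L) ⊗ L ⟶ Z) :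
    braidingInv₂₃ L ≫ braiding₂₃ L ≫ h = h := by
  simp

/-- `F₂₃` conjugated by the braiding of the first two factors is `F₁₂` conjugated by the inverse
braiding of the last two factors: both let `F` act on the outer factors. -/
lemma braiding_conj_eq {L : C} (F : L ⊗ L ⟶ L ⊗ L) :
    (β_ L L).hom ▷ L ≫ ((α_ L L L).hom ≫ L ◁ F ≫ (α_ L L L).inv) ≫ (β_ L L).inv ▷ L =
      braidingInv₂₃ L ≫ F ▷ L ≫ braiding₂₃ L := by
  have h : braiding₂₃ L ≫ (β_ L L).hom ▷ L ≫ (α_ L L L).hom ≫ L ◁ F ≫ (α_ L L L).inv =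
      F ▷ L ≫ braiding₂₃ L ≫ (β_ L L).hom ▷ L := by
    have := braiding_naturality_left F L
    rw [braiding_tensor_left_hom] at this
    simp only [Category.assoc] at this ⊢
    rw [← cancel_mono (α_ L L L).hom]
    simpa using this.symm
  rw [← braidingInv₂₃_braiding₂₃_assoc L (_ ▷ L ≫ _)]
  congr 1
  rw [← cancel_mono ((β_ L L).hom ▷ L)]
  simpa using h

variable [WStarCategory C] [MonoidalWStarCategory C] {𝓕 : FibreFunctor.{u, v, w} C}
  (hc : IsBiRegularBraiding 𝓕) {P : AObj 𝓕} {F : P.H ⊗ P.H ⟶ P.H ⊗ P.H} {Δ : P ⟶ box hc P P}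

/-- The values of `id ⊠ Δ`. -/
lemma map_id_comul_val (hF : IsUnitaryMor F) (hΔ : ∀ m, Δ.val m = 𝓕.conj F m.1)
    (m : (box hc P P).toCStarAlg.mult) :
    Hom.val ((inclusionTensor hc).map (𝟙 P) Δ) m =
      𝓕.conj ((α_ P.H P.H P.H).hom ≫ P.H ◁ F) m.1 := by
  have h₁ : ∀ m : P.toCStarAlg.mult, m.1 ∈ P.alg →
      𝓕.conj ((α_ P.H P.H P.H).hom ≫ P.H ◁ F) (inc₁ P P m.1) =
        (inl hc P (box hc P P)).val m := by
    intro m _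
    rw [inl_val, inc₁, conj_unitary_comp (associator_unitary _ _ _) _
      (𝓕.map_associator_amp m.1 _ _), ← Category.comp_id (P.H ◁ F),
      conj_unitary_comp (hF.whiskerLeft _) _ (b := m.1) ?_, conj_id]
    · rfl
    · rw [𝓕.map_whiskerLeft]
      exact 𝓕.wl_comp_amp _ _
  have h₂ : ∀ m : P.toCStarAlg.mult, m.1 ∈ P.alg →
      𝓕.conj ((α_ P.H P.H P.H).hom ≫ P.H ◁ F) (inc₂ P P m.1) =
        (Δ ≫ inr hc P (box hc P P)).val m := by
    intro m _
    rw [← conj_braiding hc, conj_conj, ← Category.assoc, braiding_associator, Category.assoc,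
      conj_unitary_comp (isUnitaryMor_slide (hc.unitary _ _).inv) _ (map_slide _ _),
      ← braiding_naturality_left, ← conj_conj, ← hΔ, conj_braiding hc P (box hc P P)]
    exact (inr_val hc P (box hc P P) (Δ.toHom.toHom m)).symm
  obtain ⟨h, hl, hr, hv⟩ := exists_boxDesc hc (inl hc P (box hc P P)) (Δ ≫ inr hc P (box hc P P))
    _ (isCoisometry_of_unitary ((associator_unitary _ _ _).comp (hF.whiskerLeft _))) h₁ h₂
  rw [← hv]
  congr 1
  refine box_hom_ext hc ?_ ?_
  · exact ((inclusionTensor hc).inl_map _ _).trans ((Category.id_comp _).trans hl.symm)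
  · exact ((inclusionTensor hc).inr_map _ _).trans hr.symm

/-- The values of `Δ ⊠ id`, up to the associator. -/
lemma map_comul_id_assoc_val (hF : IsUnitaryMor F) (hΔ : ∀ m, Δ.val m = 𝓕.conj F m.1)
    (m : (box hc P P).toCStarAlg.mult) :
    Hom.val ((inclusionTensor hc).map Δ (𝟙 P) ≫ (inclusionTensor hc).assocHom P P P) m =
      𝓕.conj (braiding₂₃ P.H ≫ F ▷ P.H ≫ (α_ P.H P.H P.H).hom) m.1 := by
  have hα := associator_unitary P.H P.H P.H
  have hb : IsUnitaryMor (braiding₂₃ P.H) := isUnitaryMor_slide (hc.unitary _ _)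
  -- `k : P ⊠ P ⟶ P ⊠ (P ⊠ P)` is the restriction of the associator to its first leg.
  obtain ⟨k, hk₁, hk₂, hk⟩ := exists_inlAssoc hc P P P
  have hk' : inl hc (box hc P P) P ≫ (inclusionTensor hc).assocHom P P P = k := by
    refine box_hom_ext hc ?_ ?_
    · exact ((inclusionTensor hc).inl_inl_assocHom P P P).trans hk₁.symm
    · exact ((inclusionTensor hc).inr_inl_assocHom P P P).trans hk₂.symm
  have h₁ : ∀ m : P.toCStarAlg.mult, m.1 ∈ P.alg →
      𝓕.conj (braiding₂₃ P.H ≫ F ▷ P.H ≫ (α_ P.H P.H P.H).hom) (inc₁ P P m.1) =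
        (Δ ≫ k).val m := by
    intro m _
    rw [inc₁, conj_unitary_comp hb _ (map_slide _ _), ← conj_conj, ← hΔ]
    exact (hk (Δ.toHom.toHom m)).symm
  have h₂ : ∀ m : P.toCStarAlg.mult, m.1 ∈ P.alg →
      𝓕.conj (braiding₂₃ P.H ≫ F ▷ P.H ≫ (α_ P.H P.H P.H).hom) (inc₂ P P m.1) =
        (inr hc P P ≫ inr hc P (box hc P P)).val m := by
    intro m _
    have e : (β_ P.H P.H).hom ▷ P.H ≫ braiding₂₃ P.H ≫ F ▷ P.H ≫ (α_ P.H P.H P.H).hom =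
        ((α_ P.H P.H P.H).hom ≫ P.H ◁ F) ≫ (β_ P.H (P.H ⊗ P.H)).hom ≫ (α_ P.H P.H P.H).hom := by
      have := braiding_naturality_right P.H F
      rw [braiding_tensor_right_hom] at this ⊢
      simp only [Category.assoc] at this ⊢
      rw [reassoc_of% this]
      simp
    rw [← conj_braiding hc, conj_conj, e, Category.assoc,
      conj_unitary_comp hα _ (𝓕.map_associator_amp m.1 _ _),
      conj_unitary_comp (hF.whiskerLeft _) _ (b := m.1)
        (by rw [𝓕.map_whiskerLeft]; exact 𝓕.wl_comp_amp _ _), conj_associator_inc₂_inc₂ hc P P P,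
      ← inr_val hc P P, conj_braiding hc P (box hc P P)]
    exact (inr_val hc P (box hc P P) ((inr hc P P).toHom.toHom m)).symm
  obtain ⟨h, hl, hr, hv⟩ := exists_boxDesc hc (Δ ≫ k) (inr hc P P ≫ inr hc P (box hc P P))
    _ (isCoisometry_of_unitary (hb.comp ((hF.whiskerRight _).comp hα))) h₁ h₂
  rw [← hv]
  congr 1
  refine box_hom_ext hc ?_ ?_
  · refine ((inclusionTensor hc).inl_map_assoc _ _ _).trans (Eq.trans ?_ hl.symm)
    exact congrArg (Δ ≫ ·) hk'
  · refine ((inclusionTensor hc).inr_map_assoc _ _ _).trans ((Category.id_comp _).trans ?_)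
    exact ((inclusionTensor hc).inr_assocHom P P P).trans hr.symm

/-- The pentagon equation makes `Δ(a) = F (a ⊗ 1) F^*` coassociative: both iterations compress
`a ⊗ 1 ⊗ 1` along products of copies of `F`, and the factors by which these products differ do not
act on the first tensor factor. -/
lemma comul_coassoc (hF : IsMultiplicativeUnitary F) (hΔ : ∀ m, Δ.val m = 𝓕.conj F m.1) :
    Δ ≫ (inclusionTensor hc).map Δ (𝟙 P) ≫ (inclusionTensor hc).assocHom P P P =
      Δ ≫ (inclusionTensor hc).map (𝟙 P) Δ := by
  have hα := associator_unitary P.H P.H P.H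
  refine Hom.ext_alg fun m _ => ?_
  have h₁ : Hom.val (Δ ≫ (inclusionTensor hc).map Δ (𝟙 P) ≫
      (inclusionTensor hc).assocHom P P P) m = 𝓕.conj (F ▷ P.H ≫ braiding₂₃ P.H ≫ F ▷ P.H ≫
        (α_ P.H P.H P.H).hom) (𝓕.amp m.1 P.H) := by
    rw [← conj_conj, ← hΔ]
    exact map_comul_id_assoc_val hc hF.unitary hΔ (Δ.toHom.toHom m)
  have h₂ : Hom.val (Δ ≫ (inclusionTensor hc).map (𝟙 P) Δ) m =
      𝓕.conj (F ▷ P.H ≫ (α_ P.H P.H P.H).hom ≫ P.H ◁ F) (𝓕.amp m.1 P.H) := by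
    rw [← conj_conj, ← hΔ]
    exact map_id_comul_val hc hF.unitary hΔ (Δ.toHom.toHom m)
  have e : F ▷ P.H ≫ (α_ P.H P.H P.H).hom ≫ P.H ◁ F =
      ((α_ P.H P.H P.H).hom ≫ P.H ◁ F ≫ (α_ P.H P.H P.H).inv) ≫ braidingInv₂₃ P.H ≫
        F ▷ P.H ≫ braiding₂₃ P.H ≫ F ▷ P.H ≫ (α_ P.H P.H P.H).hom := by
    have hp := hF.pentagon
    dsimp only at hp
    have hb := braiding_conj_eq F
    rw [← cancel_mono (α_ P.H P.H P.H).inv]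
    simp only [Category.assoc, Iso.hom_inv_id, Category.comp_id] at hp hb ⊢
    rw [hp, reassoc_of% hb]
  have hm := map_slide (𝓕 := 𝓕) F m.1
  refine h₁.trans (Eq.trans ?_ h₂.symm)
  rw [e, conj_unitary_comp (isUnitaryMor_slide hF.unitary) _ hm,
    conj_unitary_comp (isUnitaryMor_slide (hc.unitary _ _).inv) _ (map_slide _ _)]

end Coassociativity

end BraidedMU

end

theorem mainTheorem11 {C : Type u} [Category.{v} C] [BraidedMU.WStarCategory C]
    [MonoidalCategory C] [BraidedMU.MonoidalWStarCategory C] [BraidedCategory C]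
    (𝓕 : BraidedMU.FibreFunctor.{u, v, w} C) (hc : BraidedMU.IsBiRegularBraiding 𝓕)
    {L : C} (F : L ⊗ L ⟶ L ⊗ L) (hF : BraidedMU.IsMultiplicativeUnitary F)
    (hreg : BraidedMU.IsBiRegular 𝓕 F) :
    ∃ (B : BraidedMU.BoxMonoidalCategory 𝓕)
      (hA : BraidedMU.IsObj 𝓕 L (BraidedMU.legAlgebra 𝓕 F)),
      letI := B.monoidal
      let A : BraidedMU.AObj 𝓕 := ⟨L, BraidedMU.legAlgebra 𝓕 F, hA⟩
      ∃ Δ : A ⟶ A ⊗ A,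
        (∀ m : A.toCStarAlg.mult, m.1 ∈ A.alg →
          BraidedMU.AObj.Hom.val (Δ ≫ eqToHom (B.tensorObj_eq A A)) m =
            𝓕.map F ∘L 𝓕.amp (X := L) (Y := L) m.1 L ∘L
              ContinuousLinearMap.adjoint (𝓕.map F)) ∧
        B.cstar.IsBiSimplifiableBialgebra Δ := by
  obtain ⟨Δ, hΔ⟩ := BraidedMU.exists_comul hc hF hreg
  let _ := (BraidedMU.boxMonoidalCategory hc).monoidal
  refine ⟨BraidedMU.boxMonoidalCategory hc, BraidedMU.isObj_legAlgebra hc hF hreg, Δ,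
    fun m _ => ?_, ⟨?_, ?_, ?_⟩⟩
  · exact (congrArg (fun f => BraidedMU.AObj.Hom.val f m) (Category.comp_id Δ)).trans (hΔ m)
  · exact BraidedMU.comul_coassoc hc (P := BraidedMU.legObj hc hF hreg) hF hΔ
  · exact BraidedMU.podles₁ hc hF hreg hΔ
  · exact BraidedMU.podles₂ hc hF hreg hΔ
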